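/- Let $\delta \in C_c^\infty(\mathbb R^3)$ be real-valued, and consider the regularized relativistic Vlasov–Klein–Gordon system $$\partial_t f + \hat v\cdot\partial_x f - \partial_x u\cdot\partial_v f = 0,\qquad \partial_t^2 u - \Delta u + u = -\rho*\delta,$$ $$\rho(t,x)=\int_{\mathbb R^3} f(t,x,v)\,dv,\qquad \hat v=\frac{v}{\sqrt{1+|v|^2}},$$ for $f=f(t,x,v)\in\mathbb R$ and $u=u(t,x)\in\mathbb R$ with $t\ge 0$, $x,v\in\mathbb R^3$, where $*$ denotes convolution in the space variable $x$ and time derivatives at $t=0$ are one-sided. A pair $(f,u)$ is called a global classical solution if $f\in C^1([0,\infty)\times\mathbb R^6)$, $u\in C^2([0,\infty)\times\mathbb R^3)$, the integrals defining $\rho(t,x)$ and $(\rho(t)*\delta)(x)$ converge absolutely for all $t\ge 0$, $x\in\mathbb R^3$, and the equations hold for all $t\ge 0$, $x,v\in\mathbb R^3$. For all initial data $0\le f^\circ\in C_c^1(\mathbb R^6)$, $u_1^\circ\in C_b^3(\mathbb R^3)$ and $u_2^\circ\in C_b^2(\mathbb R^3)$ (where $C_b^k$ denotes the real-valued $C^k$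 functions that are bounded together with all their derivatives up to order $k$) there exists a unique global classical solution $(f,u)$ of this system satisfying the initial conditions $f(0)=f^\circ$, $u(0)=u_1^\circ$, $\partial_t u(0)=u_2^\circ$; moreover $f\ge 0$. Uniqueness holds among all global classical solutions with these initial data, without any assumption on the sign of $f$. -/

import Mathlib

open Set MeasureTheory
open scoped ContDiff Convolution

noncomputable section

namespace VlasovKleinGordon

/-- Euclidean three-space `ℝ³`, used both for positions and for momenta. -/
abbrev E3 : Type := EuclideanSpace ℝ (Fin 3)

/-- `g ∈ C_b^k(ℝ³)`: `g` is `k` times continuously differentiable, and `g` and all its derivatives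
up to order `k` are bounded. -/
structure IsCb (k : ℕ) (g : E3 → ℝ) : Prop where
  contDiff : ContDiff ℝ k g
  bounded : ∀ i ≤ k, ∃ C : ℝ, ∀ x, ‖iteratedFDeriv ℝ i g x‖ ≤ C

/-- The relativistic velocity `v / √(1 + |v|²)` of a particle with momentum `v`. -/
def vhat (v : E3) : E3 := (Real.sqrt (1 + ‖v‖ ^ 2))⁻¹ • v

/-- The spatial density `ρ(t, x) = ∫ f(t, x, v) dv`. -/
def rho (f : ℝ → E3 → E3 → ℝ) (t : ℝ) (x : E3) : ℝ := ∫ v, f t x v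

/-- The spatial convolution `(ρ(t) ∗ δ)(x) = ∫ ρ(t, y) δ(x - y) dy`. -/
def rhoConv (δ : E3 → ℝ) (f : ℝ → E3 → E3 → ℝ) (t : ℝ) (x : E3) : ℝ :=
  (rho f t ⋆[ContinuousLinearMap.mul ℝ ℝ, volume] δ) x

/-- `(f, u)` is a global classical solution of the relativistic Vlasov-Klein-Gordon system
regularized by the kernel `δ`, with `f ∈ C¹([0,∞) × ℝ⁶)` and `u ∈ C²([0,∞) × ℝ³)`.
Only the values of `f` and `u` at times `t ≥ 0` matter; time derivatives are taken
within `[0,∞)`, so they are one-sided at `t = 0`. -/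
structure IsSolution (δ : E3 → ℝ) (f : ℝ → E3 → E3 → ℝ) (u : ℝ → E3 → ℝ) : Prop where
  contDiffOn_f :
    ContDiffOn ℝ 1 (fun p : ℝ × E3 × E3 => f p.1 p.2.1 p.2.2) (Ici 0 ×ˢ univ)
  contDiffOn_u : ContDiffOn ℝ 2 (fun p : ℝ × E3 => u p.1 p.2) (Ici 0 ×ˢ univ)
  /-- The integral that defines `ρ(t, x)` converges. -/
  integrable : ∀ t, 0 ≤ t → ∀ x, Integrable (f t x)
  /-- The integral that defines `(ρ(t) ∗ δ)(x)` converges. -/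
  convolutionExists : ∀ t, 0 ≤ t → ∀ x,
    ConvolutionExistsAt (rho f t) δ x (ContinuousLinearMap.mul ℝ ℝ) volume
  /-- `∂ₜ f + v̂ · ∂ₓ f - ∂ₓ u · ∂ᵥ f = 0`. -/
  vlasov : ∀ t, 0 ≤ t → ∀ x v,
    derivWithin (fun s => f s x v) (Ici 0) t
      + inner ℝ (vhat v) (gradient (fun y => f t y v) x)
      - inner ℝ (gradient (u t) x) (gradient (f t x) v) = 0
  /-- `∂ₜ² u - Δ u + u = -ρ ∗ δ`. -/
  kleinGordon : ∀ t, 0 ≤ t → ∀ x,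
    iteratedDerivWithin 2 (fun s => u s x) (Ici 0) t
      - (Laplacian.laplacian (u t) : E3 → ℝ) x + u t x = -rhoConv δ f t x

/-- The initial conditions `f(0) = f₀`, `u(0) = u₁`, `∂ₜ u(0) = u₂`. -/
structure HasInitialData (f₀ : E3 → E3 → ℝ) (u₁ u₂ : E3 → ℝ)
    (f : ℝ → E3 → E3 → ℝ) (u : ℝ → E3 → ℝ) : Prop where
  f_zero : ∀ x v, f 0 x v = f₀ x v
  u_zero : ∀ x, u 0 x = u₁ x
  deriv_u_zero : ∀ x, derivWithin (fun s => u s x) (Ici 0) 0 = u₂ x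

end VlasovKleinGordon

end

/-! Existence is proved in Lagrangian form. The Vlasov equation says that `f` is constant along the
characteristics `x' = v̂`, `v' = -∂ₓu`, so `f(t)` is the initial density composed with the inverse
flow. The characteristic field is divergence free, hence the flow preserves Lebesgue measure and `(ρ
∗ δ)(t, x) = ∫ f₀(z) δ(x - X(t, z)) dz`, where `X` is the position component of the flow.

The linear Klein-Gordon equation is solved explicitly: `kgSol g`, with data `0, g`, is Kirchhoff's
spherical mean minus a correction with a Bessel kernel. With `W = kgSol δ`, Duhamel's principle
gives `u(t, x) = U₀(t, x) - ∫₀ᵗ ∫ f₀(z) W(t - s, x - X(s, z)) dz ds`, where `U₀` solves the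
homogeneous equation with the given data. All derivatives fall on `U₀` and `W`, so `u` is `C²`
although `X` is only known to be continuous. Second spatial derivatives of `U₀` and `W` are bounded
locally uniformly in time (`HessBounded`), so the force is Lipschitz in the position and in the past
trajectories. What remains is an ordinary differential equation with memory in the Banach space of
continuous maps on a ball containing the support of `f₀`. A contraction in an exponentially weighted
norm solves it for all times (`exists_hasDerivAt_of_historyLipschitz`, `exists_selfconsistent`), and
`LocUnifLipschitz.exists_flow` yields a `C¹` flow. Nonnegativity is immediate, since `f` takes only
values of `f₀`.

For uniqueness, let `(g, w)` be another solution. Speeds are at most one and the force is bounded on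
compact sets, so `g` has compact support locally uniformly in time (`exists_support_bound`). The
differences `D = g - f` and `h = w - u` satisfy a transport equation with force `-∂ₓw` and source
`∂ₓh · ∂ᵥf`, and a Klein-Gordon equation with source `-∫ D(t, z) δ(x - z.1) dz`. The `L²` norm of
`D` and the energy of `h`, localized to a backward cone because `h` need not decay, bound each
other's growth, and Grönwall's inequality gives zero (`eq_zero_of_linearized`). The derivative `∂ᵥf`
is that of the constructed solution, so no sign condition on `g` is involved. -/

noncomputable section

namespace VlasovKleinGordon

open Filter Topology Metric

/-! ### Differentiation of integrals with respect to parameters. -/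

section ParametricIntegrals

variable {H Y F : Type} [NormedAddCommGroup H] [NormedSpace ℝ H] [LocallyCompactSpace H]
  [NormedAddCommGroup F] [NormedSpace ℝ F]

/-- Differentiation under the integral sign over a compact set, for continuous integrands with
a jointly continuous derivative. -/
theorem hasFDerivAt_setIntegral_of_continuous [TopologicalSpace Y] [MeasurableSpace Y]
    [OpensMeasurableSpace Y] [SecondCountableTopology Y] {μ : Measure Y}
    [IsLocallyFiniteMeasure μ] {s : Set Y} (hs : IsCompact s) (hsm : MeasurableSet s)
    {f : H → Y → F} {f' : H → Y → H →L[ℝ] F}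
    (hf : Continuous f.uncurry) (hf' : Continuous f'.uncurry)
    (hd : ∀ x, ∀ y ∈ s, HasFDerivAt (fun x => f x y) (f' x y) x) (x₀ : H) :
    HasFDerivAt (fun x => ∫ y in s, f x y ∂μ) (∫ y in s, f' x₀ y ∂μ) x₀ := by
  rcases exists_compact_mem_nhds x₀ with ⟨U, U_cpct, U_nhds⟩
  rcases (U_cpct.prod hs).bddAbove_image hf'.norm.continuousOn with ⟨M, hM⟩
  have hc : ∀ x, Continuous (f x) := fun x => hf.comp (Continuous.prodMk_right x)
  have hc' : ∀ x, Continuous (f' x) := fun x => hf'.comp (Continuous.prodMk_right x)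
  have key : ∀ (G : Type) [NormedAddCommGroup G] (g : Y → G), Continuous g →
      AEStronglyMeasurable g (μ.restrict s) := fun G _ g hg => hg.aestronglyMeasurable
  refine hasFDerivAt_integral_of_dominated_of_fderiv_le (bound := fun _ => M) U_nhds
    (Eventually.of_forall fun x => key _ _ (hc x)) ?_ (key _ _ (hc' x₀)) ?_
    (integrableOn_const hs.measure_ne_top) ?_
  · exact (hc x₀).continuousOn.integrableOn_compact' hs hsm
  · filter_upwards [ae_restrict_mem hsm] with y hy x hx
    exact hM (mem_image_of_mem _ (Set.mk_mem_prod hx hy))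
  · filter_upwards [ae_restrict_mem hsm] with y hy x hx
    exact hd x y hy

/-- An integral over a compact set depends `C^n` on a parameter if the integrand is jointly
`C^n`. -/
theorem contDiff_setIntegral [NormedAddCommGroup Y] [NormedSpace ℝ Y] [MeasurableSpace Y]
    [OpensMeasurableSpace Y] [SecondCountableTopology Y] {μ : Measure Y}
    [IsLocallyFiniteMeasure μ] {s : Set Y} (hs : IsCompact s) (hsm : MeasurableSet s) (n : ℕ)
    {F : Type} [NormedAddCommGroup F] [NormedSpace ℝ F]
    {f : H → Y → F} (hf : ContDiff ℝ n f.uncurry) :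
    ContDiff ℝ n (fun x => ∫ y in s, f x y ∂μ) := by
  -- The target space must vary: the derivative of the integral is an integral with values in `H
  -- →L[ℝ] F`.
  induction n generalizing F with
  | zero =>
    rw [Nat.cast_zero, contDiff_zero] at hf ⊢
    exact continuous_parametric_integral_of_continuous hf hs
  | succ n ih =>
    have hfd : Differentiable ℝ f.uncurry := hf.differentiable (by simp)
    have hf' : ContDiff ℝ n (Function.uncurry fun x y =>
        (fderiv ℝ f.uncurry (x, y)).comp (ContinuousLinearMap.inl ℝ H Y)) := by
      have h1 : ContDiff ℝ n (fderiv ℝ f.uncurry) := hf.fderiv_right (by norm_cast)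
      exact (h1.comp (contDiff_id)).clm_comp contDiff_const
    have hd : ∀ x y, HasFDerivAt (fun x => f x y)
        ((fderiv ℝ f.uncurry (x, y)).comp (ContinuousLinearMap.inl ℝ H Y)) x := fun x y =>
      HasFDerivAt.comp (g := f.uncurry) (f := fun e => (e, y)) x (hfd (x, y)).hasFDerivAt
        (hasFDerivAt_prodMk_left x y)
    have hI := fun x => hasFDerivAt_setIntegral_of_continuous (μ := μ) hs hsm hf.continuous
      hf'.continuous (fun x y _ => hd x y) x
    push_cast
    rw [contDiff_succ_iff_fderiv]
    refine ⟨fun x => (hI x).differentiableAt, by simp, ?_⟩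
    have : fderiv ℝ (fun x => ∫ y in s, f x y ∂μ) = fun x => ∫ y in s,
        (fderiv ℝ f.uncurry (x, y)).comp (ContinuousLinearMap.inl ℝ H Y) ∂μ :=
      funext fun x => (hI x).fderiv
    rw [this]
    exact ih hf'

/-- Jointly `C^n` dependence of an interval integral on a parameter and a `C^n` upper end. -/
theorem contDiff_intervalIntegral {n : ℕ} {F : Type} [NormedAddCommGroup F] [NormedSpace ℝ F]
    {f : H → ℝ → F} (hf : ContDiff ℝ n f.uncurry) {a : H → ℝ} (ha : ContDiff ℝ n a) :
    ContDiff ℝ n (fun x => ∫ r in (0 : ℝ)..a x, f x r) := by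
  -- Substituting `r = a x * θ` moves the variable end into the integrand and leaves the fixed
  -- compact domain `[0, 1]`, for either sign of `a x`.
  have h : (fun x => ∫ r in (0 : ℝ)..a x, f x r) =
      fun x => a x • ∫ θ in Icc (0 : ℝ) 1, f x (a x * θ) := by
    ext x
    have h1 := intervalIntegral.smul_integral_comp_mul_left (a := 0) (b := 1) (f x) (a x)
    rw [mul_zero, mul_one] at h1
    rw [← h1, intervalIntegral.integral_of_le zero_le_one, integral_Icc_eq_integral_Ioc]
  rw [h]
  refine ha.smul (contDiff_setIntegral isCompact_Icc measurableSet_Icc n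
    (f := fun x θ => f x (a x * θ)) ?_)
  exact hf.comp (contDiff_fst.prodMk ((ha.comp contDiff_fst).mul contDiff_snd))

/-- Leibniz's rule with a variable upper end. -/
theorem hasFDerivAt_intervalIntegral_param [CompleteSpace F] {N : H → ℝ → F}
    {N' : H → ℝ → H →L[ℝ] F} (hN : Continuous N.uncurry) (hN' : Continuous N'.uncurry)
    (hd : ∀ p s, HasFDerivAt (fun p => N p s) (N' p s) p) (a : H →L[ℝ] ℝ) (p : H) :
    HasFDerivAt (fun p => ∫ s in (0 : ℝ)..a p, N p s)
      (a.smulRight (N p (a p)) + ∫ s in (0 : ℝ)..a p, N' p s) p := by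
  have hfix : ∀ t p, HasFDerivAt (fun p => ∫ s in (0 : ℝ)..t, N p s)
      (∫ s in (0 : ℝ)..t, N' p s) p := by
    intro t p
    have key := fun (a b : ℝ) => hasFDerivAt_setIntegral_of_continuous (μ := volume)
      (s := Icc a b) isCompact_Icc measurableSet_Icc hN hN' (fun p s _ => hd p s) p
    rcases le_total 0 t with ht | ht
    · simp only [intervalIntegral.integral_of_le ht, ← integral_Icc_eq_integral_Ioc]
      exact key 0 t
    · simp only [intervalIntegral.integral_of_ge ht, ← integral_Icc_eq_integral_Ioc]
      exact (key t 0).neg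
  have hvar : ∀ t p, HasFDerivAt (fun t => ∫ s in (0 : ℝ)..t, N p s)
      ((1 : ℝ →L[ℝ] ℝ).smulRight (N p t)) t := by
    intro t p
    have hc : Continuous (N p) := hN.comp (Continuous.prodMk_right p)
    exact (intervalIntegral.integral_hasDerivAt_right (hc.intervalIntegrable _ _)
      hc.stronglyMeasurable.stronglyMeasurableAtFilter hc.continuousAt).hasFDerivAt
  -- Parameter and upper end are first treated as independent. Both partial derivatives are jointly
  -- continuous, so the function of two variables is differentiable and can be composed with `p ↦
  -- (p, a p)`.
  have h := hasStrictFDerivAt_uncurry_coprod (𝕜 := ℝ) (u := (p, a p))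
    (f := fun p t => ∫ s in (0 : ℝ)..t, N p s)
    (f₁ := fun p t => ∫ s in (0 : ℝ)..t, N' p s)
    (f₂ := fun p t => (1 : ℝ →L[ℝ] ℝ).smulRight (N p t))
    (Eventually.of_forall fun v => hfix v.2 v.1) (Eventually.of_forall fun v => hvar v.2 v.1)
    (intervalIntegral.continuous_parametric_primitive_of_continuous hN').continuousAt
    ((ContinuousLinearMap.smulRightL ℝ ℝ F (1 : ℝ →L[ℝ] ℝ)).continuous.comp hN).continuousAt
  have h2 := h.hasFDerivAt.comp p ((hasFDerivAt_id p).prodMk a.hasFDerivAt)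
  refine HasFDerivAt.congr_fderiv h2 ?_
  ext v
  simp [Function.HasUncurry.uncurry, add_comm]

end ParametricIntegrals

/-! ### Calculus of directional derivatives. -/

section DirectionalDerivative

variable {V F : Type} [NormedAddCommGroup V] [NormedSpace ℝ V] [NormedAddCommGroup F]
  [NormedSpace ℝ F]

/-- The derivative of `U` in the direction `a`. -/
def dd (a : V) (U : V → F) : V → F := fun p => fderiv ℝ U p a

theorem contDiff_dd {n : ℕ} {U : V → F} (hU : ContDiff ℝ (n + 1 : ℕ) U) (a : V) :
    ContDiff ℝ n (dd a U) :=
  (hU.fderiv_right (m := n) (by norm_cast)).clm_apply contDiff_const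

theorem contDiff_one_dd {U : V → F} (hU : ContDiff ℝ 2 U) (a : V) : ContDiff ℝ 1 (dd a U) :=
  mod_cast contDiff_dd (n := 1) (mod_cast hU) a

theorem continuous_dd {U : V → F} (hU : ContDiff ℝ 1 U) (a : V) : Continuous (dd a U) :=
  (contDiff_dd (n := 0) (mod_cast hU) a).continuous

theorem dd_dd_eq {U : V → F} (hU : ContDiff ℝ 2 U) (a b p : V) :
    dd a (dd b U) p = fderiv ℝ (fderiv ℝ U) p a b := by
  have h1 : DifferentiableAt ℝ (fderiv ℝ U) p :=
    ((hU.fderiv_right (m := 1) (by norm_num)).differentiable (by simp)) p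
  have h2 := h1.hasFDerivAt.clm_apply (hasFDerivAt_const b p)
  have h3 : fderiv ℝ (dd b U) p = fderiv ℝ (fun y => fderiv ℝ U y b) p := rfl
  rw [dd, h3, h2.fderiv]
  simp

theorem dd_comm {U : V → F} (hU : ContDiff ℝ 2 U) (a b : V) : dd a (dd b U) = dd b (dd a U) := by
  ext p
  rw [dd_dd_eq hU, dd_dd_eq hU]
  exact (hU.contDiffAt.isSymmSndFDerivAt (by simp)) a b

theorem dd_add {U W : V → F} (hU : ContDiff ℝ 1 U) (hW : ContDiff ℝ 1 W) (a : V) :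
    dd a (fun p => U p + W p) = fun p => dd a U p + dd a W p := by
  ext p
  simp [dd, fderiv_fun_add (hU.differentiable (by simp) p) (hW.differentiable (by simp) p)]

theorem dd_sub {U W : V → F} (hU : ContDiff ℝ 1 U) (hW : ContDiff ℝ 1 W) (a : V) :
    dd a (fun p => U p - W p) = fun p => dd a U p - dd a W p := by
  ext p
  simp [dd, fderiv_fun_sub (hU.differentiable (by simp) p) (hW.differentiable (by simp) p)]

theorem dd_sum {ι : Type} (s : Finset ι) {U : ι → V → F} (hU : ∀ i, ContDiff ℝ 1 (U i)) (a : V) :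
    dd a (fun p => ∑ i ∈ s, U i p) = fun p => ∑ i ∈ s, dd a (U i) p := by
  ext p
  simp [dd, fderiv_fun_sum (fun i _ => (hU i).differentiable (by simp) p)]

theorem dd_mul {U W : V → ℝ} (hU : ContDiff ℝ 1 U) (hW : ContDiff ℝ 1 W) (a : V) :
    dd a (fun p => U p * W p) = fun p => dd a U p * W p + U p * dd a W p := by
  ext p
  simp [dd, fderiv_fun_mul (hU.differentiable (by simp) p) (hW.differentiable (by simp) p)]
  ring

theorem dd_clm (L : V →L[ℝ] F) (a : V) : dd a L = fun _ => L a := by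
  ext p
  simp [dd]

/-- Directional derivatives pass under the integral sign. -/
theorem dd_setIntegral {Y : Type} [LocallyCompactSpace V] [NormedAddCommGroup Y] [NormedSpace ℝ Y]
    [MeasurableSpace Y] [OpensMeasurableSpace Y] [SecondCountableTopology Y] {μ : Measure Y}
    [IsLocallyFiniteMeasure μ] {s : Set Y} (hs : IsCompact s) (hsm : MeasurableSet s)
    [CompleteSpace F] {f : V → Y → F} (hf : ContDiff ℝ 1 f.uncurry) (a : V) :
    dd a (fun x => ∫ y in s, f x y ∂μ) = fun x => ∫ y in s, dd a (fun x => f x y) x ∂μ := by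
  ext x
  have hfd : Differentiable ℝ f.uncurry := hf.differentiable (by simp)
  have hf' : Continuous (Function.uncurry fun x y =>
      (fderiv ℝ f.uncurry (x, y)).comp (ContinuousLinearMap.inl ℝ V Y)) :=
    ((hf.continuous_fderiv (by simp)).clm_comp continuous_const)
  have hd : ∀ x y, HasFDerivAt (fun x => f x y)
      ((fderiv ℝ f.uncurry (x, y)).comp (ContinuousLinearMap.inl ℝ V Y)) x := fun x y =>
    HasFDerivAt.comp (g := f.uncurry) (f := fun e => (e, y)) x (hfd (x, y)).hasFDerivAt
      (hasFDerivAt_prodMk_left x y)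
  have h := hasFDerivAt_setIntegral_of_continuous (μ := μ) hs hsm hf.continuous hf'
    (fun x y _ => hd x y) x
  unfold dd
  rw [h.fderiv, ContinuousLinearMap.integral_apply]
  · simp only [(hd _ _).fderiv]
  · exact (hf'.comp (Continuous.prodMk_right x)).continuousOn.integrableOn_compact' hs hsm

end DirectionalDerivative

/-- The standard basis of `E3`. -/
abbrev ex (i : Fin 3) : E3 := EuclideanSpace.single i (1 : ℝ)

theorem sum_smul_ex (y : E3) : ∑ i, y i • ex i = y := by
  ext j
  simp [Finset.sum_apply, Pi.single_apply]

theorem fderiv_apply_eq_sum_dd {F : Type} [NormedAddCommGroup F] [NormedSpace ℝ F] (g : E3 → F)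
    (x y : E3) : fderiv ℝ g x y = ∑ i, y i • dd (ex i) g x := by
  conv_lhs => rw [← sum_smul_ex y]
  simp [dd]

theorem contDiff_coord (i : Fin 3) {n : WithTop ℕ∞} : ContDiff ℝ n (fun y : E3 => y i) :=
  (EuclideanSpace.proj (𝕜 := ℝ) i).contDiff

/-! ### Rotation invariant integration on the sphere and the spherical Laplacian. -/

section Sphere

/-- The uniform probability measure on the unit sphere of `ℝ³`. -/
def sph : Measure E3 :=
  (ProbabilityTheory.cond volume (closedBall (0 : E3) 1)).map (fun y => ‖y‖⁻¹ • y)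

theorem measurable_normalize : Measurable (fun y : E3 => ‖y‖⁻¹ • y) := by fun_prop

instance : IsProbabilityMeasure (ProbabilityTheory.cond volume (closedBall (0 : E3) 1)) :=
  ProbabilityTheory.cond_isProbabilityMeasure_of_finite
    (measure_closedBall_pos _ _ one_pos).ne' measure_closedBall_lt_top.ne

instance : IsProbabilityMeasure sph :=
  Measure.isProbabilityMeasure_map measurable_normalize.aemeasurable

theorem ae_sph_norm_eq_one : ∀ᵐ ζ ∂sph, ‖ζ‖ = 1 := by
  rw [sph, ae_map_iff measurable_normalize.aemeasurable
    (measurableSet_eq_fun measurable_norm measurable_const)]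
  have h : ∀ᵐ y ∂(volume : Measure E3), y ≠ 0 := by
    simp [ae_iff]
  filter_upwards [ProbabilityTheory.cond_absolutelyContinuous.ae_le h] with y hy
  rw [norm_smul, norm_inv, norm_norm, inv_mul_cancel₀ (norm_ne_zero_iff.2 hy)]

/-- Makes the results on integrals over compact sets applicable to integrals against `sph`, which is
a measure on the whole space. -/
theorem sph_restrict : sph.restrict (closedBall 0 1) = sph :=
  Measure.restrict_eq_self_of_ae_mem (by
    filter_upwards [ae_sph_norm_eq_one] with ζ h using by simp [h])

/-- A linear isometry preserves volume and the unit ball, and it commutes with the normalization `y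
↦ ‖y‖⁻¹ • y`. -/
theorem sph_map_isometry (R : E3 ≃ₗᵢ[ℝ] E3) : sph.map R = sph := by
  have hR : Measurable R := R.continuous.measurable
  have h1 : (ProbabilityTheory.cond volume (closedBall (0 : E3) 1)).map R =
      ProbabilityTheory.cond volume (closedBall (0 : E3) 1) := by
    have h2 : (volume.restrict (closedBall (0 : E3) 1)).map R =
        volume.restrict (closedBall (0 : E3) 1) := by
      have := (R.measurePreserving.restrict_preimage
        (measurableSet_closedBall (x := (0 : E3)) (ε := 1))).map_eq
      rwa [R.preimage_closedBall, map_zero] at this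
    rw [ProbabilityTheory.cond, Measure.map_smul, h2]
  unfold sph
  rw [Measure.map_map hR measurable_normalize]
  conv_rhs => rw [← h1, Measure.map_map measurable_normalize hR]
  congr 1
  ext y : 1
  simp

theorem integral_sph_comp_isometry (R : E3 ≃ₗᵢ[ℝ] E3) (f : E3 → ℝ) :
    ∫ ζ, f (R ζ) ∂sph = ∫ ζ, f ζ ∂sph := by
  conv_rhs => rw [← sph_map_isometry R]
  exact (R.toHomeomorph.measurableEmbedding.integral_map f).symm

theorem exp_zero_smul (A : E3 →L[ℝ] E3) : NormedSpace.exp ((0 : ℝ) • A) = 1 := by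
  have : ((0 : ℝ) • A) = 0 := zero_smul ℝ A
  rw [this]
  exact NormedSpace.exp_zero

/-- The flow of a skew-symmetric operator consists of isometries. -/
theorem exists_isometry_exp (A : E3 →L[ℝ] E3) (hA : ∀ y, inner ℝ y (A y) = 0) (s : ℝ) :
    ∃ R : E3 ≃ₗᵢ[ℝ] E3, ∀ y, R y = NormedSpace.exp (s • A) y := by
  have hd : ∀ (y : E3) (t : ℝ), HasDerivAt (fun t : ℝ => NormedSpace.exp (t • A) y)
      (A (NormedSpace.exp (t • A) y)) t := fun y t =>
    (hasDerivAt_exp_smul_const' (𝕂 := ℝ) A t).clm_apply (hasDerivAt_const t y) |>.congr_deriv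
      (by simp)
  -- The squared norm along the flow has derivative `2⟨y, A y⟩ = 0`.
  have hn : ∀ y, ‖NormedSpace.exp (s • A) y‖ = ‖y‖ := by
    intro y
    have h := is_const_of_deriv_eq_zero (𝕜 := ℝ)
      (f := fun t : ℝ => ‖NormedSpace.exp (t • A) y‖ ^ 2)
      (fun t => ((hd y t).norm_sq).differentiableAt)
      (fun t => by rw [((hd y t).norm_sq).deriv, hA]; simp) s 0
    rw [exp_zero_smul] at h
    exact (sq_eq_sq₀ (norm_nonneg _) (norm_nonneg _)).1 h
  let L : E3 →ₗᵢ[ℝ] E3 := ⟨(NormedSpace.exp (s • A) : E3 →L[ℝ] E3).toLinearMap, hn⟩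
  exact ⟨L.toLinearIsometryEquiv rfl, fun y => rfl⟩

/-- By rotation invariance the mean of `F ∘ exp(sA)` does not depend on `s`; the claim is its
derivative at `s = 0`. -/
theorem integral_sph_fderiv_skew (A : E3 →L[ℝ] E3) (hA : ∀ y, inner ℝ y (A y) = 0) {F : E3 → ℝ}
    (hF : ContDiff ℝ 1 F) : ∫ ζ, fderiv ℝ F ζ (A ζ) ∂sph = 0 := by
  have he : Continuous (fun s : ℝ => NormedSpace.exp (s • A)) :=
    continuous_iff_continuousAt.2 fun s =>
      (hasDerivAt_exp_smul_const (𝕂 := ℝ) A s).continuousAt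
  have hd : ∀ (s : ℝ) (y : E3), HasDerivAt (fun t : ℝ => F (NormedSpace.exp (t • A) y))
      (fderiv ℝ F (NormedSpace.exp (s • A) y) ((NormedSpace.exp (s • A) * A) y)) s := by
    intro s y
    refine HasFDerivAt.comp_hasDerivAt s (hF.differentiable (by simp) _).hasFDerivAt ?_
    exact (hasDerivAt_exp_smul_const (𝕂 := ℝ) A s).clm_apply (hasDerivAt_const s y) |>.congr_deriv
      (by simp)
  have hc : Continuous (Function.uncurry fun (s : ℝ) (y : E3) => NormedSpace.exp (s • A) y) :=
    (he.comp continuous_fst).clm_apply continuous_snd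
  have h := hasFDerivAt_setIntegral_of_continuous (μ := sph) (isCompact_closedBall (0 : E3) 1)
    measurableSet_closedBall
    (f := fun (s : ℝ) (y : E3) => F (NormedSpace.exp (s • A) y))
    (f' := fun (s : ℝ) (y : E3) => (1 : ℝ →L[ℝ] ℝ).smulRight
      (fderiv ℝ F (NormedSpace.exp (s • A) y) ((NormedSpace.exp (s • A) * A) y)))
    (hF.continuous.comp hc)
    ((ContinuousLinearMap.smulRightL ℝ ℝ ℝ (1 : ℝ →L[ℝ] ℝ)).continuous.comp
      (((hF.continuous_fderiv (by simp)).comp hc).clm_apply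
        (((he.mul continuous_const).comp continuous_fst).clm_apply continuous_snd)))
    (fun s y _ => (hd s y).hasFDerivAt) 0
  have h2 := h.hasDerivAt
  rw [sph_restrict] at h2
  have hconst : (fun s : ℝ => ∫ y, F (NormedSpace.exp (s • A) y) ∂sph) =
      fun _ => ∫ y, F y ∂sph := by
    ext s
    obtain ⟨R, hR⟩ := exists_isometry_exp A hA s
    simp_rw [← hR]
    exact integral_sph_comp_isometry R F
  rw [hconst] at h2
  have h3 := h2.unique (hasDerivAt_const 0 _)
  rw [ContinuousLinearMap.integral_apply] at h3
  · simpa [exp_zero_smul] using h3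
  · rw [← sph_restrict]
    refine Continuous.continuousOn ?_ |>.integrableOn_compact'
      (isCompact_closedBall (0 : E3) 1) measurableSet_closedBall
    exact (ContinuousLinearMap.smulRightL ℝ ℝ ℝ (1 : ℝ →L[ℝ] ℝ)).continuous.comp
      (((hF.continuous_fderiv (by simp)).comp (hc.comp (Continuous.prodMk_right 0))).clm_apply
        (by fun_prop))

theorem integrable_sph {F : Type} [NormedAddCommGroup F] {f : E3 → F} (hf : Continuous f) :
    Integrable f sph := by
  rw [← sph_restrict]
  exact hf.continuousOn.integrableOn_compact' (isCompact_closedBall (0 : E3) 1)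
      measurableSet_closedBall

/-- Angular derivatives have mean zero on the sphere. -/
theorem integral_sph_angular {F : E3 → ℝ} (hF : ContDiff ℝ 1 F) (i j : Fin 3) :
    ∫ ζ : E3, (ζ i * dd (ex j) F ζ - ζ j * dd (ex i) F ζ) ∂sph = 0 := by
  have h := integral_sph_fderiv_skew ((EuclideanSpace.proj i : E3 →L[ℝ] ℝ).smulRight (ex j) -
    (EuclideanSpace.proj j : E3 →L[ℝ] ℝ).smulRight (ex i))
    (fun y => by simp [inner_sub_right, inner_smul_right, EuclideanSpace.inner_single_right,
      mul_comm]) hF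
  simpa [dd] using h

theorem dd_angular {G : E3 → ℝ} (hG : ContDiff ℝ 2 G) (i j k : Fin 3) (y : E3) :
    dd (ex k) (fun y => y i * dd (ex j) G y - y j * dd (ex i) G y) y =
      (if i = k then 1 else 0) * dd (ex j) G y + y i * dd (ex k) (dd (ex j) G) y -
      ((if j = k then 1 else 0) * dd (ex i) G y + y j * dd (ex k) (dd (ex i) G) y) := by
  have h1 : ∀ l, dd (ex k) (fun y : E3 => y l) = fun _ => if l = k then 1 else 0 := by
    intro l
    have := dd_clm (EuclideanSpace.proj (𝕜 := ℝ) l : E3 →L[ℝ] ℝ) (ex k)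
    simpa [PiLp.single_apply] using this
  rw [dd_sub ((contDiff_coord i).mul (contDiff_one_dd hG _))
    ((contDiff_coord j).mul (contDiff_one_dd hG _)),
    dd_mul (contDiff_coord i) (contDiff_one_dd hG _),
    dd_mul (contDiff_coord j) (contDiff_one_dd hG _), h1, h1]

/-- The spherical mean of the Laplacian, in terms of radial derivatives. -/
theorem integral_sph_laplacian {G : E3 → ℝ} (hG : ContDiff ℝ 2 G) :
    ∫ ζ : E3, (∑ i, dd (ex i) (dd (ex i) G) ζ - ∑ i, ∑ j, ζ i * ζ j * dd (ex i) (dd (ex j) G) ζ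
      - 2 * ∑ i, ζ i * dd (ex i) G ζ) ∂sph = 0 := by
  have hL : ∀ i j, ContDiff ℝ 1 (fun y : E3 => y i * dd (ex j) G y - y j * dd (ex i) G y) :=
    fun i j => ((contDiff_coord i).mul (contDiff_one_dd hG _)).sub
      ((contDiff_coord j).mul (contDiff_one_dd hG _))
  have key := fun i j => integral_sph_angular (hL i j) i j
  have hI := fun i j : Fin 3 => integrable_sph (f := fun ζ : E3 =>
    ζ i * dd (ex j) (fun y => y i * dd (ex j) G y - y j * dd (ex i) G y) ζ -
      ζ j * dd (ex i) (fun y => y i * dd (ex j) G y - y j * dd (ex i) G y) ζ)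
    (((contDiff_coord i (n := 0)).continuous.mul (continuous_dd (hL i j) _)).sub
      ((contDiff_coord j (n := 0)).continuous.mul (continuous_dd (hL i j) _)))
  -- With `Lᵢⱼ = yᵢ∂ⱼ - yⱼ∂ᵢ`, the sum of `Lᵢⱼ²` over the three pairs `i < j` equals `|y|²Δ - ∑
  -- yᵢyⱼ∂ᵢ∂ⱼ - 2 ∑ yᵢ∂ᵢ`. Each `Lᵢⱼ²G` has mean zero, and `|y| = 1` on the sphere.
  have hsum := integral_add ((hI 0 1).add (hI 0 2)) (hI 1 2)
  simp only [Pi.add_apply] at hsum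
  rw [integral_add (hI 0 1) (hI 0 2), key, key, key, add_zero, add_zero] at hsum
  rw [← hsum]
  refine integral_congr_ae ?_
  filter_upwards [ae_sph_norm_eq_one] with ζ hζ
  have h1 : ζ 0 ^ 2 + ζ 1 ^ 2 + ζ 2 ^ 2 = 1 := by
    have := EuclideanSpace.norm_sq_eq ζ
    rw [hζ] at this
    simpa [Fin.sum_univ_three] using this.symm
  have c1 := congrFun (dd_comm hG (ex 1) (ex 0)) ζ
  have c2 := congrFun (dd_comm hG (ex 2) (ex 0)) ζ
  have c3 := congrFun (dd_comm hG (ex 2) (ex 1)) ζ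
  simp only [dd_angular hG, Fin.sum_univ_three, c1, c2, c3]
  simp
  linear_combination (-(dd (ex 0) (dd (ex 0) G) ζ) - dd (ex 1) (dd (ex 1) G) ζ
    - dd (ex 2) (dd (ex 2) G) ζ) * h1

end Sphere

/-! ### Bessel functions as entire functions of the squared argument. -/

section BesselKernel

/-- Coefficients of the entire function `s ↦ 2 ^ j * s ^ (-j / 2) * J_j (√s)`. -/
def besselCoeff (j n : ℕ) : ℝ := (-1 / 4) ^ n / (n.factorial * (n + j).factorial)

/-- The entire function `s ↦ 2 ^ j * s ^ (-j / 2) * J_j (√s)`, with `J_j` the Bessel function. -/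
def besselFun (j : ℕ) (s : ℝ) : ℝ := ∑' n, besselCoeff j n * s ^ n

theorem abs_besselCoeff_le (j n : ℕ) : |besselCoeff j n| ≤ 1 / n.factorial := by
  rw [besselCoeff, abs_div, abs_pow, abs_of_pos (by positivity : (0 : ℝ) <
    n.factorial * (n + j).factorial)]
  have h1 : |(-1 / 4 : ℝ)| ^ n ≤ 1 := pow_le_one₀ (abs_nonneg _) (by norm_num [abs_div])
  have h2 : (1 : ℝ) ≤ (n + j).factorial := by exact_mod_cast Nat.succ_le_of_lt (Nat.factorial_pos _)
  refine div_le_div₀ zero_le_one h1 (by positivity) ?_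
  exact le_mul_of_one_le_right (by positivity) h2

theorem besselCoeff_succ (j n : ℕ) :
    besselCoeff j (n + 1) * (n + 1) = -1 / 4 * besselCoeff (j + 1) n := by
  have h : n + 1 + j = n + (j + 1) := by ring
  rw [besselCoeff, besselCoeff, Nat.factorial_succ n, h, pow_succ]
  push_cast
  field_simp

theorem summable_besselCoeff (j : ℕ) (s : ℝ) : Summable fun n => besselCoeff j n * s ^ n := by
  refine Summable.of_norm_bounded (g := fun n => |s| ^ n / n.factorial)
    (Real.summable_pow_div_factorial |s|) fun n => ?_
  rw [Real.norm_eq_abs, abs_mul, abs_pow, div_eq_mul_one_div, mul_comm]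
  exact mul_le_mul_of_nonneg_left (abs_besselCoeff_le j n) (by positivity)

theorem hasDerivAt_besselFun (j : ℕ) (s : ℝ) :
    HasDerivAt (besselFun j) (-1 / 4 * besselFun (j + 1) s) s := by
  -- Termwise differentiation is carried out on the open ball of radius `R`, which contains `s`;
  -- there the differentiated series is dominated by the exponential series of `R`.
  set R : ℝ := |s| + 1
  have hR : 0 ≤ R := by positivity
  have hu : Summable fun n : ℕ => |besselCoeff j n| * (n * R ^ (n - 1)) := by
    rw [← summable_nat_add_iff 1]
    refine Summable.of_nonneg_of_le (fun n => by positivity) (fun n => ?_)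
      (Real.summable_pow_div_factorial R)
    have h1 := abs_besselCoeff_le j (n + 1)
    calc |besselCoeff j (n + 1)| * (((n + 1 : ℕ) : ℝ) * R ^ (n + 1 - 1))
        ≤ 1 / (n + 1).factorial * (((n + 1 : ℕ) : ℝ) * R ^ (n + 1 - 1)) :=
          mul_le_mul_of_nonneg_right h1 (by positivity)
      _ = R ^ n / n.factorial := by
          rw [Nat.factorial_succ, Nat.add_sub_cancel]
          push_cast
          field_simp
  have h := hasDerivAt_tsum_of_isPreconnected hu (isOpen_ball (x := (0 : ℝ)) (ε := R))
    (convex_ball 0 R).isPreconnected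
    (g := fun n y => besselCoeff j n * y ^ n)
    (g' := fun n y => besselCoeff j n * (n * y ^ (n - 1)))
    (fun n y _ => (hasDerivAt_pow n y).const_mul _)
    (fun n y hy => by
      rw [mem_ball_zero_iff, Real.norm_eq_abs] at hy
      rw [Real.norm_eq_abs, abs_mul, abs_mul, abs_pow, Nat.abs_cast]
      gcongr)
    (y₀ := s) (by simp [R]) (summable_besselCoeff j s) (y := s) (by simp [R])
  refine h.congr_deriv ?_
  have hs : Summable fun n : ℕ => besselCoeff j n * (n * s ^ (n - 1)) := by
    refine Summable.of_norm_bounded hu fun n => ?_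
    rw [Real.norm_eq_abs, abs_mul, abs_mul, abs_pow, Nat.abs_cast]
    gcongr
    simp [R]
  rw [hs.tsum_eq_zero_add, besselFun, ← tsum_mul_left]
  simp only [Nat.cast_zero, zero_mul, mul_zero, zero_add]
  refine tsum_congr fun n => ?_
  rw [Nat.add_sub_cancel, ← mul_assoc, ← mul_assoc, ← besselCoeff_succ]
  push_cast
  ring

theorem contDiff_besselFun (n : ℕ) (j : ℕ) : ContDiff ℝ n (besselFun j) := by
  induction n generalizing j with
  | zero =>
    rw [Nat.cast_zero, contDiff_zero, continuous_iff_continuousAt]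
    exact fun s => (hasDerivAt_besselFun j s).continuousAt
  | succ n ih =>
    push_cast
    rw [contDiff_succ_iff_deriv]
    refine ⟨fun s => (hasDerivAt_besselFun j s).differentiableAt, by simp, ?_⟩
    rw [show deriv (besselFun j) = fun s => -1 / 4 * besselFun (j + 1) s from
      funext fun s => (hasDerivAt_besselFun j s).deriv]
    exact contDiff_const.mul (ih (j + 1))

theorem besselFun_one_zero : besselFun 1 0 = 1 := by
  rw [besselFun, tsum_eq_single 0]
  · simp [besselCoeff]
  · intro n hn
    simp [hn]

/-- This is `J₁(x) + J₃(x) = (4 / x) J₂(x)` with `s = x²`. The power series form also covers `s ≤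
0`, so the kernels built from it are smooth across the light cone. -/
theorem besselFun_recurrence (s : ℝ) :
    s / 8 * besselFun 3 s - besselFun 2 s + 1 / 2 * besselFun 1 s = 0 := by
  have h : ∀ n, besselCoeff 2 (n + 1) - 1 / 2 * besselCoeff 1 (n + 1) = 1 / 8 * besselCoeff 3 n := by
    intro n
    have e1 : n + 1 + 2 = n + 3 := by ring
    have e2 : n + 3 = n + 2 + 1 := by ring
    rw [besselCoeff, besselCoeff, besselCoeff, e1, show n + 1 + 1 = n + 2 by ring, e2,
      Nat.factorial_succ (n + 2), Nat.factorial_succ n, pow_succ]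
    push_cast
    field_simp
    ring
  have hs : Summable fun n => (besselCoeff 2 n - 1 / 2 * besselCoeff 1 n) * s ^ n := by
    refine ((summable_besselCoeff 2 s).sub ((summable_besselCoeff 1 s).mul_left (1 / 2))).congr ?_
    intro n
    ring
  have h1 : besselFun 2 s - 1 / 2 * besselFun 1 s =
      ∑' n, (besselCoeff 2 n - 1 / 2 * besselCoeff 1 n) * s ^ n := by
    rw [besselFun, besselFun, ← tsum_mul_left,
      ← (summable_besselCoeff 2 s).tsum_sub ((summable_besselCoeff 1 s).mul_left (1 / 2))]
    exact tsum_congr fun n => by ring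
  have h2 : s / 8 * besselFun 3 s = besselFun 2 s - 1 / 2 * besselFun 1 s := by
    rw [h1, hs.tsum_eq_zero_add, besselFun, ← tsum_mul_left]
    have h0 : (besselCoeff 2 0 - 1 / 2 * besselCoeff 1 0) * s ^ 0 = 0 := by
      norm_num [besselCoeff, Nat.factorial]
    rw [h0, zero_add]
    refine tsum_congr fun n => ?_
    rw [h]
    ring
  linarith

end BesselKernel

/-- The time direction of `ℝ × E3`. -/
abbrev eT : ℝ × E3 := (1, 0)

/-- The spatial coordinate directions of `ℝ × E3`. -/
abbrev eX (i : Fin 3) : ℝ × E3 := (0, ex i)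

/-- The Klein-Gordon operator `∂ₜ² - Δ + 1`. -/
def kg (U : ℝ × E3 → ℝ) (p : ℝ × E3) : ℝ :=
  dd eT (dd eT U) p - ∑ i, dd (eX i) (dd (eX i) U) p + U p

/-! ### Partial derivatives on space-time. -/

section Partials

variable {F : Type} [NormedAddCommGroup F] [NormedSpace ℝ F]

theorem hasDerivAt_time {U : ℝ × E3 → F} {t : ℝ} {x : E3} (hU : DifferentiableAt ℝ U (t, x)) :
    HasDerivAt (fun s => U (s, x)) (dd eT U (t, x)) t :=
  HasFDerivAt.comp_hasDerivAt (l := U) (f := fun s : ℝ => (s, x)) t hU.hasFDerivAt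
    ((hasDerivAt_id t).prodMk (hasDerivAt_const t x))

theorem hasFDerivAt_space {U : ℝ × E3 → F} {t : ℝ} {x : E3} (hU : DifferentiableAt ℝ U (t, x)) :
    HasFDerivAt (fun y => U (t, y)) ((fderiv ℝ U (t, x)).comp (ContinuousLinearMap.inr ℝ ℝ E3)) x :=
  HasFDerivAt.comp (g := U) (f := fun y => (t, y)) x hU.hasFDerivAt (hasFDerivAt_prodMk_right t x)

theorem dd_space_eq {U : ℝ × E3 → F} {t : ℝ} {x : E3} (hU : DifferentiableAt ℝ U (t, x)) (a : E3) :
    dd (0, a) U (t, x) = dd a (fun y => U (t, y)) x := by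
  rw [dd, dd, (hasFDerivAt_space hU).fderiv]
  rfl

/-- Leibniz's rule for directional derivatives. -/
theorem dd_intervalIntegral {H : Type} [NormedAddCommGroup H] [NormedSpace ℝ H]
    [LocallyCompactSpace H] [CompleteSpace F] {N : H → ℝ → F} (hN : ContDiff ℝ 1 N.uncurry)
    (a : H →L[ℝ] ℝ) (v : H) :
    dd v (fun p => ∫ s in (0 : ℝ)..a p, N p s) =
      fun p => a v • N p (a p) + ∫ s in (0 : ℝ)..a p, dd v (fun p => N p s) p := by
  ext p
  have hNd : Differentiable ℝ N.uncurry := hN.differentiable (by simp)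
  have hN' : Continuous (Function.uncurry fun x y =>
      (fderiv ℝ N.uncurry (x, y)).comp (ContinuousLinearMap.inl ℝ H ℝ)) :=
    ((hN.continuous_fderiv (by simp)).clm_comp continuous_const)
  have hd : ∀ x y, HasFDerivAt (fun x => N x y)
      ((fderiv ℝ N.uncurry (x, y)).comp (ContinuousLinearMap.inl ℝ H ℝ)) x := fun x y =>
    HasFDerivAt.comp (g := N.uncurry) (f := fun e => (e, y)) x (hNd (x, y)).hasFDerivAt
      (hasFDerivAt_prodMk_left x y)
  have h := hasFDerivAt_intervalIntegral_param hN.continuous hN' (fun x y => hd x y) a p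
  unfold dd
  rw [h.fderiv]
  simp only [(hd _ _).fderiv, add_apply, ContinuousLinearMap.smulRight_apply]
  congr 1
  exact ContinuousLinearMap.intervalIntegral_apply
    ((hN'.comp (Continuous.prodMk_right p)).intervalIntegrable _ _) v

end Partials

/-! ### Spherical means and Kirchhoff's solution of the wave equation. -/

section SphericalMeans

/-- Weighted spherical means `∫ c(t, η) g(x + t η) dη`. -/
def wmean (c : ℝ → E3 → ℝ) (g : E3 → ℝ) (p : ℝ × E3) : ℝ :=
  ∫ η in closedBall (0 : E3) 1, c p.1 η * g (p.2 + p.1 • η) ∂sph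

theorem contDiff_wmean_aux {c : ℝ → E3 → ℝ} {g : E3 → ℝ} {n : WithTop ℕ∞}
    (hc : ContDiff ℝ n c.uncurry) (hg : ContDiff ℝ n g) :
    ContDiff ℝ n (Function.uncurry fun (p : ℝ × E3) η => c p.1 η * g (p.2 + p.1 • η)) := by
  refine ContDiff.mul (hc.comp ((contDiff_fst.comp contDiff_fst).prodMk contDiff_snd))
    (hg.comp ?_)
  exact (contDiff_snd.comp contDiff_fst).add ((contDiff_fst.comp contDiff_fst).smul contDiff_snd)

theorem contDiff_wmean {c : ℝ → E3 → ℝ} {g : E3 → ℝ} {n : ℕ} (hc : ContDiff ℝ n c.uncurry)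
    (hg : ContDiff ℝ n g) : ContDiff ℝ n (wmean c g) :=
  contDiff_setIntegral (isCompact_closedBall _ _) measurableSet_closedBall n
    (contDiff_wmean_aux hc hg)

theorem integrableOn_wmean {c : ℝ → E3 → ℝ} {g : E3 → ℝ} (hc : Continuous c.uncurry)
    (hg : Continuous g) (t : ℝ) (x : E3) :
    IntegrableOn (fun η => c t η * g (x + t • η)) (closedBall (0 : E3) 1) sph := by
  refine Continuous.continuousOn ?_ |>.integrableOn_compact'
      (isCompact_closedBall (0 : E3) 1) measurableSet_closedBall
  exact (hc.comp (Continuous.prodMk_right t)).mul (hg.comp (by fun_prop))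

theorem dd_space_wmean {c : ℝ → E3 → ℝ} {g : E3 → ℝ} (hc : ContDiff ℝ 1 c.uncurry)
    (hg : ContDiff ℝ 1 g) (a : E3) : dd (0, a) (wmean c g) = wmean c (dd a g) := by
  unfold wmean
  rw [dd_setIntegral (isCompact_closedBall _ _) measurableSet_closedBall
    (contDiff_wmean_aux hc hg)]
  ext ⟨t, x⟩
  refine integral_congr_ae (Eventually.of_forall fun η => ?_)
  have hd : DifferentiableAt ℝ (fun p : ℝ × E3 => c p.1 η * g (p.2 + p.1 • η)) (t, x) :=
    ((contDiff_wmean_aux hc hg).comp (contDiff_prodMk_left η)).differentiable (by simp) _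
  have h1 : HasFDerivAt (fun y : E3 => g (y + t • η)) (fderiv ℝ g (x + t • η)) x := by
    rw [hasFDerivAt_comp_add_right]
    exact (hg.differentiable (by simp) _).hasFDerivAt
  simp only
  rw [dd_space_eq hd, dd, (h1.const_mul (c t η)).fderiv]
  rfl

/-- The reason for general weights: a time derivative of `g (x + t • η)` brings down coordinates of
`η`, and with these absorbed into the weight the class of means is stable under `∂ₜ`. -/
theorem dd_time_wmean {c : ℝ → E3 → ℝ} {c' : ℝ → E3 → ℝ} {g : E3 → ℝ}
    (hc : ContDiff ℝ 1 c.uncurry) (hc' : ∀ t η, HasDerivAt (fun t => c t η) (c' t η) t)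
    (hcc' : Continuous c'.uncurry)
    (hg : ContDiff ℝ 1 g) : dd eT (wmean c g) = fun p => wmean c' g p +
      ∑ i, wmean (fun t η => c t η * η i) (dd (ex i) g) p := by
  unfold wmean
  rw [dd_setIntegral (isCompact_closedBall _ _) measurableSet_closedBall
    (contDiff_wmean_aux hc hg)]
  ext ⟨t, x⟩
  have hci : ∀ i, Continuous (Function.uncurry fun t (η : E3) => c t η * η i) := fun i =>
    hc.continuous.mul ((contDiff_coord i (n := 0)).continuous.comp continuous_snd)
  rw [← integral_finsetSum _ (fun i _ => integrableOn_wmean (hci i) (continuous_dd hg _) t x),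
    ← integral_add (integrableOn_wmean hcc' hg.continuous t x)
    (integrable_finsetSum _ fun i _ => integrableOn_wmean (hci i) (continuous_dd hg _) t x)]
  refine integral_congr_ae (Eventually.of_forall fun η => ?_)
  have hd : DifferentiableAt ℝ (fun p : ℝ × E3 => c p.1 η * g (p.2 + p.1 • η)) (t, x) :=
    ((contDiff_wmean_aux hc hg).comp (contDiff_prodMk_left η)).differentiable (by simp) _
  have h1 : HasDerivAt (fun t : ℝ => g (x + t • η)) (fderiv ℝ g (x + t • η) η) t := by
    refine HasFDerivAt.comp_hasDerivAt t (hg.differentiable (by simp) _).hasFDerivAt ?_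
    simpa using ((hasDerivAt_id t).smul_const η).const_add x
  have h2 := (hasDerivAt_time hd).unique ((hc' t η).mul h1)
  simp only
  rw [h2, fderiv_apply_eq_sum_dd, Finset.mul_sum]
  congr 1
  exact Finset.sum_congr rfl fun i _ => by ring

theorem abs_wmean_le {c : ℝ → E3 → ℝ} {g : E3 → ℝ} {C G t : ℝ}
    (hc : ∀ η : E3, ‖η‖ ≤ 1 → |c t η| ≤ C) (hG : ∀ x, |g x| ≤ G) (x : E3) :
    |wmean c g (t, x)| ≤ C * G := by
  have h := norm_integral_le_of_norm_le_const (μ := sph.restrict (closedBall (0 : E3) 1))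
    (f := fun η => c t η * g (x + t • η)) (C := C * G) ?_
  · rw [sph_restrict] at h
    simpa [wmean, sph_restrict] using h
  · filter_upwards [ae_restrict_mem measurableSet_closedBall] with η hη
    rw [Real.norm_eq_abs, abs_mul]
    have h1 := hc η (by simpa using hη)
    exact mul_le_mul h1 (hG _) (abs_nonneg _) ((abs_nonneg _).trans h1)

/-- The solution of the wave equation with initial data `0`, `g`. -/
def waveSol (g : E3 → ℝ) : ℝ × E3 → ℝ := wmean (fun t _ => t) g

theorem contDiff_waveSol {g : E3 → ℝ} {n : ℕ} (hg : ContDiff ℝ n g) :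
    ContDiff ℝ n (waveSol g) :=
  contDiff_wmean contDiff_fst hg

theorem waveSol_zero (g : E3 → ℝ) (x : E3) : waveSol g (0, x) = 0 := by
  simp [waveSol, wmean]

theorem dd_space_waveSol {g : E3 → ℝ} (hg : ContDiff ℝ 1 g) (a : E3) :
    dd (0, a) (waveSol g) = waveSol (dd a g) :=
  dd_space_wmean contDiff_fst hg a

theorem dd_time_waveSol {g : E3 → ℝ} (hg : ContDiff ℝ 1 g) : dd eT (waveSol g) =
    fun p => wmean (fun _ _ => 1) g p + ∑ i, wmean (fun t η => t * η i) (dd (ex i) g) p :=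
  dd_time_wmean contDiff_fst (fun t _ => hasDerivAt_id t) continuous_const hg

theorem wmean_one_zero (g : E3 → ℝ) (x : E3) : wmean (fun _ _ => 1) g (0, x) = g x := by
  simp [wmean, sph_restrict]

theorem dd_time_waveSol_zero {g : E3 → ℝ} (hg : ContDiff ℝ 1 g) (x : E3) :
    dd eT (waveSol g) (0, x) = g x := by
  rw [dd_time_waveSol hg]
  simp only [wmean_one_zero]
  simp [wmean]

theorem contDiff_mul_coord (i : Fin 3) {n : WithTop ℕ∞} :
    ContDiff ℝ n (Function.uncurry fun (t : ℝ) (η : E3) => t * η i) :=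
  contDiff_fst.mul ((contDiff_coord i).comp contDiff_snd)

theorem dd_dd_time_waveSol {g : E3 → ℝ} (hg : ContDiff ℝ 2 g) (p : ℝ × E3) :
    dd eT (dd eT (waveSol g)) p = 2 * ∑ i, wmean (fun _ η => η i) (dd (ex i) g) p +
      ∑ i, ∑ j, wmean (fun t η => t * η i * η j) (dd (ex j) (dd (ex i) g)) p := by
  have hg1 : ContDiff ℝ 1 g := hg.of_le (by norm_num)
  rw [dd_time_waveSol hg1, dd_add, dd_sum, dd_time_wmean (c' := fun _ _ => 0)]
  · simp only
    have h : ∀ i, dd eT (wmean (fun t η => t * η i) (dd (ex i) g)) = fun p =>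
        wmean (fun _ η => η i) (dd (ex i) g) p +
          ∑ j, wmean (fun t η => t * η i * η j) (dd (ex j) (dd (ex i) g)) p := fun i =>
      dd_time_wmean (contDiff_mul_coord i)
        (fun t η => by simpa using (hasDerivAt_id t).mul_const (η i))
        ((contDiff_coord i (n := 0)).continuous.comp continuous_snd) (contDiff_one_dd hg _)
    simp only [h, Finset.sum_add_distrib, one_mul]
    have h0 : wmean (fun _ _ => 0) g p = 0 := by simp [wmean]
    rw [h0]
    ring
  · exact contDiff_const
  · exact fun t η => hasDerivAt_const t _
  · exact continuous_const
  · exact hg1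
  · exact fun i => mod_cast contDiff_wmean (n := 1) (contDiff_mul_coord i)
      (mod_cast contDiff_one_dd hg _)
  · exact mod_cast contDiff_wmean (n := 1) contDiff_const (mod_cast hg1)
  · exact ContDiff.sum fun i _ => mod_cast contDiff_wmean (n := 1) (contDiff_mul_coord i)
      (mod_cast contDiff_one_dd hg _)

theorem dd_comp_affine {g : E3 → ℝ} (hg : ContDiff ℝ 1 g) (x a : E3) (t : ℝ) :
    dd a (fun y => g (x + t • y)) = fun y => t * dd a g (x + t • y) := by
  ext y
  have h1 : HasFDerivAt (fun y : E3 => g (x + t • y))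
      ((fderiv ℝ g (x + t • y)).comp (t • ContinuousLinearMap.id ℝ E3)) y := by
    refine HasFDerivAt.comp y (hg.differentiable (by simp) _).hasFDerivAt ?_
    exact ((hasFDerivAt_id y).const_smul t).const_add x
  rw [dd, h1.fderiv]
  simp [dd]

/-- `waveSol g` solves the wave equation (Darboux's identity). -/
theorem waveSol_wave {g : E3 → ℝ} (hg : ContDiff ℝ 2 g) (p : ℝ × E3) :
    dd eT (dd eT (waveSol g)) p = ∑ i, dd (eX i) (dd (eX i) (waveSol g)) p := by
  have hg1 : ContDiff ℝ 1 g := hg.of_le (by norm_num)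
  have hsp : ∀ i, dd (eX i) (dd (eX i) (waveSol g)) = waveSol (dd (ex i) (dd (ex i) g)) := by
    intro i
    rw [dd_space_waveSol hg1, dd_space_waveSol (contDiff_one_dd hg _)]
  -- For `t ≠ 0` the identity is `integral_sph_laplacian` for the rescaled function `y ↦ g (x + t •
  -- y)`.
  have hne : ∀ (t : ℝ) (x : E3), t ≠ 0 → dd eT (dd eT (waveSol g)) (t, x) =
      ∑ i, dd (eX i) (dd (eX i) (waveSol g)) (t, x) := by
    intro t x ht
    have hG : ContDiff ℝ 2 (fun y => g (x + t • y)) :=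
      hg.comp (contDiff_const.add (contDiff_id.const_smul t))
    have key := integral_sph_laplacian hG
    rw [← sph_restrict] at key
    have hd1 : ∀ i, dd (ex i) (fun y => g (x + t • y)) = fun y => t * dd (ex i) g (x + t • y) :=
      fun i => dd_comp_affine hg1 x _ t
    have hd2 : ∀ i j, dd (ex i) (dd (ex j) (fun y => g (x + t • y))) =
        fun y => t ^ 2 * dd (ex i) (dd (ex j) g) (x + t • y) := by
      intro i j
      rw [hd1]
      have hc : ContDiff ℝ 1 (fun y => dd (ex j) g (x + t • y)) :=
        (contDiff_one_dd hg _).comp (contDiff_const.add (contDiff_id.const_smul t))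
      rw [dd_mul contDiff_const hc, dd_comp_affine (contDiff_one_dd hg _)]
      ext y
      have : dd (ex i) (fun _ : E3 => t) y = 0 := by simp [dd]
      rw [this]
      ring
    simp only [hd1] at hd2
    simp only [hd1, hd2] at key
    have hdc : ∀ i, Continuous (dd (ex i) g) := fun i => continuous_dd hg1 _
    have hddc : ∀ i j, Continuous (dd (ex i) (dd (ex j) g)) := fun i j =>
      continuous_dd (contDiff_one_dd hg _) _
    have I1 : ∀ i, IntegrableOn (fun η => t * dd (ex i) (dd (ex i) g) (x + t • η))
        (closedBall (0 : E3) 1) sph := fun i =>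
      integrableOn_wmean (c := fun t _ => t) continuous_fst (hddc i i) t x
    have hcc : ∀ i j : Fin 3, Continuous (Function.uncurry
      fun (t : ℝ) (η : E3) => t * η i * η j) := fun i j => by
        simp only; fun_prop
    have I2 : ∀ i j, IntegrableOn (fun η => t * η i * η j * dd (ex j) (dd (ex i) g) (x + t • η))
        (closedBall (0 : E3) 1) sph := fun i j =>
      integrableOn_wmean (c := fun t η => t * η i * η j) (hcc i j) (hddc j i) t x
    have I3 : ∀ i, IntegrableOn (fun η : E3 => η i * dd (ex i) g (x + t • η))
        (closedBall (0 : E3) 1) sph := fun i =>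
      integrableOn_wmean (c := fun _ η => η i)
        ((contDiff_coord i (n := 0)).continuous.comp continuous_snd) (hdc i) t x
    have hsum : ∑ i, waveSol (dd (ex i) (dd (ex i) g)) (t, x) -
        ∑ i, ∑ j, wmean (fun t η => t * η i * η j) (dd (ex j) (dd (ex i) g)) (t, x) -
        2 * ∑ i, wmean (fun _ η => η i) (dd (ex i) g) (t, x) = 0 := by
      unfold waveSol wmean
      simp only
      simp_rw [← integral_finsetSum _ (fun j _ => I2 _ j)]
      rw [← integral_finsetSum _ (fun i _ => I1 i), ← integral_finsetSum _ (fun i _ => I3 i),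
        ← integral_finsetSum _ (fun i _ => integrable_finsetSum _ fun j _ => I2 i j),
        ← integral_const_mul, ← integral_sub, ← integral_sub]
      · refine (_root_.mul_eq_zero (a := t) |>.1 ?_).resolve_left ht
        rw [← integral_const_mul, ← key]
        refine integral_congr_ae (Eventually.of_forall fun η => ?_)
        simp only [Fin.sum_univ_three, congrFun (dd_comm hg (ex 1) (ex 0)),
          congrFun (dd_comm hg (ex 2) (ex 0)), congrFun (dd_comm hg (ex 2) (ex 1))]
        ring
      · exact (integrable_finsetSum _ fun i _ => I1 i).sub
          (integrable_finsetSum _ fun i _ => integrable_finsetSum _ fun j _ => I2 i j)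
      · exact (integrable_finsetSum _ fun i _ => I3 i).const_mul 2
      · exact integrable_finsetSum _ fun i _ => I1 i
      · exact integrable_finsetSum _ fun i _ => integrable_finsetSum _ fun j _ => I2 i j
    rw [dd_dd_time_waveSol hg]
    simp only [hsp]
    linarith
  have hM : ContDiff ℝ 2 (waveSol g) := contDiff_waveSol (n := 2) hg
  have hcl : Continuous fun p => dd eT (dd eT (waveSol g)) p :=
    continuous_dd (contDiff_one_dd hM _) _
  have hcr : Continuous fun p => ∑ i, dd (eX i) (dd (eX i) (waveSol g)) p :=
    continuous_finsetSum _ fun i _ => continuous_dd (contDiff_one_dd hM _) _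
  -- Both sides are continuous, so the time `t = 0` is reached by density.
  have hdense : Dense {p : ℝ × E3 | p.1 ≠ 0} :=
    (dense_compl_singleton (0 : ℝ)).preimage isOpenMap_fst
  exact congrFun (Continuous.ext_on hdense hcl hcr fun q hq => hne q.1 q.2 hq) p

theorem abs_waveSol_le {g : E3 → ℝ} {G : ℝ} (hG : ∀ x, |g x| ≤ G) (t : ℝ) (x : E3) :
    |waveSol g (t, x)| ≤ |t| * G :=
  abs_wmean_le (fun _ _ => le_rfl) hG x

theorem abs_dd_time_waveSol_le {g : E3 → ℝ} (hg : ContDiff ℝ 1 g) {G : ℝ} (hG : ∀ x, |g x| ≤ G)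
    (hG' : ∀ i x, |dd (ex i) g x| ≤ G) (t : ℝ) (x : E3) :
    |dd eT (waveSol g) (t, x)| ≤ G + 3 * (|t| * G) := by
  rw [dd_time_waveSol hg]
  have h1 : |wmean (fun _ _ => 1) g (t, x)| ≤ 1 * G := abs_wmean_le (fun _ _ => by simp) hG x
  have h2 : ∀ i, |wmean (fun t η => t * η i) (dd (ex i) g) (t, x)| ≤ |t| * G := by
    intro i
    refine abs_wmean_le (fun η hη => ?_) (hG' i) x
    rw [abs_mul]
    exact mul_le_of_le_one_right (abs_nonneg _) ((PiLp.norm_apply_le η i).trans hη)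
  calc _ ≤ |wmean (fun _ _ => 1) g (t, x)| +
        ∑ i, |wmean (fun t η => t * η i) (dd (ex i) g) (t, x)| :=
        (abs_add_le _ _).trans (add_le_add le_rfl (Finset.abs_sum_le_sum_abs _ _))
    _ ≤ 1 * G + ∑ i : Fin 3, |t| * G := add_le_add h1 (Finset.sum_le_sum fun i _ => h2 i)
    _ = _ := by simp

end SphericalMeans

/-! ### The Klein-Gordon propagator with data `0, g`. -/

section Propagator

/-- The function `s ↦ J₁(√s) / √s`. -/
def massKernel (s : ℝ) : ℝ := besselFun 1 s / 2

/-- The derivative of `massKernel`. -/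
def massKernel' (s : ℝ) : ℝ := -besselFun 2 s / 8

/-- The second derivative of `massKernel`. -/
def massKernel'' (s : ℝ) : ℝ := besselFun 3 s / 32

theorem hasDerivAt_massKernel (s : ℝ) : HasDerivAt massKernel (massKernel' s) s :=
  ((hasDerivAt_besselFun 1 s).div_const 2).congr_deriv (by rw [massKernel']; ring)

theorem hasDerivAt_massKernel' (s : ℝ) : HasDerivAt massKernel' (massKernel'' s) s :=
  ((hasDerivAt_besselFun 2 s).neg.div_const 8).congr_deriv (by rw [massKernel'']; ring)

theorem contDiff_massKernel (n : ℕ) : ContDiff ℝ n massKernel :=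
  (contDiff_besselFun n 1).div_const 2

theorem contDiff_massKernel' (n : ℕ) : ContDiff ℝ n massKernel' :=
  (contDiff_besselFun n 2).neg.div_const 8

theorem contDiff_massKernel'' (n : ℕ) : ContDiff ℝ n massKernel'' :=
  (contDiff_besselFun n 3).div_const 32

theorem massKernel_zero : massKernel 0 = 1 / 2 := by
  rw [massKernel, besselFun_one_zero]

/-- Evaluated at `t² - s²` and multiplied by `s`, this says that `kernelA` solves the
one-dimensional equation `∂ₜ²A - ∂ₛ²A + A = 0`. -/
theorem massKernel_ode (s : ℝ) : 4 * s * massKernel'' s + 8 * massKernel' s + massKernel s = 0 := by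
  rw [massKernel, massKernel', massKernel'']
  linear_combination besselFun_recurrence s

theorem hasDerivAt_massKernel_left (f f' : ℝ → ℝ) (hf : ∀ s, HasDerivAt f (f' s) s) (t s : ℝ) :
    HasDerivAt (fun t => f (t ^ 2 - s ^ 2)) (2 * t * f' (t ^ 2 - s ^ 2)) t := by
  have h := (hf (t ^ 2 - s ^ 2)).comp t ((hasDerivAt_pow 2 t).sub_const (s ^ 2))
  exact h.congr_deriv (by push_cast; ring)

theorem hasDerivAt_massKernel_right (f f' : ℝ → ℝ) (hf : ∀ s, HasDerivAt f (f' s) s) (t s : ℝ) :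
    HasDerivAt (fun s => f (t ^ 2 - s ^ 2)) (-(2 * s * f' (t ^ 2 - s ^ 2))) s := by
  have h := (hf (t ^ 2 - s ^ 2)).comp s ((hasDerivAt_pow 2 s).const_sub (t ^ 2))
  exact h.congr_deriv (by push_cast; ring)

/-- The integrand of the mass correction, for a general kernel `κ`. -/
def massIntegrand (κ : ℝ → ℝ → ℝ) (g : E3 → ℝ) (p : ℝ × E3) (s : ℝ) : ℝ :=
  κ p.1 s * waveSol g (s, p.2)

theorem contDiff_massIntegrand {κ : ℝ → ℝ → ℝ} {g : E3 → ℝ} {n : ℕ}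
    (hκ : ContDiff ℝ n κ.uncurry) (hg : ContDiff ℝ n g) :
    ContDiff ℝ n (massIntegrand κ g).uncurry := by
  refine ContDiff.mul (hκ.comp ((contDiff_fst.comp contDiff_fst).prodMk contDiff_snd)) ?_
  exact (contDiff_waveSol hg).comp (contDiff_snd.prodMk (contDiff_snd.comp contDiff_fst))

theorem dd_time_massIntegrand {κ κ' : ℝ → ℝ → ℝ} {g : E3 → ℝ} (hκ : ContDiff ℝ 1 κ.uncurry)
    (hκ' : ∀ t s, HasDerivAt (fun t => κ t s) (κ' t s) t) (hg : ContDiff ℝ 1 g) (s : ℝ) :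
    dd eT (fun p => massIntegrand κ g p s) = fun p => massIntegrand κ' g p s := by
  ext ⟨t, x⟩
  have h1 := contDiff_massIntegrand (n := 1) (mod_cast hκ) (mod_cast hg)
  have hd : DifferentiableAt ℝ (fun p => massIntegrand κ g p s) (t, x) :=
    (h1.comp (contDiff_prodMk_left s)).differentiable (by simp) _
  exact (hasDerivAt_time hd).unique ((hκ' t s).mul_const (waveSol g (s, x)))

theorem dd_space_massIntegrand {κ : ℝ → ℝ → ℝ} {g : E3 → ℝ} (hκ : ContDiff ℝ 1 κ.uncurry)
    (hg : ContDiff ℝ 1 g) (a : E3) (s : ℝ) :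
    dd (0, a) (fun p => massIntegrand κ g p s) = fun p => massIntegrand κ (dd a g) p s := by
  ext ⟨t, x⟩
  have h1 := contDiff_massIntegrand (n := 1) (mod_cast hκ) (mod_cast hg)
  have hd : DifferentiableAt ℝ (fun p => massIntegrand κ g p s) (t, x) :=
    (h1.comp (contDiff_prodMk_left s)).differentiable (by simp) _
  have hd2 : DifferentiableAt ℝ (waveSol g) (s, x) :=
    (contDiff_waveSol (n := 1) (mod_cast hg)).differentiable (by simp) _
  rw [dd_space_eq hd, dd]
  simp only [massIntegrand]
  rw [((hasFDerivAt_space hd2).const_mul (κ t s)).fderiv, ← dd_space_waveSol hg]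
  rfl

/-- The contribution of the mass term to the Klein-Gordon propagator. -/
def massCorrection (κ : ℝ → ℝ → ℝ) (g : E3 → ℝ) (p : ℝ × E3) : ℝ :=
  ∫ s in (0 : ℝ)..p.1, massIntegrand κ g p s

theorem contDiff_massCorrection {κ : ℝ → ℝ → ℝ} {g : E3 → ℝ} {n : ℕ}
    (hκ : ContDiff ℝ n κ.uncurry) (hg : ContDiff ℝ n g) :
    ContDiff ℝ n (massCorrection κ g) :=
  contDiff_intervalIntegral (contDiff_massIntegrand hκ hg) contDiff_fst

theorem dd_space_massCorrection {κ : ℝ → ℝ → ℝ} {g : E3 → ℝ} (hκ : ContDiff ℝ 1 κ.uncurry)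
    (hg : ContDiff ℝ 1 g) (a : E3) :
    dd (0, a) (massCorrection κ g) = massCorrection κ (dd a g) := by
  have h := dd_intervalIntegral (contDiff_massIntegrand (n := 1) (mod_cast hκ) (mod_cast hg))
    (ContinuousLinearMap.fst ℝ ℝ E3) (0, a)
  simp only [ContinuousLinearMap.coe_fst', zero_smul, zero_add,
    dd_space_massIntegrand hκ hg] at h
  exact h

theorem dd_time_massCorrection {κ κ' : ℝ → ℝ → ℝ} {g : E3 → ℝ} (hκ : ContDiff ℝ 1 κ.uncurry)
    (hκ' : ∀ t s, HasDerivAt (fun t => κ t s) (κ' t s) t) (hg : ContDiff ℝ 1 g) :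
    dd eT (massCorrection κ g) =
      fun p => κ p.1 p.1 * waveSol g p + massCorrection κ' g p := by
  have h := dd_intervalIntegral (contDiff_massIntegrand (n := 1) (mod_cast hκ) (mod_cast hg))
    (ContinuousLinearMap.fst ℝ ℝ E3) eT
  simp only [ContinuousLinearMap.coe_fst', one_smul, dd_time_massIntegrand hκ hκ' hg] at h
  exact h

/-- The kernel `s J₁(√(t² - s²)) / √(t² - s²)`. -/
def kernelA (t s : ℝ) : ℝ := s * massKernel (t ^ 2 - s ^ 2)

/-- The time derivative of `kernelA`. -/
def kernelB (t s : ℝ) : ℝ := s * (2 * t * massKernel' (t ^ 2 - s ^ 2))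

/-- The second time derivative of `kernelA`. -/
def kernelC (t s : ℝ) : ℝ :=
  s * (2 * massKernel' (t ^ 2 - s ^ 2) + 2 * t * (2 * t * massKernel'' (t ^ 2 - s ^ 2)))

theorem contDiff_sq_sub_sq {n : WithTop ℕ∞} : ContDiff ℝ n (fun p : ℝ × ℝ => p.1 ^ 2 - p.2 ^ 2) :=
  (contDiff_fst.pow 2).sub (contDiff_snd.pow 2)

theorem contDiff_kernelA (n : ℕ) : ContDiff ℝ n kernelA.uncurry :=
  contDiff_snd.mul ((contDiff_massKernel n).comp contDiff_sq_sub_sq)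

theorem contDiff_kernelB (n : ℕ) : ContDiff ℝ n kernelB.uncurry :=
  contDiff_snd.mul ((contDiff_const.mul contDiff_fst).mul
    ((contDiff_massKernel' n).comp contDiff_sq_sub_sq))

theorem hasDerivAt_kernelA (t s : ℝ) : HasDerivAt (fun t => kernelA t s) (kernelB t s) t :=
  (hasDerivAt_massKernel_left _ _ hasDerivAt_massKernel t s).const_mul s

theorem hasDerivAt_kernelB (t s : ℝ) : HasDerivAt (fun t => kernelB t s) (kernelC t s) t := by
  have h := (((hasDerivAt_id t).const_mul 2).mul
    (hasDerivAt_massKernel_left _ _ hasDerivAt_massKernel' t s)).const_mul s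
  exact h.congr_deriv (by simp [kernelC])

theorem contDiff_one_kernelA : ContDiff ℝ 1 kernelA.uncurry := mod_cast contDiff_kernelA 1

theorem contDiff_one_kernelB : ContDiff ℝ 1 kernelB.uncurry := mod_cast contDiff_kernelB 1

/-- The solution of the Klein-Gordon equation with initial data `0`, `g`. -/
def kgSol (g : E3 → ℝ) (p : ℝ × E3) : ℝ := waveSol g p - massCorrection kernelA g p

theorem contDiff_kgSol {g : E3 → ℝ} {n : ℕ} (hg : ContDiff ℝ n g) : ContDiff ℝ n (kgSol g) :=
  (contDiff_waveSol hg).sub (contDiff_massCorrection (contDiff_kernelA n) hg)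

theorem kgSol_zero (g : E3 → ℝ) (x : E3) : kgSol g (0, x) = 0 := by
  simp [kgSol, waveSol_zero, massCorrection]

theorem dd_space_kgSol {g : E3 → ℝ} (hg : ContDiff ℝ 1 g) (a : E3) :
    dd (0, a) (kgSol g) = kgSol (dd a g) := by
  have h1 : ContDiff ℝ 1 (waveSol g) := mod_cast contDiff_waveSol (n := 1) (mod_cast hg)
  have h2 : ContDiff ℝ 1 (massCorrection kernelA g) :=
    mod_cast contDiff_massCorrection (n := 1) (contDiff_kernelA 1) (mod_cast hg)
  unfold kgSol
  rw [dd_sub h1 h2, dd_space_waveSol hg, dd_space_massCorrection contDiff_one_kernelA hg]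

theorem dd_time_kgSol {g : E3 → ℝ} (hg : ContDiff ℝ 1 g) :
    dd eT (kgSol g) = fun p => dd eT (waveSol g) p -
      (p.1 / 2 * waveSol g p + massCorrection kernelB g p) := by
  have h1 : ContDiff ℝ 1 (waveSol g) := mod_cast contDiff_waveSol (n := 1) (mod_cast hg)
  have h2 : ContDiff ℝ 1 (massCorrection kernelA g) :=
    mod_cast contDiff_massCorrection (n := 1) (contDiff_kernelA 1) (mod_cast hg)
  unfold kgSol
  rw [dd_sub h1 h2, dd_time_massCorrection contDiff_one_kernelA hasDerivAt_kernelA hg]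
  ext p
  simp [kernelA, massKernel_zero, div_eq_mul_inv]

theorem dd_time_kgSol_zero {g : E3 → ℝ} (hg : ContDiff ℝ 1 g) (x : E3) :
    dd eT (kgSol g) (0, x) = g x := by
  rw [dd_time_kgSol hg]
  simp [dd_time_waveSol_zero hg, massCorrection]

/-- `kgSol g` solves the Klein-Gordon equation. -/
theorem kg_kgSol {g : E3 → ℝ} (hg : ContDiff ℝ 2 g) (p : ℝ × E3) : kg (kgSol g) p = 0 := by
  obtain ⟨t, x⟩ := p
  have hg1 : ContDiff ℝ 1 g := hg.of_le (by norm_num)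
  have hM : ContDiff ℝ 2 (waveSol g) := contDiff_waveSol (n := 2) hg
  have hM1 : ContDiff ℝ 1 (waveSol g) := hM.of_le (by norm_num)
  set m : ℝ → ℝ := fun s => waveSol g (s, x)
  set m1 : ℝ → ℝ := fun s => dd eT (waveSol g) (s, x)
  set m2 : ℝ → ℝ := fun s => dd eT (dd eT (waveSol g)) (s, x)
  have hm : ∀ s, HasDerivAt m (m1 s) s := fun s =>
    hasDerivAt_time (hM.differentiable (by simp) _)
  have hm1 : ∀ s, HasDerivAt m1 (m2 s) s := fun s =>
    hasDerivAt_time ((contDiff_one_dd hM _).differentiable (by simp) _)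
  have hm0 : m 0 = 0 := waveSol_zero g x
  have hmc : Continuous m := hM.continuous.comp (Continuous.prodMk_left x)
  have hm1c : Continuous m1 := (continuous_dd hM1 _).comp (Continuous.prodMk_left x)
  have hm2c : Continuous m2 :=
    (continuous_dd (contDiff_one_dd hM _) _).comp (Continuous.prodMk_left x)
  have hk := (contDiff_massKernel 0).continuous
  have hk' := (contDiff_massKernel' 0).continuous
  have hk'' := (contDiff_massKernel'' 0).continuous
  -- second time derivative
  have htt : dd eT (dd eT (kgSol g)) (t, x) = m2 t -
      (1 / 2 * m t + t / 2 * m1 t + (kernelB t t * m t + ∫ s in (0 : ℝ)..t, kernelC t s * m s)) := by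
    have hB : ContDiff ℝ 1 (massCorrection kernelB g) :=
      mod_cast contDiff_massCorrection (n := 1) (contDiff_kernelB 1) (mod_cast hg1)
    have hBd := hasDerivAt_time (hB.differentiable (by simp) (t, x))
    rw [dd_time_massCorrection contDiff_one_kernelB hasDerivAt_kernelB hg1] at hBd
    have h := (hm1 t).sub ((((hasDerivAt_id t).div_const 2).mul (hm t)).add hBd)
    have hU : ContDiff ℝ 1 (dd eT (kgSol g)) := contDiff_one_dd (contDiff_kgSol (n := 2) hg) _
    have h' := hasDerivAt_time (hU.differentiable (by simp) (t, x))
    refine h'.unique (h.congr_of_eventuallyEq (Eventually.of_forall fun s => ?_))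
    rw [dd_time_kgSol hg1]
    rfl
  -- Laplacian
  have hxx : ∑ i, dd (eX i) (dd (eX i) (kgSol g)) (t, x) =
      m2 t - ∫ s in (0 : ℝ)..t, kernelA t s * m2 s := by
    have h1 : ∀ i, dd (eX i) (dd (eX i) (kgSol g)) = kgSol (dd (ex i) (dd (ex i) g)) := fun i => by
      rw [dd_space_kgSol hg1, dd_space_kgSol (contDiff_one_dd hg _)]
    have h2 : ∀ i, dd (eX i) (dd (eX i) (waveSol g)) = waveSol (dd (ex i) (dd (ex i) g)) :=
      fun i => by rw [dd_space_waveSol hg1, dd_space_waveSol (contDiff_one_dd hg _)]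
    have h3 : ∀ s, m2 s = ∑ i, waveSol (dd (ex i) (dd (ex i) g)) (s, x) := fun s => by
      simp only [m2, waveSol_wave hg, h2]
    simp only [h1, kgSol, Finset.sum_sub_distrib, h3, massCorrection, Finset.mul_sum]
    rw [intervalIntegral.integral_finsetSum]
    · rfl
    · intro i _
      have hw : Continuous (waveSol (dd (ex i) (dd (ex i) g))) :=
        (contDiff_waveSol (n := 0)
          (contDiff_zero.2 (continuous_dd (contDiff_one_dd hg _) _))).continuous
      exact (((contDiff_kernelA 0).continuous.comp (Continuous.prodMk_right t)).mul
        (hw.comp (Continuous.prodMk_left x))).intervalIntegrable _ _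
  -- integration by parts
  set P : ℝ → ℝ := fun s => massKernel (t ^ 2 - s ^ 2) - 2 * s ^ 2 * massKernel' (t ^ 2 - s ^ 2)
  -- `P` is `∂ₛ kernelA` and the bracket is `-∂ₛP`, so the integrand is the derivative of `kernelA *
  -- m1 - P * m`; two integrations by parts in one.
  have hibp : ∫ s in (0 : ℝ)..t, (kernelA t s * m2 s + (6 * s * massKernel' (t ^ 2 - s ^ 2) -
      4 * s ^ 3 * massKernel'' (t ^ 2 - s ^ 2)) * m s) =
      (kernelA t t * m1 t - P t * m t) - (kernelA t 0 * m1 0 - P 0 * m 0) := by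
    refine intervalIntegral.integral_eq_sub_of_hasDerivAt
      (f := fun s => kernelA t s * m1 s - P s * m s) (fun s _ => ?_) ?_
    · have hA := (hasDerivAt_id s).mul
        (hasDerivAt_massKernel_right _ _ hasDerivAt_massKernel t s)
      have hP := (hasDerivAt_massKernel_right _ _ hasDerivAt_massKernel t s).sub
        (((hasDerivAt_pow 2 s).const_mul 2).mul
          (hasDerivAt_massKernel_right _ _ hasDerivAt_massKernel' t s))
      have h := (hA.mul (hm1 s)).sub (hP.mul (hm s))
      refine h.congr_deriv ?_
      simp [kernelA]
      ring
    · refine Continuous.intervalIntegrable ?_ _ _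
      unfold kernelA
      fun_prop
  -- Here `massKernel_ode` replaces `∂ₛ²A` by `∂ₜ²A + A`.
  have hint : ∫ s in (0 : ℝ)..t, (kernelA t s * m2 s + (6 * s * massKernel' (t ^ 2 - s ^ 2) -
      4 * s ^ 3 * massKernel'' (t ^ 2 - s ^ 2)) * m s) =
      (∫ s in (0 : ℝ)..t, kernelA t s * m2 s) - (∫ s in (0 : ℝ)..t, kernelC t s * m s) -
      ∫ s in (0 : ℝ)..t, kernelA t s * m s := by
    rw [← intervalIntegral.integral_sub, ← intervalIntegral.integral_sub]
    · refine intervalIntegral.integral_congr fun s _ => ?_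
      have := massKernel_ode (t ^ 2 - s ^ 2)
      simp only [kernelA, kernelC]
      linear_combination (s * m s) * this
    all_goals
      simp only [kernelA, kernelC]
      refine Continuous.intervalIntegrable ?_ _ _
      fun_prop
  have hA0 : kernelA t 0 = 0 := by simp [kernelA]
  have hAt : kernelA t t = t / 2 := by simp [kernelA, massKernel_zero, div_eq_mul_inv]
  have hPt : P t = 1 / 2 - t * (2 * t * massKernel' 0) := by
    simp only [P, sub_self, massKernel_zero]
    ring
  have hBt : kernelB t t = t * (2 * t * massKernel' 0) := by simp [kernelB]
  have hU : kgSol g (t, x) = m t - ∫ s in (0 : ℝ)..t, kernelA t s * m s := rfl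
  -- At `s = 0` the boundary terms vanish because `kernelA t 0 = 0` and `m 0 = 0`. At `s = t` they
  -- match the diagonal terms of Leibniz's rule in `htt`.
  rw [hint, hA0, hAt, hPt, hm0] at hibp
  rw [kg, htt, hxx, hU, hBt]
  linear_combination hibp

theorem exists_abs_massCorrection_le {κ : ℝ → ℝ → ℝ} (hκ : Continuous κ.uncurry) (T : ℝ) :
    ∃ C, 0 ≤ C ∧ ∀ (g : E3 → ℝ) (G : ℝ), (∀ x, |g x| ≤ G) → ∀ t, |t| ≤ T → ∀ x,
      |massCorrection κ g (t, x)| ≤ C * G := by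
  obtain ⟨K, hK⟩ := ((isCompact_Icc (a := -T) (b := T)).prod
    (isCompact_Icc (a := -T) (b := T))).bddAbove_image hκ.norm.continuousOn
  refine ⟨|K| * |T| * |T|, by positivity, fun g G hG t ht x => ?_⟩
  have hG0 : 0 ≤ G := (abs_nonneg _).trans (hG 0)
  have hT : 0 ≤ T := (abs_nonneg t).trans ht
  have h := intervalIntegral.norm_integral_le_of_norm_le_const (a := 0) (b := t)
    (f := massIntegrand κ g (t, x)) (C := |K| * (|T| * G)) (fun s hs => ?_)
  · rw [sub_zero] at h
    calc |massCorrection κ g (t, x)| ≤ |K| * (|T| * G) * |t| := h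
      _ ≤ |K| * (|T| * G) * |T| :=
        mul_le_mul_of_nonneg_left (ht.trans (le_abs_self T)) (by positivity)
      _ = _ := by ring
  · have hs' : |s| ≤ T := by
      rcases le_total 0 t with h0 | h0
      · rw [uIoc_of_le h0] at hs
        rw [abs_of_nonneg hs.1.le]
        exact hs.2.trans ((le_abs_self t).trans ht)
      · rw [uIoc_of_ge h0] at hs
        rw [abs_of_nonpos hs.2]
        exact (neg_le_neg hs.1.le).trans ((neg_le_abs t).trans ht)
    have h1 : ‖κ t s‖ ≤ |K| :=
      (hK ⟨(t, s), Set.mk_mem_prod (abs_le.1 ht) (abs_le.1 hs'), rfl⟩).trans (le_abs_self K)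
    rw [massIntegrand, norm_mul]
    refine mul_le_mul h1 ((abs_waveSol_le hG s x).trans ?_) (norm_nonneg _) (abs_nonneg _)
    exact mul_le_mul_of_nonneg_right (hs'.trans (le_abs_self T)) hG0

/-- The constant is uniform in `g`. As `kgSol` commutes with spatial derivatives, the bound can be
applied to second derivatives of the data and controls those of the solution. -/
theorem exists_abs_kgSol_le (T : ℝ) : ∃ C, 0 ≤ C ∧ ∀ (g : E3 → ℝ) (G : ℝ), (∀ x, |g x| ≤ G) →
    ∀ t, |t| ≤ T → ∀ x, |kgSol g (t, x)| ≤ C * G := by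
  obtain ⟨C, hC, h⟩ := exists_abs_massCorrection_le (contDiff_kernelA 0).continuous T
  refine ⟨|T| + C, by positivity, fun g G hG t ht x => ?_⟩
  have hG0 : 0 ≤ G := (abs_nonneg _).trans (hG 0)
  have h1 : |waveSol g (t, x)| ≤ |T| * G := (abs_waveSol_le hG t x).trans
    (mul_le_mul_of_nonneg_right (ht.trans (le_abs_self T)) hG0)
  have h2 := abs_sub (waveSol g (t, x)) (massCorrection kernelA g (t, x))
  have h3 := h g G hG t ht x
  rw [kgSol]
  linarith

/-- The time derivative of a spherical mean involves `∇g`. This loss of one derivative explains why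
`u₁` is taken in `C_b³` while `C_b²` suffices for `u₂`. -/
theorem exists_abs_dd_time_kgSol_le (T : ℝ) : ∃ C, 0 ≤ C ∧ ∀ (g : E3 → ℝ) (G : ℝ),
    ContDiff ℝ 1 g → (∀ x, |g x| ≤ G) → (∀ i x, |dd (ex i) g x| ≤ G) →
    ∀ t, |t| ≤ T → ∀ x, |dd eT (kgSol g) (t, x)| ≤ C * G := by
  obtain ⟨C, hC, h⟩ := exists_abs_massCorrection_le (contDiff_kernelB 0).continuous T
  refine ⟨1 + 3 * |T| + |T| * |T| + C, by positivity, fun g G hg hG hG' t ht x => ?_⟩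
  have hG0 : 0 ≤ G := (abs_nonneg _).trans (hG 0)
  have ht' : |t| ≤ |T| := ht.trans (le_abs_self T)
  have h1 : |waveSol g (t, x)| ≤ |T| * G := (abs_waveSol_le hG t x).trans
    (mul_le_mul_of_nonneg_right ht' hG0)
  have h2 : |dd eT (waveSol g) (t, x)| ≤ G + 3 * (|T| * G) :=
    (abs_dd_time_waveSol_le hg hG hG' t x).trans (by gcongr)
  have h3 := h g G hG t ht x
  have h4 : |t / 2 * waveSol g (t, x)| ≤ |T| * (|T| * G) := by
    rw [abs_mul]
    refine mul_le_mul ?_ h1 (abs_nonneg _) (abs_nonneg _)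
    rw [abs_div, abs_two]
    linarith [abs_nonneg t]
  rw [dd_time_kgSol hg]
  have h5 := abs_sub (dd eT (waveSol g) (t, x))
    (t / 2 * waveSol g (t, x) + massCorrection kernelB g (t, x))
  have h6 := abs_add_le (t / 2 * waveSol g (t, x)) (massCorrection kernelB g (t, x))
  simp only
  linarith

end Propagator

/-! ### The homogeneous Klein-Gordon equation with general data. -/

section HomogeneousSolution

theorem kg_dd_time {V : ℝ × E3 → ℝ} (hV : ContDiff ℝ 3 V) (p : ℝ × E3) :
    kg (dd eT V) p = dd eT (kg V) p := by
  have hV2 : ContDiff ℝ 2 V := hV.of_le (by norm_num)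
  have hV1 : ContDiff ℝ 1 V := hV.of_le (by norm_num)
  have hd : ∀ a, ContDiff ℝ 2 (dd a V) := fun a => contDiff_dd (n := 2) hV a
  have h1 : ∀ i, dd (eX i) (dd (eX i) (dd eT V)) = dd eT (dd (eX i) (dd (eX i) V)) := fun i => by
    rw [dd_comm hV2 (eX i) eT, dd_comm (hd (eX i)) (eX i) eT]
  have hdd : ∀ a b, ContDiff ℝ 1 (dd a (dd b V)) := fun a b => contDiff_one_dd (hd b) a
  have h2 : dd eT (kg V) = fun p => dd eT (dd eT (dd eT V)) p -
      ∑ i, dd eT (dd (eX i) (dd (eX i) V)) p + dd eT V p := by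
    unfold kg
    rw [dd_add ((hdd _ _).sub (ContDiff.sum fun i _ => hdd _ _)) hV1,
      dd_sub (hdd _ _) (ContDiff.sum fun i _ => hdd _ _), dd_sum _ fun i => hdd _ _]
  rw [h2]
  simp only [kg, h1]

theorem kg_add {U V : ℝ × E3 → ℝ} (hU : ContDiff ℝ 2 U) (hV : ContDiff ℝ 2 V) (p : ℝ × E3) :
    kg (fun p => U p + V p) p = kg U p + kg V p := by
  have h : ∀ a, dd a (dd a (fun p => U p + V p)) = fun p => dd a (dd a U) p + dd a (dd a V) p :=
    fun a => by
      rw [dd_add (hU.of_le (by norm_num)) (hV.of_le (by norm_num)),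
        dd_add (contDiff_one_dd hU _) (contDiff_one_dd hV _)]
  simp only [kg, h, Finset.sum_add_distrib]
  ring

theorem kg_sub {U V : ℝ × E3 → ℝ} (hU : ContDiff ℝ 2 U) (hV : ContDiff ℝ 2 V) (p : ℝ × E3) :
    kg (fun p => U p - V p) p = kg U p - kg V p := by
  have h : ∀ a, dd a (dd a (fun p => U p - V p)) = fun p => dd a (dd a U) p - dd a (dd a V) p :=
    fun a => by
      rw [dd_sub (hU.of_le (by norm_num)) (hV.of_le (by norm_num)),
        dd_sub (contDiff_one_dd hU _) (contDiff_one_dd hV _)]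
  simp only [kg, h, Finset.sum_sub_distrib]
  ring

theorem IsCb.dd {k : ℕ} {g : E3 → ℝ} (hg : IsCb (k + 1) g) (a : E3) : IsCb k (dd a g) := by
  refine ⟨contDiff_dd hg.contDiff a, fun i hi => ?_⟩
  obtain ⟨C, hC⟩ := hg.bounded (i + 1) (by omega)
  refine ⟨‖ContinuousLinearMap.apply ℝ ℝ a‖ * C, fun x => ?_⟩
  have hf : ContDiff ℝ k (fderiv ℝ g) := hg.contDiff.fderiv_right (by norm_cast)
  have h := (ContinuousLinearMap.apply ℝ ℝ a).norm_iteratedFDeriv_comp_left (n := i)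
    (hf.contDiffAt (x := x)) (by exact_mod_cast hi)
  refine h.trans (mul_le_mul_of_nonneg_left ?_ (norm_nonneg _))
  rw [norm_iteratedFDeriv_fderiv]
  exact hC x

theorem IsCb.exists_bound {k : ℕ} {g : E3 → ℝ} (hg : IsCb k g) : ∃ C, ∀ x, |g x| ≤ C := by
  obtain ⟨C, hC⟩ := hg.bounded 0 (Nat.zero_le _)
  exact ⟨C, fun x => by simpa using hC x⟩

theorem IsCb.exists_bound_dd {k : ℕ} {g : E3 → ℝ} (hg : IsCb (k + 1) g) :
    ∃ C, (∀ x, |g x| ≤ C) ∧ ∀ i x, |VlasovKleinGordon.dd (ex i) g x| ≤ C := by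
  obtain ⟨C, hC⟩ := hg.exists_bound
  choose D hD using fun i => (hg.dd (ex i)).exists_bound
  refine ⟨C + ∑ i, D i, fun x => (hC x).trans (le_add_of_nonneg_right
    (Finset.sum_nonneg fun i _ => (abs_nonneg _).trans (hD i 0))), fun i x => ?_⟩
  have h1 := Finset.single_le_sum (f := D) (fun i _ => (abs_nonneg _).trans (hD i 0))
    (Finset.mem_univ i)
  linarith [hD i x, (abs_nonneg _).trans (hC 0)]

theorem isCb_of_hasCompactSupport {g : E3 → ℝ} (hg : ContDiff ℝ ∞ g) (hc : HasCompactSupport g)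
    (k : ℕ) : IsCb k g := by
  have hk : ∀ i : ℕ, ContDiff ℝ i g := fun i => hg.of_le (by exact_mod_cast le_top)
  refine ⟨hk k, fun i _ => ?_⟩
  exact ((hk i).continuous_iteratedFDeriv le_rfl).bounded_above_of_compact_support
    (hc.iteratedFDeriv i)

/-- Second spatial derivatives are bounded locally uniformly in time. -/
def HessBounded (U : ℝ × E3 → ℝ) : Prop :=
  ∀ T : ℝ, ∃ C, ∀ t, |t| ≤ T → ∀ x i j, |dd (eX j) (dd (eX i) U) (t, x)| ≤ C

theorem exists_forall_fin_le {P : Fin 3 → Fin 3 → ℝ → Prop}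
    (hP : ∀ i j C D, C ≤ D → P i j C → P i j D) (h : ∀ i j, ∃ C, P i j C) :
    ∃ C, ∀ i j, P i j C := by
  choose C hC using h
  obtain ⟨M, hM⟩ := (Set.finite_range (fun q : Fin 3 × Fin 3 => C q.1 q.2)).bddAbove
  exact ⟨M, fun i j => hP i j _ _ (hM ⟨(i, j), rfl⟩) (hC i j)⟩

theorem hessBounded_of_forall {U : ℝ × E3 → ℝ}
    (h : ∀ (T : ℝ) (i j : Fin 3), ∃ C, ∀ t, |t| ≤ T → ∀ x, |dd (eX j) (dd (eX i) U) (t, x)| ≤ C) :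
    HessBounded U := by
  intro T
  obtain ⟨C, hC⟩ := exists_forall_fin_le
    (P := fun i j C => ∀ t, |t| ≤ T → ∀ x, |dd (eX j) (dd (eX i) U) (t, x)| ≤ C)
    (fun i j C D hCD h t ht x => (h t ht x).trans hCD) (h T)
  exact ⟨C, fun t ht x i j => hC i j t ht x⟩

theorem HessBounded.add {U V : ℝ × E3 → ℝ} (hU : ContDiff ℝ 2 U) (hV : ContDiff ℝ 2 V)
    (hbU : HessBounded U) (hbV : HessBounded V) : HessBounded (fun p => U p + V p) := by
  intro T
  obtain ⟨C, hC⟩ := hbU T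
  obtain ⟨D, hD⟩ := hbV T
  refine ⟨C + D, fun t ht x i j => ?_⟩
  rw [dd_add (hU.of_le (by norm_num)) (hV.of_le (by norm_num)),
    dd_add (contDiff_one_dd hU _) (contDiff_one_dd hV _)]
  exact (abs_add_le _ _).trans (add_le_add (hC t ht x i j) (hD t ht x i j))

theorem dd_dd_space_kgSol {g : E3 → ℝ} (hg : ContDiff ℝ 2 g) (i j : Fin 3) :
    dd (eX j) (dd (eX i) (kgSol g)) = kgSol (dd (ex j) (dd (ex i) g)) := by
  rw [dd_space_kgSol (hg.of_le (by norm_num)), dd_space_kgSol (contDiff_one_dd hg _)]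

theorem hessBounded_kgSol {g : E3 → ℝ} (hg : IsCb 2 g) : HessBounded (kgSol g) := by
  refine hessBounded_of_forall fun T i j => ?_
  obtain ⟨C, _, hC⟩ := exists_abs_kgSol_le T
  obtain ⟨G, hG⟩ := ((hg.dd (ex i)).dd (ex j)).exists_bound
  refine ⟨C * G, fun t ht x => ?_⟩
  rw [dd_dd_space_kgSol hg.contDiff]
  exact hC _ G hG t ht x

theorem dd_dd_space_dd_time_kgSol {g : E3 → ℝ} (hg : ContDiff ℝ 3 g) (i j : Fin 3) :
    dd (eX j) (dd (eX i) (dd eT (kgSol g))) = dd eT (kgSol (dd (ex j) (dd (ex i) g))) := by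
  have hg2 : ContDiff ℝ 2 g := hg.of_le (by norm_num)
  rw [dd_comm (contDiff_kgSol (n := 2) hg2) (eX i) eT, dd_space_kgSol (hg.of_le (by norm_num)),
    dd_comm (contDiff_kgSol (n := 2) (contDiff_dd (n := 2) hg _)) (eX j) eT,
    dd_space_kgSol (contDiff_one_dd hg2 _)]

theorem hessBounded_dd_time_kgSol {g : E3 → ℝ} (hg : IsCb 3 g) :
    HessBounded (dd eT (kgSol g)) := by
  refine hessBounded_of_forall fun T i j => ?_
  obtain ⟨C, _, hC⟩ := exists_abs_dd_time_kgSol_le T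
  have h1 := (hg.dd (ex i)).dd (ex j)
  obtain ⟨G, hG, hG'⟩ := h1.exists_bound_dd
  refine ⟨C * G, fun t ht x => ?_⟩
  rw [dd_dd_space_dd_time_kgSol hg.contDiff]
  exact hC _ G (mod_cast h1.contDiff) hG hG' t ht x

/-- Solutions of the homogeneous Klein-Gordon equation. -/
theorem exists_kg_homogeneous {u₁ u₂ : E3 → ℝ} (h₁ : IsCb 3 u₁) (h₂ : IsCb 2 u₂) :
    ∃ U : ℝ × E3 → ℝ, ContDiff ℝ 2 U ∧ (∀ p, kg U p = 0) ∧ (∀ x, U (0, x) = u₁ x) ∧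
      (∀ x, dd eT U (0, x) = u₂ x) ∧ HessBounded U := by
  have hV : ContDiff ℝ 3 (kgSol u₁) := contDiff_kgSol (n := 3) h₁.contDiff
  have hV1 : ContDiff ℝ 2 (dd eT (kgSol u₁)) := contDiff_dd (n := 2) hV _
  have hV2 : ContDiff ℝ 2 (kgSol u₂) := contDiff_kgSol (n := 2) h₂.contDiff
  have c₁ : ContDiff ℝ 2 u₁ := h₁.contDiff.of_le (by norm_num)
  have hkg0 : kg (kgSol u₁) = fun _ => 0 := funext fun p => kg_kgSol c₁ p
  -- The time derivative of the propagator carries the initial position, the propagator itself the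
  -- initial velocity.
  refine ⟨fun p => dd eT (kgSol u₁) p + kgSol u₂ p, hV1.add hV2, fun p => ?_, fun x => ?_,
    fun x => ?_, (hessBounded_dd_time_kgSol h₁).add hV1 hV2 (hessBounded_kgSol h₂)⟩
  · rw [kg_add hV1 hV2, kg_dd_time hV, hkg0, kg_kgSol h₂.contDiff]
    simp [dd]
  · simp only [dd_time_kgSol_zero (c₁.of_le (by norm_num)), kgSol_zero, add_zero]
  · rw [dd_add (hV1.of_le (by norm_num)) (hV2.of_le (by norm_num))]
    -- At `t = 0` the function `kgSol u₁` and its spatial derivatives vanish, so the equation forces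
    -- `∂ₜ² kgSol u₁ = 0` there; the first summand adds nothing to the initial velocity.
    have h0 := kg_kgSol c₁ (0, x)
    rw [kg, kgSol_zero] at h0
    have hs : ∀ i, dd (eX i) (dd (eX i) (kgSol u₁)) (0, x) = 0 := fun i => by
      rw [dd_dd_space_kgSol c₁, kgSol_zero]
    simp only [hs, Finset.sum_const_zero] at h0
    simp only [dd_time_kgSol_zero (g := u₂) (h₂.contDiff.of_le (by norm_num))]
    linarith

end HomogeneousSolution

/-! ### Duhamel's principle for a superposition of moving sources. -/

section Duhamel

variable {Y : Type} [MeasurableSpace Y] {μ : Measure Y} {K : Set Y}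
  {a : Y → ℝ} {X : ℝ → Y → E3} {V : ℝ × E3 → ℝ}

/-- The superposition at time `s` of translates of `V (τ, ·)`. -/
def superpose (μ : Measure Y) (K : Set Y) (a : Y → ℝ) (X : ℝ → Y → E3) (V : ℝ × E3 → ℝ)
    (p : ℝ × E3) (s : ℝ) : ℝ :=
  ∫ z in K, a z * V (p.1 - s, p.2 - X s z) ∂μ

/-- Duhamel's integral for a superposition of moving sources. -/
def duhamel (μ : Measure Y) (K : Set Y) (a : Y → ℝ) (X : ℝ → Y → E3) (V : ℝ × E3 → ℝ)
    (p : ℝ × E3) : ℝ :=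
  ∫ s in (0 : ℝ)..p.1, superpose μ K a X V p s

/-- Removes the boundary term of Leibniz's rule in the first derivative of `duhamel`, so that a
boundary term appears only in second derivatives. -/
theorem superpose_diag_eq_zero (hV : ∀ x, V (0, x) = 0) (p : ℝ × E3) :
    superpose μ K a X V p p.1 = 0 := by
  simp [superpose, hV]

theorem continuous_superpose_integrand {Y : Type} [TopologicalSpace Y] {a : Y → ℝ}
    {X : ℝ → Y → E3} {F : Type} [NormedAddCommGroup F] [NormedSpace ℝ F]
    {V : ℝ × E3 → F} (ha : Continuous a) (hX : Continuous X.uncurry) (hV : Continuous V) :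
    Continuous (Function.uncurry fun (q : (ℝ × E3) × ℝ) z =>
      a z • V (q.1.1 - q.2, q.1.2 - X q.2 z)) := by
  have hX' : Continuous fun w : ((ℝ × E3) × ℝ) × Y => X w.1.2 w.2 :=
    hX.comp ((continuous_snd.comp continuous_fst).prodMk continuous_snd)
  refine (ha.comp continuous_snd).smul (hV.comp ?_)
  exact Continuous.prodMk (by fun_prop) (Continuous.sub (by fun_prop) hX')

set_option linter.unusedSectionVars false

variable [TopologicalSpace Y] [T2Space Y] [OpensMeasurableSpace Y] [SecondCountableTopology Y]
  [IsLocallyFiniteMeasure μ]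

theorem continuous_superpose (hK : IsCompact K) (ha : Continuous a) (hX : Continuous X.uncurry)
    (hV : Continuous V) : Continuous (superpose μ K a X V).uncurry :=
  continuous_parametric_integral_of_continuous (μ := μ) (X := (ℝ × E3) × ℝ)
    (f := fun q z => a z • V (q.1.1 - q.2, q.1.2 - X q.2 z))
    (continuous_superpose_integrand ha hX hV) hK

theorem continuous_duhamel (hK : IsCompact K) (ha : Continuous a) (hX : Continuous X.uncurry)
    (hV : Continuous V) : Continuous (duhamel μ K a X V) :=
  intervalIntegral.continuous_parametric_intervalIntegral_of_continuous
    (continuous_superpose hK ha hX hV) continuous_fst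

theorem hasFDerivAt_superpose (hK : IsCompact K) (ha : Continuous a)
    (hX : Continuous X.uncurry) (hV : ContDiff ℝ 1 V) (p : ℝ × E3) (s : ℝ) :
    HasFDerivAt (fun p => superpose μ K a X V p s)
      (∫ z in K, a z • fderiv ℝ V (p.1 - s, p.2 - X s z) ∂μ) p := by
  have h1 := continuous_superpose_integrand ha hX hV.continuous
  have h2 := continuous_superpose_integrand ha hX (hV.continuous_fderiv (by simp))
  have hm : Continuous fun w : (ℝ × E3) × Y => ((w.1, s), w.2) := by fun_prop
  refine hasFDerivAt_setIntegral_of_continuous (μ := μ) hK hK.measurableSet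
    (f := fun (p : ℝ × E3) z => a z * V (p.1 - s, p.2 - X s z))
    (f' := fun (p : ℝ × E3) z => a z • fderiv ℝ V (p.1 - s, p.2 - X s z)) (h1.comp hm) (h2.comp hm)
    (fun p z _ => ?_) p
  have h3 : HasFDerivAt (fun p : ℝ × E3 => V (p - (s, X s z)))
      (fderiv ℝ V (p - (s, X s z))) p := by
    rw [hasFDerivAt_comp_sub]
    exact (hV.differentiable (by simp) _).hasFDerivAt
  exact h3.const_mul (a z)

theorem dd_duhamel (hK : IsCompact K) (ha : Continuous a) (hX : Continuous X.uncurry)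
    (hV : ContDiff ℝ 1 V) (v : ℝ × E3) :
    Differentiable ℝ (duhamel μ K a X V) ∧ dd v (duhamel μ K a X V) = fun p =>
      v.1 * superpose μ K a X V p p.1 + duhamel μ K a X (dd v V) p := by
  have h2 := continuous_superpose_integrand ha hX (hV.continuous_fderiv (by simp))
  have h3 := continuous_parametric_integral_of_continuous (μ := μ) h2 hK
  have hd := fun p => hasFDerivAt_intervalIntegral_param
    (continuous_superpose (μ := μ) hK ha hX hV.continuous)
    (N' := fun (p : ℝ × E3) s => ∫ z in K, a z • fderiv ℝ V (p.1 - s, p.2 - X s z) ∂μ) h3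
    (fun p s => hasFDerivAt_superpose hK ha hX hV p s) (ContinuousLinearMap.fst ℝ ℝ E3) p
  refine ⟨fun p => (hd p).differentiableAt, ?_⟩
  ext p
  have h4 : dd v (duhamel μ K a X V) p = _ := congrArg (fun L => L v) (hd p).fderiv
  rw [h4]
  simp only [add_apply, ContinuousLinearMap.smulRight_apply,
    ContinuousLinearMap.coe_fst', smul_eq_mul]
  congr 1
  have h6 : Continuous fun s => ∫ z in K, a z • fderiv ℝ V (p.1 - s, p.2 - X s z) ∂μ :=
    h3.comp (Continuous.prodMk_right p)
  rw [ContinuousLinearMap.intervalIntegral_apply (h6.intervalIntegrable _ _)]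
  refine intervalIntegral.integral_congr fun s _ => ?_
  have h5 : IntegrableOn (fun z => a z • fderiv ℝ V (p.1 - s, p.2 - X s z)) K μ :=
    (h2.comp (Continuous.prodMk_right (p, s))).continuousOn.integrableOn_compact' hK
      hK.measurableSet
  exact ContinuousLinearMap.integral_apply h5 v

theorem dd_duhamel_of_zero (hK : IsCompact K) (ha : Continuous a) (hX : Continuous X.uncurry)
    (hV : ContDiff ℝ 1 V) (hV0 : ∀ x, V (0, x) = 0) (v : ℝ × E3) :
    dd v (duhamel μ K a X V) = duhamel μ K a X (dd v V) := by
  rw [(dd_duhamel hK ha hX hV v).2]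
  simp only [superpose_diag_eq_zero hV0, mul_zero, zero_add]

theorem dd_dd_duhamel (hK : IsCompact K) (ha : Continuous a) (hX : Continuous X.uncurry)
    (hV : ContDiff ℝ 2 V) (hV0 : ∀ x, V (0, x) = 0) (v w : ℝ × E3) (p : ℝ × E3) :
    dd w (dd v (duhamel μ K a X V)) p = w.1 * superpose μ K a X (dd v V) p p.1 +
      duhamel μ K a X (dd w (dd v V)) p := by
  rw [dd_duhamel_of_zero hK ha hX (hV.of_le (by norm_num)) hV0,
    (dd_duhamel hK ha hX (contDiff_one_dd hV v) w).2]

/-- Every derivative falls on `V`, so mere continuity of the trajectories suffices. This lets the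
potential be `C²` before anything is known about the smoothness of the flow. -/
theorem contDiff_duhamel (hK : IsCompact K) (ha : Continuous a) (hX : Continuous X.uncurry)
    (hV : ContDiff ℝ 2 V) (hV0 : ∀ x, V (0, x) = 0) : ContDiff ℝ 2 (duhamel μ K a X V) := by
  have hV1 : ContDiff ℝ 1 V := hV.of_le (by norm_num)
  have hc : ∀ {U : ℝ × E3 → ℝ}, ContDiff ℝ 1 U → ContDiff ℝ 1 (duhamel μ K a X U) := by
    intro U hU
    rw [show (1 : WithTop ℕ∞) = 0 + 1 by norm_num, contDiff_succ_iff_fderiv_apply]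
    refine ⟨(dd_duhamel hK ha hX hU 0).1, by simp, fun v => ?_⟩
    rw [contDiff_zero]
    change Continuous (dd v (duhamel μ K a X U))
    rw [(dd_duhamel hK ha hX hU v).2]
    exact (continuous_const.mul ((continuous_superpose hK ha hX hU.continuous).comp
      (continuous_id.prodMk continuous_fst))).add (continuous_duhamel hK ha hX (continuous_dd hU v))
  rw [show (2 : WithTop ℕ∞) = 1 + 1 by norm_num, contDiff_succ_iff_fderiv_apply]
  refine ⟨(dd_duhamel hK ha hX hV1 0).1, by simp, fun v => ?_⟩
  change ContDiff ℝ 1 (dd v (duhamel μ K a X V))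
  rw [dd_duhamel_of_zero hK ha hX hV1 hV0]
  exact hc (contDiff_one_dd hV v)

/-- Duhamel's principle. -/
theorem kg_duhamel (hK : IsCompact K) (ha : Continuous a) (hX : Continuous X.uncurry)
    (hV : ContDiff ℝ 2 V) (hV0 : ∀ x, V (0, x) = 0) (hkg : ∀ p, kg V p = 0) (p : ℝ × E3) :
    kg (duhamel μ K a X V) p = ∫ z in K, a z * dd eT V (0, p.2 - X p.1 z) ∂μ := by
  have hdd : ∀ v w, Continuous (dd w (dd v V)) := fun v w => continuous_dd (contDiff_one_dd hV v) w
  have hsc : ∀ {U : ℝ × E3 → ℝ}, Continuous U → Continuous (superpose μ K a X U p) := fun hU =>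
    (continuous_superpose hK ha hX hU).comp (Continuous.prodMk_right p)
  have hint : ∀ {U : ℝ × E3 → ℝ}, Continuous U →
      IntervalIntegrable (superpose μ K a X U p) volume 0 p.1 := fun hU =>
    (hsc hU).intervalIntegrable _ _
  have hsum : IntervalIntegrable
      (fun s => ∑ i, superpose μ K a X (dd (eX i) (dd (eX i) V)) p s) volume 0 p.1 :=
    (continuous_finsetSum _ fun i _ => hsc (hdd _ _)).intervalIntegrable _ _
  have hsup : ∀ {U : ℝ × E3 → ℝ}, Continuous U → ∀ s,
      IntegrableOn (fun z => a z * U (p.1 - s, p.2 - X s z)) K μ := fun hU s =>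
    ((continuous_superpose_integrand ha hX hU).comp
      (Continuous.prodMk_right (p, s))).continuousOn.integrableOn_compact' hK hK.measurableSet
  -- The operator passes under both integrals onto `V`, where it gives zero; the boundary term of
  -- `∂ₜ²` is all that remains.
  have h0 : duhamel μ K a X (dd eT (dd eT V)) p -
      ∑ i, duhamel μ K a X (dd (eX i) (dd (eX i) V)) p + duhamel μ K a X V p = 0 := by
    unfold duhamel
    rw [← intervalIntegral.integral_finsetSum (fun i _ => hint (hdd _ _)),
      ← intervalIntegral.integral_sub (hint (hdd _ _))
        hsum,
      ← intervalIntegral.integral_add ((hint (hdd _ _)).sub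
        hsum) (hint hV.continuous)]
    refine (intervalIntegral.integral_congr fun s _ => ?_).trans intervalIntegral.integral_zero
    simp only [superpose]
    rw [← integral_finsetSum _ (fun i _ => hsup (hdd _ _) s),
      ← integral_sub (hsup (hdd _ _) s) (integrable_finsetSum _ fun i _ => hsup (hdd _ _) s),
      ← integral_add ((hsup (hdd _ _) s).fun_sub (integrable_finsetSum _ fun i _ => hsup (hdd _ _) s))
        (hsup hV.continuous s)]
    refine (integral_congr_ae (Eventually.of_forall fun z => ?_)).trans (integral_zero _ _)
    have := hkg (p.1 - s, p.2 - X s z)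
    rw [kg] at this
    rw [← Finset.mul_sum, ← mul_sub, ← mul_add, this, mul_zero]
  rw [kg]
  simp only [dd_dd_duhamel hK ha hX hV hV0]
  simp only [one_mul, zero_mul, zero_add]
  rw [← sub_eq_zero]
  simp only [superpose, sub_self] at *
  linarith

/-- Lipschitz dependence on the point and on the trajectories at once. Only times `|s| ≤ |t|` enter,
which is the causality required by `HistoryLipschitz`. The factor `T` bounds the length of the time
integral. -/
theorem abs_duhamel_sub_le (hK : IsCompact K) (ha : Continuous a) {X₁ X₂ : ℝ → Y → E3}
    (hX₁ : Continuous X₁.uncurry) (hX₂ : Continuous X₂.uncurry) (hV : Continuous V) {T L : ℝ}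
    (hL : ∀ t, |t| ≤ T → ∀ x y, |V (t, x) - V (t, y)| ≤ L * ‖x - y‖) (hL0 : 0 ≤ L)
    {t : ℝ} (ht : |t| ≤ T)
    {M : ℝ} {x₁ x₂ : E3} (hM : ∀ s, |s| ≤ |t| → ∀ z ∈ K, ‖(x₁ - X₁ s z) - (x₂ - X₂ s z)‖ ≤ M) :
    |duhamel μ K a X₁ V (t, x₁) - duhamel μ K a X₂ V (t, x₂)| ≤
      T * (L * ∫ z in K, |a z| ∂μ) * M := by
  have hT : 0 ≤ T := (abs_nonneg t).trans ht
  have hA : 0 ≤ ∫ z in K, |a z| ∂μ := integral_nonneg fun z => abs_nonneg _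
  have hint : ∀ {X : ℝ → Y → E3} (x : E3), Continuous X.uncurry →
      IntervalIntegrable (superpose μ K a X V (t, x)) volume 0 t := fun x hX =>
    ((continuous_superpose hK ha hX hV).comp
      (Continuous.prodMk_right (t, x))).intervalIntegrable _ _
  have hsup : ∀ {X : ℝ → Y → E3}, Continuous X.uncurry → ∀ s x,
      IntegrableOn (fun z => a z * V (t - s, x - X s z)) K μ := fun hX s x =>
    ((continuous_superpose_integrand ha hX hV).comp
      (Continuous.prodMk_right ((t, x), s))).continuousOn.integrableOn_compact' hK hK.measurableSet
  rcases eq_empty_or_nonempty K with rfl | ⟨z₀, hz₀⟩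
  · simp [duhamel, superpose]
  have hM0 : 0 ≤ M := (norm_nonneg _).trans (hM 0 (by simp) z₀ hz₀)
  unfold duhamel
  rw [← intervalIntegral.integral_sub (hint x₁ hX₁) (hint x₂ hX₂)]
  have h := intervalIntegral.norm_integral_le_of_norm_le_const (a := 0) (b := t)
    (f := fun s => superpose μ K a X₁ V (t, x₁) s - superpose μ K a X₂ V (t, x₂) s)
    (C := (L * ∫ z in K, |a z| ∂μ) * M) (fun s hs => ?_)
  · rw [sub_zero] at h
    calc _ ≤ (L * ∫ z in K, |a z| ∂μ) * M * |t| := h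
      _ ≤ (L * ∫ z in K, |a z| ∂μ) * M * T := by gcongr
      _ = _ := by ring
  · have hs' : |s| ≤ |t| ∧ |t - s| ≤ |t| := by
      rcases le_total 0 t with h0 | h0
      · rw [uIoc_of_le h0] at hs
        rw [abs_of_nonneg h0, abs_of_nonneg hs.1.le, abs_of_nonneg (by linarith [hs.2])]
        exact ⟨hs.2, by linarith [hs.1]⟩
      · rw [uIoc_of_ge h0] at hs
        rw [abs_of_nonpos h0, abs_of_nonpos hs.2, abs_of_nonpos (by linarith [hs.1])]
        exact ⟨by linarith [hs.1], by linarith [hs.2]⟩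
    simp only [superpose]
    rw [← integral_sub (hsup hX₁ s x₁) (hsup hX₂ s x₂), mul_right_comm, mul_comm,
      ← integral_mul_const]
    refine norm_integral_le_of_norm_le
      ((ha.abs.continuousOn.integrableOn_compact' hK hK.measurableSet).mul_const _) ?_
    filter_upwards [ae_restrict_mem hK.measurableSet] with z hz
    rw [← mul_sub, norm_mul, Real.norm_eq_abs]
    refine mul_le_mul_of_nonneg_left ?_ (abs_nonneg _)
    exact (hL _ (hs'.2.trans ht) _ _).trans (mul_le_mul_of_nonneg_left (hM s hs'.1 z hz) hL0)

end Duhamel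

/-! ### Differential equations with memory in a Banach space. -/

section Volterra

variable {B : Type} [NormedAddCommGroup B]

/-- The derivative of a curve at time `t` depends on the history of the curve between the times
`0` and `t` in a Lipschitz way, locally uniformly in `t`. -/
def HistoryLipschitz (G : (ℝ → B) → ℝ → B) : Prop :=
  ∀ T : ℝ, ∃ L : ℝ, 0 ≤ L ∧ ∀ γ η : ℝ → B, Continuous γ → Continuous η → ∀ t, |t| ≤ T → ∀ M,
    (∀ s, |s| ≤ |t| → ‖γ s - η s‖ ≤ M) → ‖G γ t - G η t‖ ≤ L * M

/-- The admissible Lipschitz constants at a given time form a convex set, so locally constant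
choices can be glued to a continuous one. Adding its reflection makes it even, which reduces
negative times to positive ones. -/
theorem HistoryLipschitz.exists_continuous {G : (ℝ → B) → ℝ → B}
    (hGc : ∀ γ, Continuous γ → Continuous (G γ)) (hG : HistoryLipschitz G) :
    ∃ ℓ : ℝ → ℝ, Continuous ℓ ∧ (∀ t, ℓ (-t) = ℓ t) ∧ (∀ t, 0 ≤ ℓ t) ∧
      (∀ t, ‖G (fun _ => 0) t‖ ≤ ℓ t) ∧ ∀ γ η : ℝ → B, Continuous γ → Continuous η → ∀ t M,
        (∀ s, |s| ≤ |t| → ‖γ s - η s‖ ≤ M) → ‖G γ t - G η t‖ ≤ ℓ t * M := by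
  have hconv : ∀ t : ℝ, Convex ℝ {c : ℝ | 0 ≤ c ∧ ‖G (fun _ => 0) t‖ ≤ c ∧
      ∀ γ η : ℝ → B, Continuous γ → Continuous η → ∀ M, (∀ s, |s| ≤ |t| → ‖γ s - η s‖ ≤ M) →
        ‖G γ t - G η t‖ ≤ c * M} := by
    intro t
    refine Set.OrdConnected.convex ⟨fun a ha b _ c hc => ⟨ha.1.trans hc.1, ha.2.1.trans hc.1,
      fun γ η hγ hη M hM => (ha.2.2 γ η hγ hη M hM).trans ?_⟩⟩
    exact mul_le_mul_of_nonneg_right hc.1 ((norm_nonneg _).trans (hM 0 (by simp)))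
  obtain ⟨g, hg⟩ := exists_continuous_forall_mem_convex_of_local_const hconv (fun t => by
    obtain ⟨L, hL, h⟩ := hG (|t| + 1)
    have h0 : Continuous (G fun _ => 0) := hGc _ continuous_const
    refine ⟨L + (‖G (fun _ => 0) t‖ + 1), ?_⟩
    have e1 : ∀ᶠ s in 𝓝 t, |s| < |t| + 1 :=
      continuous_abs.continuousAt.eventually_lt continuousAt_const (by linarith)
    have e2 : ∀ᶠ s in 𝓝 t, ‖G (fun _ => 0) s‖ < ‖G (fun _ => 0) t‖ + 1 :=
      h0.norm.continuousAt.eventually_lt continuousAt_const (by linarith)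
    filter_upwards [e1, e2] with s h1 h2
    refine ⟨by positivity, by linarith, fun γ η hγ hη M hM => ?_⟩
    refine (h γ η hγ hη s h1.le M hM).trans (mul_le_mul_of_nonneg_right ?_
      ((norm_nonneg _).trans (hM 0 (by simp))))
    linarith [norm_nonneg (G (fun _ => 0) t)])
  refine ⟨fun t => g t + g (-t), by fun_prop, fun t => by simp [add_comm], fun t =>
    add_nonneg (hg t).1 (hg (-t)).1, fun t => by linarith [(hg t).2.1, (hg (-t)).1],
    fun γ η hγ hη t M hM => ?_⟩
  have hM0 : 0 ≤ M := (norm_nonneg _).trans (hM 0 (by simp))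
  have h1 := (hg t).2.2 γ η hγ hη M hM
  have h2 := mul_nonneg (hg (-t)).1 hM0
  linarith

variable [NormedSpace ℝ B]

/-- For `s ≥ 0` the majorant of `v` is the exact derivative of `exp(2∫ℓ) * (D / 2)`. The 2 in the
exponent gains the factor `1 / 2` that makes the Picard operator a contraction. -/
theorem norm_integral_le_exp {v : ℝ → B} {ℓ : ℝ → ℝ} {D : ℝ}
    (hℓ : Continuous ℓ) (heven : ∀ t, ℓ (-t) = ℓ t) (hD : 0 ≤ D)
    (h : ∀ s, ‖v s‖ ≤ ℓ s * (Real.exp (2 * ∫ r in (0 : ℝ)..|s|, ℓ r) * D)) (t : ℝ) :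
    ‖∫ s in (0 : ℝ)..t, v s‖ ≤ Real.exp (2 * ∫ r in (0 : ℝ)..|t|, ℓ r) * (D / 2) := by
  have key : ∀ (v : ℝ → B), (∀ s, ‖v s‖ ≤ ℓ s * (Real.exp (2 * ∫ r in (0 : ℝ)..|s|, ℓ r) * D)) →
      ∀ t, 0 ≤ t → ‖∫ s in (0 : ℝ)..t, v s‖ ≤
        Real.exp (2 * ∫ r in (0 : ℝ)..t, ℓ r) * (D / 2) := by
    intro v h t ht
    have hA : ∀ s, HasDerivAt (fun s => ∫ r in (0 : ℝ)..s, ℓ r) (ℓ s) s := fun s =>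
      intervalIntegral.integral_hasDerivAt_right (hℓ.intervalIntegrable _ _)
        hℓ.stronglyMeasurable.stronglyMeasurableAtFilter hℓ.continuousAt
    have hAc : Continuous fun s => ∫ r in (0 : ℝ)..s, ℓ r :=
      continuous_iff_continuousAt.2 fun s => (hA s).continuousAt
    have hE : ∀ s, HasDerivAt (fun s => Real.exp (2 * ∫ r in (0 : ℝ)..s, ℓ r) * (D / 2))
        (ℓ s * (Real.exp (2 * ∫ r in (0 : ℝ)..s, ℓ r) * D)) s := fun s =>
      ((((hA s).const_mul 2).exp).mul_const (D / 2)).congr_deriv (by ring)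
    have hc : Continuous fun s => ℓ s * (Real.exp (2 * ∫ r in (0 : ℝ)..s, ℓ r) * D) := by fun_prop
    have h1 := intervalIntegral.integral_eq_sub_of_hasDerivAt (fun s _ => hE s)
      (hc.intervalIntegrable 0 t)
    refine (intervalIntegral.norm_integral_le_of_norm_le ht
      (Eventually.of_forall fun s hs => ?_) (hc.intervalIntegrable 0 t)).trans ?_
    · have := h s
      rwa [abs_of_pos hs.1] at this
    · rw [h1]
      simp only [intervalIntegral.integral_same, mul_zero, Real.exp_zero, one_mul]
      linarith
  rcases le_total 0 t with ht | ht
  · have := key v h t ht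
    rwa [abs_of_nonneg ht]
  · have h1 := key (fun s => v (-s)) (fun s => by have := h (-s); rwa [heven, abs_neg] at this)
      (-t) (by linarith)
    rw [intervalIntegral.integral_comp_neg, neg_neg, neg_zero, intervalIntegral.integral_symm,
      norm_neg] at h1
    rwa [abs_of_nonpos ht]

/-- Global solvability of functional differential equations with Lipschitz dependence on the
history. -/
theorem exists_hasDerivAt_of_historyLipschitz [CompleteSpace B] {G : (ℝ → B) → ℝ → B}
    (hGc : ∀ γ, Continuous γ → Continuous (G γ)) (hG : HistoryLipschitz G) (γ₀ : B) :
    ∃ γ : ℝ → B, γ 0 = γ₀ ∧ ∀ t, HasDerivAt γ (G γ t) t := by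
  obtain ⟨ℓ, hℓ, heven, hℓ0, hGz, hL⟩ := hG.exists_continuous hGc
  set Λ : ℝ → ℝ := fun t => 2 * ∫ r in (0 : ℝ)..|t|, ℓ r with hΛdef
  have hΛ : Continuous Λ := by
    have : Continuous fun s : ℝ => ∫ r in (0 : ℝ)..s, ℓ r :=
      continuous_iff_continuousAt.2 fun s => (intervalIntegral.integral_hasDerivAt_right
        (hℓ.intervalIntegrable _ _) hℓ.stronglyMeasurable.stronglyMeasurableAtFilter
        hℓ.continuousAt).continuousAt
    exact continuous_const.mul (this.comp continuous_abs)
  have hΛmono : ∀ s t, |s| ≤ |t| → Λ s ≤ Λ t := by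
    intro s t hst
    have h1 := intervalIntegral.integral_interval_sub_left (hℓ.intervalIntegrable 0 |t|)
      (hℓ.intervalIntegrable 0 |s|) (μ := volume)
    have h2 : 0 ≤ ∫ r in |s|..|t|, ℓ r := intervalIntegral.integral_nonneg hst fun r _ => hℓ0 r
    simp only [Λ]
    linarith
  have hΛ0 : ∀ t, 0 ≤ Λ t := fun t =>
    mul_nonneg zero_le_two (intervalIntegral.integral_nonneg (abs_nonneg t) fun r _ => hℓ0 r)
  -- Curves are written as `exp(Λ) • y` with `y` bounded, so the sup norm of `y` is an exponentially
  -- weighted norm of the curve, valid on the whole time axis at once.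
  let C : BoundedContinuousFunction ℝ B → ℝ → B := fun y t => Real.exp (Λ t) • y t
  have hC : ∀ y, Continuous (C y) := fun y => (Real.continuous_exp.comp hΛ).smul y.continuous
  have hGC : ∀ y, Continuous (G (C y)) := fun y => hGc _ (hC y)
  have hdiff : ∀ y z s, ‖G (C y) s - G (C z) s‖ ≤ ℓ s * (Real.exp (Λ s) * dist y z) := by
    intro y z s
    refine hL _ _ (hC y) (hC z) s _ fun r hr => ?_
    rw [← smul_sub, norm_smul, Real.norm_eq_abs, abs_of_pos (Real.exp_pos _), ← dist_eq_norm]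
    exact mul_le_mul (Real.exp_le_exp.2 (hΛmono r s hr)) (y.dist_coe_le_dist r) dist_nonneg
      (Real.exp_pos _).le
  have hbd : ∀ y s, ‖G (C y) s‖ ≤ ℓ s * (Real.exp (Λ s) * (1 + ‖y‖)) := by
    intro y s
    have h1 : C 0 = fun _ => 0 := by
      ext t
      simp [C]
    have h2 := hdiff y 0 s
    rw [h1, dist_zero_right] at h2
    have h3 : ‖G (fun _ => 0) s‖ ≤ ℓ s * Real.exp (Λ s) :=
      (hGz s).trans (le_mul_of_one_le_right (hℓ0 s) (Real.one_le_exp (hΛ0 s)))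
    have h4 := norm_add_le (G (C y) s - G (fun _ => 0) s) (G (fun _ => 0) s)
    rw [sub_add_cancel] at h4
    linarith
  have hint : ∀ y, Continuous fun t => ∫ s in (0 : ℝ)..t, G (C y) s := fun y =>
    continuous_iff_continuousAt.2 fun s => (intervalIntegral.integral_hasDerivAt_right
        ((hGC y).intervalIntegrable _ _) (hGC y).aestronglyMeasurable.stronglyMeasurableAtFilter
        (hGC y).continuousAt).continuousAt
  have hexp : ∀ t, Real.exp (-Λ t) * Real.exp (Λ t) = 1 := fun t => by
    rw [← Real.exp_add, neg_add_cancel, Real.exp_zero]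
  -- The Picard operator conjugated with the weight.
  let S : BoundedContinuousFunction ℝ B → BoundedContinuousFunction ℝ B := fun y =>
    BoundedContinuousFunction.ofNormedAddCommGroup
      (fun t => Real.exp (-Λ t) • (γ₀ + ∫ s in (0 : ℝ)..t, G (C y) s))
      ((Real.continuous_exp.comp hΛ.neg).smul (continuous_const.add (hint y)))
      (‖γ₀‖ + (1 + ‖y‖) / 2) (fun t => by
        rw [norm_smul, Real.norm_eq_abs, abs_of_pos (Real.exp_pos _)]
        have h1 := norm_integral_le_exp hℓ heven (by positivity) (hbd y) t
        calc Real.exp (-Λ t) * ‖γ₀ + ∫ s in (0 : ℝ)..t, G (C y) s‖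
            ≤ Real.exp (-Λ t) * (Real.exp (Λ t) * ‖γ₀‖ + Real.exp (Λ t) * ((1 + ‖y‖) / 2)) := by
              refine mul_le_mul_of_nonneg_left ((norm_add_le _ _).trans (add_le_add ?_ h1))
                (Real.exp_pos _).le
              exact le_mul_of_one_le_left (norm_nonneg _) (Real.one_le_exp (hΛ0 t))
          _ = _ := by rw [← mul_add, ← mul_assoc, hexp, one_mul])
  have hcontr : ContractingWith (1 / 2 : NNReal) S := by
    refine ⟨by norm_num, LipschitzWith.of_dist_le_mul fun y z => ?_⟩
    rw [BoundedContinuousFunction.dist_le (by positivity)]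
    intro t
    have h1 : S y t - S z t =
        Real.exp (-Λ t) • ∫ s in (0 : ℝ)..t, (G (C y) s - G (C z) s) := by
      rw [intervalIntegral.integral_sub ((hGC y).intervalIntegrable _ _)
        ((hGC z).intervalIntegrable _ _)]
      simp only [S, BoundedContinuousFunction.coe_ofNormedAddCommGroup]
      rw [← smul_sub, add_sub_add_left_eq_sub]
    rw [dist_eq_norm, h1, norm_smul, Real.norm_eq_abs, abs_of_pos (Real.exp_pos _)]
    have h2 := norm_integral_le_exp hℓ heven dist_nonneg (hdiff y z) t
    refine (mul_le_mul_of_nonneg_left h2 (Real.exp_pos _).le).trans_eq ?_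
    change Real.exp (-Λ t) * (Real.exp (Λ t) * (dist y z / 2)) = _
    rw [← mul_assoc, hexp]
    push_cast
    ring
  set y := hcontr.fixedPoint
  have hy : ∀ t, Real.exp (-Λ t) • (γ₀ + ∫ s in (0 : ℝ)..t, G (C y) s) = y t := fun t =>
    DFunLike.congr_fun hcontr.fixedPoint_isFixedPt t
  have hCy : C y = fun t => γ₀ + ∫ s in (0 : ℝ)..t, G (C y) s := by
    ext t
    simp only [C]
    rw [← hy t, smul_smul, mul_comm, hexp, one_smul]
  refine ⟨C y, by rw [hCy]; simp, fun t => ?_⟩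
  have h := (intervalIntegral.integral_hasDerivAt_right (a := 0)
    ((hGC y).intervalIntegrable _ t) (hGC y).aestronglyMeasurable.stronglyMeasurableAtFilter
    (hGC y).continuousAt).const_add γ₀
  exact h.congr_of_eventuallyEq (Eventually.of_forall fun s => congrFun hCy s)

end Volterra

/-! ### Global `C¹` flows of Lipschitz vector fields. -/

section Flow

variable {B : Type} [NormedAddCommGroup B] [NormedSpace ℝ B]

/-- Two-sided Grönwall inequality. -/
theorem norm_le_gronwallBound_abs {w w' : ℝ → B} {a T L ε : ℝ}
    (hw : ∀ t, HasDerivAt w (w' t) t) (hb : ∀ t, |t - a| ≤ T → ‖w' t‖ ≤ L * ‖w t‖ + ε) {t : ℝ}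
    (ht : |t - a| ≤ T) : ‖w t‖ ≤ gronwallBound ‖w a‖ L ε |t - a| := by
  have key : ∀ (w w' : ℝ → B), (∀ t, HasDerivAt w (w' t) t) →
      (∀ t, |t| ≤ T → ‖w' t‖ ≤ L * ‖w t‖ + ε) → ∀ t, 0 ≤ t → t ≤ T →
      ‖w t‖ ≤ gronwallBound ‖w 0‖ L ε t := by
    intro w w' hw hb t ht htT
    have := norm_le_gronwallBound_of_norm_deriv_right_le (a := 0) (b := t) (f := w) (f' := w')
      (δ := ‖w 0‖) (K := L) (ε := ε) (fun s _ => (hw s).continuousAt.continuousWithinAt)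
      (fun s _ => (hw s).hasDerivWithinAt) le_rfl
      (fun s hs => hb s (by rw [abs_of_nonneg hs.1]; exact hs.2.le.trans htT)) t ⟨ht, le_rfl⟩
    rwa [sub_zero] at this
  rcases le_total a t with h | h
  · rw [abs_of_nonneg (by linarith)] at ht ⊢
    have := key (fun s => w (a + s)) (fun s => w' (a + s))
      (fun s => by simpa using (hw (a + s)).comp_const_add a s)
      (fun s hs => hb _ (by simpa using hs)) (t - a) (by linarith) ht
    simpa using this
  · rw [abs_of_nonpos (by linarith)] at ht ⊢
    have := key (fun s => w (a - s)) (fun s => -w' (a - s))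
      (fun s => by simpa using (hw (a - s)).comp_const_sub a s)
      (fun s hs => by rw [norm_neg]; exact hb _ (by simpa using hs)) (-(t - a)) (by linarith) ht
    simpa using this

/-- A time-dependent vector field that is Lipschitz, locally uniformly in time. -/
def LocUnifLipschitz {Y : Type} [NormedAddCommGroup Y] (b : ℝ → Y → Y) : Prop :=
  ∀ T : ℝ, ∃ L : ℝ, 0 ≤ L ∧ ∀ t, |t| ≤ T → ∀ x y, ‖b t x - b t y‖ ≤ L * ‖x - y‖

/-- The memoryless case of `exists_hasDerivAt_of_historyLipschitz`, after a time translation that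
moves the initial time to 0. -/
theorem LocUnifLipschitz.exists_solution [CompleteSpace B] {b : ℝ → B → B}
    (hb : LocUnifLipschitz b) (hc : Continuous b.uncurry) (a : ℝ) (z : B) :
    ∃ γ : ℝ → B, γ a = z ∧ ∀ t, HasDerivAt γ (b t (γ t)) t := by
  have hL : HistoryLipschitz (fun (γ : ℝ → B) t => b (t + a) (γ t)) := by
    intro T
    obtain ⟨L, hL0, hL⟩ := hb (T + |a|)
    refine ⟨L, hL0, fun γ η _ _ t ht M hM => ?_⟩
    refine (hL (t + a) ?_ _ _).trans (mul_le_mul_of_nonneg_left (hM t le_rfl) hL0)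
    exact (abs_add_le t a).trans (by linarith)
  obtain ⟨γ, h0, hγ⟩ := exists_hasDerivAt_of_historyLipschitz
    (fun γ hγ => hc.comp ((continuous_id.add continuous_const).prodMk hγ)) hL z
  refine ⟨fun t => γ (t - a), by simpa using h0, fun t => ?_⟩
  have := (hγ (t - a)).comp_sub_const t a
  simpa using this

theorem LocUnifLipschitz.dist_le {b : ℝ → B → B} (hb : LocUnifLipschitz b) (a T : ℝ) :
    ∃ C, 0 ≤ C ∧ ∀ γ η : ℝ → B, (∀ t, HasDerivAt γ (b t (γ t)) t) →
      (∀ t, HasDerivAt η (b t (η t)) t) → ∀ t, |t - a| ≤ T → ‖γ t - η t‖ ≤ ‖γ a - η a‖ * C := by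
  obtain ⟨L, hL0, hL⟩ := hb (|a| + T)
  refine ⟨Real.exp (L * T), (Real.exp_pos _).le, fun γ η hγ hη t ht => ?_⟩
  have h := norm_le_gronwallBound_abs (L := L) (ε := 0) (a := a) (T := T)
    (w := fun t => γ t - η t) (fun t => (hγ t).sub (hη t)) (fun s hs => by
      rw [add_zero]
      refine hL s ?_ _ _
      have := abs_add_le a (s - a)
      rw [add_sub_cancel] at this
      linarith) ht
  rw [gronwallBound_ε0] at h
  exact h.trans (mul_le_mul_of_nonneg_left (Real.exp_le_exp.2
    (mul_le_mul_of_nonneg_left ht hL0)) (norm_nonneg _))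

theorem LocUnifLipschitz.unique {b : ℝ → B → B} (hb : LocUnifLipschitz b) {γ η : ℝ → B}
    (hγ : ∀ t, HasDerivAt γ (b t (γ t)) t) (hη : ∀ t, HasDerivAt η (b t (η t)) t) {a : ℝ}
    (h : γ a = η a) (t : ℝ) : γ t = η t := by
  obtain ⟨C, _, hC⟩ := hb.dist_le a |t - a|
  have := hC γ η hγ hη t le_rfl
  rw [h, sub_self, norm_zero, zero_mul] at this
  exact sub_eq_zero.1 (norm_le_zero_iff.1 this)

theorem continuous_uncurry_of_locUnif {P B : Type} [TopologicalSpace P] [NormedAddCommGroup B]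
    {ψ : ℝ → P → B}
    (ht : ∀ z, Continuous fun t => ψ t z)
    (hz : ∀ T : ℝ, ∀ z₀, ∀ ε > 0, ∀ᶠ z in 𝓝 z₀, ∀ t, |t| ≤ T → ‖ψ t z - ψ t z₀‖ ≤ ε) :
    Continuous ψ.uncurry := by
  rw [continuous_iff_continuousAt]
  rintro ⟨t₀, z₀⟩
  rw [ContinuousAt, tendsto_iff_norm_sub_tendsto_zero, NormedAddGroup.tendsto_nhds_zero]
  intro ε hε
  have h1 := hz (|t₀| + 1) z₀ (ε / 3) (by positivity)
  have h2 : ∀ᶠ t in 𝓝 t₀, |t| ≤ |t₀| + 1 :=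
    (continuous_abs.continuousAt.eventually_lt continuousAt_const (by linarith)).mono
      fun _ h => h.le
  have h3 : ∀ᶠ t in 𝓝 t₀, ‖ψ t z₀ - ψ t₀ z₀‖ < ε / 3 := by
    have := (ht z₀).continuousAt (x := t₀)
    rw [ContinuousAt, tendsto_iff_norm_sub_tendsto_zero] at this
    exact this.eventually_lt_const (by positivity)
  rw [nhds_prod_eq]
  filter_upwards [(h2.and h3).prod_mk h1] with q hq
  rw [norm_norm]
  have e1 := hq.2 q.1 hq.1.1
  have e2 := norm_sub_le_norm_sub_add_norm_sub (ψ q.1 q.2) (ψ q.1 z₀) (ψ t₀ z₀)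
  simp only [Function.uncurry]
  linarith [hq.1.2]

/-- The tube lemma over the compact interval `[-T, T]`. -/
theorem eventually_forall_abs_le_norm_sub_lt {P F : Type} [TopologicalSpace P]
    [NormedAddCommGroup F] {A : ℝ → P → F} (hA : Continuous A.uncurry) (T : ℝ) (z₀ : P) {ε : ℝ}
    (hε : 0 < ε) : ∀ᶠ z in 𝓝 z₀, ∀ t, |t| ≤ T → ‖A t z - A t z₀‖ < ε := by
  have hc : Continuous fun q : ℝ × P => ‖A q.1 q.2 - A q.1 z₀‖ :=
    (hA.sub (hA.comp (continuous_fst.prodMk continuous_const))).norm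
  obtain ⟨u, v, _, hv, hu, hz, huv⟩ := generalized_tube_lemma (isCompact_Icc (a := -T) (b := T))
    (isCompact_singleton (x := z₀)) (isOpen_lt hc continuous_const)
    (n := {q : ℝ × P | ‖A q.1 q.2 - A q.1 z₀‖ < ε}) (by
      rintro ⟨t, z⟩ ⟨_, rfl⟩
      simpa using hε)
  filter_upwards [hv.mem_nhds (hz rfl)] with z hz t ht
  exact huv (Set.mk_mem_prod (hu (abs_le.1 ht)) hz)

/-- The flow of a vector field, together with its inverse. -/
structure IsFlow {Y : Type} [NormedAddCommGroup Y] [NormedSpace ℝ Y] (b Φ Ψ : ℝ → Y → Y) :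
    Prop where
  zero : ∀ z, Φ 0 z = z
  hasDerivAt : ∀ z t, HasDerivAt (fun t => Φ t z) (b t (Φ t z)) t
  contDiff : ContDiff ℝ 1 Φ.uncurry
  contDiff_inv : ContDiff ℝ 1 Ψ.uncurry
  left_inv : ∀ t z, Ψ t (Φ t z) = z
  right_inv : ∀ t z, Φ t (Ψ t z) = z

variable {Y : Type} [NormedAddCommGroup Y] [NormedSpace ℝ Y] [FiniteDimensional ℝ Y]

/-- The flow of a `C¹` vector field that is Lipschitz, locally uniformly in time, is global and
`C¹`. -/
theorem LocUnifLipschitz.exists_flow {b : ℝ → Y → Y} (hb : LocUnifLipschitz b)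
    (hc : Continuous b.uncurry) {b' : ℝ → Y → Y →L[ℝ] Y} (hb' : ∀ t z, HasFDerivAt (b t) (b' t z) z)
    (hc' : Continuous b'.uncurry) : ∃ Φ Ψ, IsFlow b Φ Ψ := by
  have : CompleteSpace Y := FiniteDimensional.complete ℝ Y
  choose φ hφ0 hφ using fun z => hb.exists_solution hc 0 z
  set Φ : ℝ → Y → Y := fun t z => φ z t with hΦdef
  have hΦd : ∀ z t, HasDerivAt (fun t => Φ t z) (b t (Φ t z)) t := fun z t => hφ z t
  have hΦL : ∀ T, ∃ C, 0 ≤ C ∧ ∀ t, |t| ≤ T → ∀ z z', ‖Φ t z - Φ t z'‖ ≤ ‖z - z'‖ * C := by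
    intro T
    obtain ⟨C, hC, h⟩ := hb.dist_le 0 T
    refine ⟨C, hC, fun t ht z z' => ?_⟩
    have := h (φ z) (φ z') (hφ z) (hφ z') t (by simpa using ht)
    rwa [hφ0, hφ0] at this
  have hΦc : Continuous Φ.uncurry := by
    refine continuous_uncurry_of_locUnif (fun z => continuous_iff_continuousAt.2 fun t =>
      (hΦd z t).continuousAt) fun T z₀ ε hε => ?_
    obtain ⟨C, hC, h⟩ := hΦL T
    have : ∀ᶠ z in 𝓝 z₀, ‖z - z₀‖ * C < ε := by
      refine ContinuousAt.eventually_lt (by fun_prop) continuousAt_const ?_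
      simpa using hε
    filter_upwards [this] with z hz t ht
    exact (h t ht z z₀).trans hz.le
  -- The coefficient of the linearized equation along the trajectory of `z`. The Lipschitz bound on
  -- `b` bounds its norm.
  set A : ℝ → Y → Y →L[ℝ] Y := fun t z => b' t (Φ t z)
  have hAc : Continuous A.uncurry := hc'.comp (continuous_fst.prodMk hΦc)
  have hAb : ∀ T, ∃ L, 0 ≤ L ∧ ∀ t, |t| ≤ T → ∀ z, ‖A t z‖ ≤ L := by
    intro T
    obtain ⟨L, hL0, hL⟩ := hb T
    refine ⟨L, hL0, fun t ht z => ?_⟩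
    exact (hb' t (Φ t z)).le_of_lip' hL0 (Eventually.of_forall fun y => hL t ht y _)
  have hlin : ∀ z, LocUnifLipschitz (fun t (J : Y →L[ℝ] Y) => (A t z).comp J) := by
    intro z T
    obtain ⟨L, hL0, hL⟩ := hAb T
    refine ⟨L, hL0, fun t ht J J' => ?_⟩
    rw [← ContinuousLinearMap.comp_sub]
    exact (ContinuousLinearMap.opNorm_comp_le _ _).trans
      (mul_le_mul_of_nonneg_right (hL t ht z) (norm_nonneg _))
  have hAz : ∀ z, Continuous fun t => A t z := fun z => hAc.comp (Continuous.prodMk_left z)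
  -- The candidate for the derivative in the initial value solves the variational equation `J' = A
  -- J`, `J(0) = id`.
  choose j hj0 hj using fun z => (hlin z).exists_solution
    (((hAz z).comp continuous_fst).clm_comp continuous_snd) 0 (ContinuousLinearMap.id ℝ Y)
  set J : ℝ → Y → Y →L[ℝ] Y := fun t z => j z t with hJdef
  have hJt : ∀ z, Continuous fun t => J t z := fun z => continuous_iff_continuousAt.2 fun t =>
    (hj z t).continuousAt
  -- joint continuity of the derivative
  have hJc : Continuous J.uncurry := by
    refine continuous_uncurry_of_locUnif hJt fun T z₀ ε hε => ?_
    obtain ⟨L, hL0, hL⟩ := hAb T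
    obtain ⟨M, hM⟩ := (isCompact_Icc (a := -T) (b := T)).bddAbove_image
      (hJt z₀).norm.continuousOn
    have hM' : ∀ t, |t| ≤ T → ‖J t z₀‖ ≤ |M| := fun t ht =>
      (hM ⟨t, abs_le.1 ht, rfl⟩).trans (le_abs_self M)
    -- The difference of two solutions satisfies a linear equation forced by `(A s z - A s z₀) ∘ J s
    -- z₀`. A coefficient difference below `η` then keeps it below `ε` by Grönwall.
    obtain ⟨η, hη, hη'⟩ : ∃ η > 0, gronwallBound 0 L (η * |M|) T ≤ ε := by
      have h1 : Tendsto (fun η => gronwallBound 0 L (η * |M|) T) (𝓝 0) (𝓝 0) := by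
        have h2 := (gronwallBound_continuous_ε 0 L T).comp (continuous_id.mul
          (continuous_const (y := |M|)))
        have h3 := h2.tendsto 0
        simpa [Function.comp_def, gronwallBound_ε0_δ0] using h3
      have h2 := (h1.eventually (gt_mem_nhds hε)).filter_mono
        (nhdsWithin_le_nhds (s := Ioi 0))
      obtain ⟨η, h3, h4⟩ := (h2.and self_mem_nhdsWithin).exists
      exact ⟨η, h4, h3.le⟩
    filter_upwards [eventually_forall_abs_le_norm_sub_lt hAc T z₀ hη] with z hz t ht
    have h := norm_le_gronwallBound_abs (L := L) (ε := η * |M|) (a := 0) (T := T)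
      (w := fun t => J t z - J t z₀) (fun t => (hj z t).sub (hj z₀ t)) (fun s hs => by
        rw [sub_zero] at hs
        have e : (A s z).comp (j z s) - (A s z₀).comp (j z₀ s) =
            (A s z).comp (J s z - J s z₀) + (A s z - A s z₀).comp (J s z₀) := by
          rw [ContinuousLinearMap.comp_sub, ContinuousLinearMap.sub_comp]
          simp [hJdef]
        rw [e]
        refine (norm_add_le _ _).trans (add_le_add ?_ ?_)
        · exact (ContinuousLinearMap.opNorm_comp_le _ _).trans
            (mul_le_mul_of_nonneg_right (hL s hs z) (norm_nonneg _))
        · exact (ContinuousLinearMap.opNorm_comp_le _ _).trans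
            (mul_le_mul (hz s hs).le (hM' s hs) (norm_nonneg _) hη.le)) (t := t)
      (by simpa using ht)
    have h0 : J 0 z - J 0 z₀ = 0 := by simp only [J, hj0, sub_self]
    rw [h0, norm_zero, sub_zero] at h
    refine h.trans (le_trans ?_ hη')
    exact gronwallBound_mono le_rfl (by positivity) hL0 ht
  -- differentiability in the initial value
  have hΦz : ∀ t z, HasFDerivAt (Φ t) (J t z) z := by
    intro t z
    rw [hasFDerivAt_iff_isLittleO_nhds_zero, Asymptotics.isLittleO_iff]
    intro c hcpos
    set T := |t|
    obtain ⟨L, hL0, hL⟩ := hAb T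
    obtain ⟨C, hC0, hC⟩ := hΦL T
    obtain ⟨η, hη, hη'⟩ : ∃ η > 0, gronwallBound 0 L (η * C) T ≤ c := by
      have h1 : Tendsto (fun η => gronwallBound 0 L (η * C) T) (𝓝 0) (𝓝 0) := by
        have h2 := (gronwallBound_continuous_ε 0 L T).comp (continuous_id.mul
          (continuous_const (y := C)))
        have h3 := h2.tendsto 0
        simpa [Function.comp_def, gronwallBound_ε0_δ0] using h3
      have h2 := (h1.eventually (gt_mem_nhds hcpos)).filter_mono
        (nhdsWithin_le_nhds (s := Ioi 0))
      obtain ⟨η, h3, h4⟩ := (h2.and self_mem_nhdsWithin).exists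
      exact ⟨η, h4, h3.le⟩
    have hΦt : Continuous fun t => Φ t z := hΦc.comp (Continuous.prodMk_left z)
    have hshift : Continuous (Function.uncurry fun (s : ℝ) (y : Y) => b' s (Φ s z + y)) :=
      hc'.comp (continuous_fst.prodMk ((hΦt.comp continuous_fst).add continuous_snd))
    have h1 := eventually_forall_abs_le_norm_sub_lt hshift T 0 hη
    obtain ⟨ρ, hρ, hρ'⟩ := Metric.eventually_nhds_iff_ball.1 h1
    have h2 : ∀ᶠ h in 𝓝 (0 : Y), ‖h‖ * C < ρ := by
      refine ContinuousAt.eventually_lt (by fun_prop) continuousAt_const ?_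
      simpa using hρ
    filter_upwards [h2] with h hh
    have hclose : ∀ s, |s| ≤ T → ‖Φ s (z + h) - Φ s z‖ ≤ ‖h‖ * C := fun s hs => by
      simpa using hC s hs (z + h) z
    -- First-order Taylor remainder of the field, by the mean value inequality on a ball where `b'`
    -- differs from `A s z` by at most `η`; `ρ` is uniform in `s`.
    have hrem : ∀ s, |s| ≤ T → ‖b s (Φ s (z + h)) - b s (Φ s z) -
        A s z (Φ s (z + h) - Φ s z)‖ ≤ η * (‖h‖ * C) := by
      intro s hs
      have hball : ∀ y ∈ ball (Φ s z) ρ, ‖b' s y - A s z‖ ≤ η := by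
        intro y hy
        have := hρ' (y - Φ s z) (by simpa [dist_eq_norm] using hy) s hs
        simpa [A] using this.le
      refine (Convex.norm_image_sub_le_of_norm_hasFDerivWithin_le'
        (fun y _ => (hb' s y).hasFDerivWithinAt) hball (convex_ball _ _)
        (mem_ball_self hρ) ?_).trans ?_
      · rw [mem_ball, dist_eq_norm]
        exact (hclose s hs).trans_lt hh
      · exact mul_le_mul_of_nonneg_left (hclose s hs) hη.le
    have h3 := norm_le_gronwallBound_abs (L := L) (ε := η * C * ‖h‖) (a := 0) (T := T)
      (w := fun s => Φ s (z + h) - Φ s z - J s z h)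
      (fun s => ((hΦd (z + h) s).sub (hΦd z s)).sub
        ((hj z s).clm_apply (hasDerivAt_const s h))) (fun s hs => by
        rw [sub_zero] at hs
        have e : b s (Φ s (z + h)) - b s (Φ s z) - ((A s z).comp (j z s) h + j z s 0) =
            A s z (Φ s (z + h) - Φ s z - J s z h) + (b s (Φ s (z + h)) - b s (Φ s z) -
              A s z (Φ s (z + h) - Φ s z)) := by
          simp [hJdef, map_sub]
        rw [e]
        refine (norm_add_le _ _).trans (add_le_add ?_ ?_)
        · exact ((A s z).le_opNorm _).trans (mul_le_mul_of_nonneg_right (hL s hs z) (norm_nonneg _))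
        · exact (hrem s hs).trans_eq (by ring)) (t := t) (by simp [T])
    have h0 : Φ 0 (z + h) - Φ 0 z - J 0 z h = 0 := by simp [Φ, J, hφ0, hj0]
    rw [h0, norm_zero, sub_zero] at h3
    refine h3.trans ?_
    -- With zero initial value the Grönwall bound is linear in the forcing, so the error is at most
    -- `c * ‖h‖`.
    have h4 : gronwallBound 0 L (η * C * ‖h‖) T = gronwallBound 0 L (η * C) T * ‖h‖ := by
      unfold gronwallBound
      split_ifs <;> ring
    change gronwallBound 0 L (η * C * ‖h‖) T ≤ _
    rw [h4]
    exact mul_le_mul_of_nonneg_right hη' (norm_nonneg _)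
  have hΦ1 : ContDiff ℝ 1 Φ.uncurry := by
    have hs : ∀ q : ℝ × Y, HasStrictFDerivAt Φ.uncurry
        (((1 : ℝ →L[ℝ] ℝ).smulRight (b q.1 (Φ q.1 q.2))).coprod (J q.1 q.2)) q := fun q =>
      hasStrictFDerivAt_uncurry_coprod (𝕜 := ℝ) (u := q) (f := Φ)
        (f₁ := fun t z => (1 : ℝ →L[ℝ] ℝ).smulRight (b t (Φ t z))) (f₂ := J)
        (Eventually.of_forall fun v => (hΦd v.2 v.1).hasFDerivAt)
        (Eventually.of_forall fun v => hΦz v.1 v.2)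
        ((ContinuousLinearMap.smulRightL ℝ ℝ Y (1 : ℝ →L[ℝ] ℝ)).continuous.comp
          (hc.comp (continuous_fst.prodMk hΦc))).continuousAt hJc.continuousAt
    rw [contDiff_one_iff_fderiv]
    refine ⟨fun q => (hs q).hasFDerivAt.differentiableAt, ?_⟩
    rw [show fderiv ℝ Φ.uncurry = fun q => ((1 : ℝ →L[ℝ] ℝ).smulRight
      (b q.1 (Φ q.1 q.2))).coprod (J q.1 q.2) from funext fun q => (hs q).hasFDerivAt.fderiv]
    refine continuous_clm_apply.2 fun v => ?_
    simp only [ContinuousLinearMap.coprod_apply, ContinuousLinearMap.smulRight_apply]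
    exact (continuous_const.smul (hc.comp (continuous_fst.prodMk hΦc))).add
      (hJc.clm_apply continuous_const)
  -- the inverse
  have hbij : ∀ t z, ∃ z₀, Φ t z₀ = z := by
    intro t z
    obtain ⟨γ, h1, h2⟩ := hb.exists_solution hc t z
    refine ⟨γ 0, ?_⟩
    rw [← h1]
    exact hb.unique (hφ (γ 0)) h2 (hφ0 _) t
  have hinj : ∀ t z z', Φ t z = Φ t z' → z = z' := by
    intro t z z' h
    have := hb.unique (hφ z) (hφ z') h 0
    rwa [hφ0, hφ0] at this
  choose Ψ hΨ using hbij
  have hΨ1 : ContDiff ℝ 1 Ψ.uncurry := by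
    -- Adjoining time gives an endomorphism of `ℝ × Y`, so the inverse function theorem yields joint
    -- regularity of `Ψ` in time and space.
    set Θ : ℝ × Y → ℝ × Y := fun q => (q.1, Φ q.1 q.2)
    have hΘ : ContDiff ℝ 1 Θ := contDiff_fst.prodMk hΦ1
    rw [contDiff_iff_contDiffAt]
    rintro ⟨t, y⟩
    set z := Ψ t y
    have hq : Θ (t, z) = (t, y) := by simp [Θ, z, hΨ]
    have hd := (hΘ.differentiable (by simp) (t, z)).hasFDerivAt
    -- A kernel vector has no time component, and its space component `h` satisfies `J t z h = 0`.
    -- Uniqueness for the linear variational equation, solved back to time 0, gives `h = 0`.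
    have hker : Function.Injective (fderiv ℝ Θ (t, z)) := by
      rw [injective_iff_map_eq_zero]
      rintro ⟨τ, h⟩ hv
      have e1 : HasFDerivAt (fun q => (Θ q).1) (ContinuousLinearMap.fst ℝ ℝ Y) (t, z) :=
        hasFDerivAt_fst
      have hτ : τ = 0 := by
        have := hd.fst.unique e1
        have := DFunLike.congr_fun this (τ, h)
        simpa [hv] using this.symm
      subst hτ
      have e2 : HasFDerivAt (fun y => (Θ (t, y)).2) (J t z) z := hΦz t z
      have hJ0 : J t z h = 0 := by
        have h3 := HasFDerivAt.comp (g := fun q => (Θ q).2) (f := fun y => (t, y)) z hd.snd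
          (hasFDerivAt_prodMk_right t z)
        have := DFunLike.congr_fun (e2.unique h3) h
        simpa [hv] using this
      have hA : LocUnifLipschitz (fun s (v : Y) => A s z v) := by
        intro T
        obtain ⟨L, hL0, hL⟩ := hAb T
        refine ⟨L, hL0, fun s hs v w => ?_⟩
        rw [← map_sub]
        exact ((A s z).le_opNorm _).trans (mul_le_mul_of_nonneg_right (hL s hs z) (norm_nonneg _))
      have h4 := hA.unique (γ := fun s => J s z h) (η := fun _ => 0) (a := t)
        (fun s => ((hj z s).clm_apply (hasDerivAt_const s h)).congr_deriv (by simp [J]))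
        (fun s => by simpa using hasDerivAt_const s (0 : Y)) hJ0 0
      have h5 : h = 0 := by simpa [J, hj0] using h4
      rw [h5]
      rfl
    let e : (ℝ × Y) ≃L[ℝ] (ℝ × Y) :=
      (LinearEquiv.ofInjectiveEndo (fderiv ℝ Θ (t, z)).toLinearMap hker).toContinuousLinearEquiv
    have he : HasFDerivAt Θ (e : (ℝ × Y) →L[ℝ] (ℝ × Y)) (t, z) := by
      exact hd.congr_fderiv (ContinuousLinearMap.ext fun v => rfl)
    have hloc := (hΘ.contDiffAt (x := (t, z))).to_localInverse he (by simp)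
    have hstrict : HasStrictFDerivAt Θ (e : (ℝ × Y) →L[ℝ] (ℝ × Y)) (t, z) :=
      (hΘ.contDiffAt (x := (t, z))).hasStrictFDerivAt' he (by simp)
    have hev := hstrict.eventually_right_inverse
    rw [hq] at hev hloc
    have hsnd : ContDiffAt ℝ 1 (fun q => ((hΘ.contDiffAt (x := (t, z))).localInverse he
      (by simp) q).2) (t, y) := contDiff_snd.contDiffAt.comp _ hloc
    refine hsnd.congr_of_eventuallyEq ?_
    filter_upwards [hev] with q hq'
    have e1 : (hstrict.localInverse Θ e (t, z) q).1 = q.1 :=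
      (Prod.ext_iff.1 hq').1
    have e2 : Φ (hstrict.localInverse Θ e (t, z) q).1 (hstrict.localInverse Θ e (t, z) q).2 = q.2 :=
      (Prod.ext_iff.1 hq').2
    rw [e1] at e2
    -- Global injectivity of `Φ` identifies the local inverse with `Ψ`.
    exact hinj q.1 _ _ ((hΨ q.1 q.2).trans e2.symm)
  exact ⟨Φ, Ψ, hφ0, hΦd, hΦ1, hΨ1, fun t z => hinj t _ _ (hΨ t _), hΨ⟩

end Flow

/-! ### Bounds and regularity of the relativistic velocity. -/

section RelativisticVelocity

theorem one_le_sqrt_one_add_sq (r : ℝ) : 1 ≤ Real.sqrt (1 + r ^ 2) :=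
  Real.one_le_sqrt.2 (by nlinarith [sq_nonneg r])

theorem abs_le_sqrt_one_add_sq (r : ℝ) : |r| ≤ Real.sqrt (1 + r ^ 2) :=
  Real.abs_le_sqrt (by linarith)

theorem abs_sqrt_sub_sqrt_le (a b : ℝ) :
    |Real.sqrt (1 + a ^ 2) - Real.sqrt (1 + b ^ 2)| ≤ |a - b| := by
  have h1 := one_le_sqrt_one_add_sq a
  have h2 := one_le_sqrt_one_add_sq b
  have h3 : (Real.sqrt (1 + a ^ 2) - Real.sqrt (1 + b ^ 2)) *
      (Real.sqrt (1 + a ^ 2) + Real.sqrt (1 + b ^ 2)) = (a - b) * (a + b) := by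
    have e1 := Real.mul_self_sqrt (by positivity : 0 ≤ 1 + a ^ 2)
    have e2 := Real.mul_self_sqrt (by positivity : 0 ≤ 1 + b ^ 2)
    linear_combination e1 - e2
  have h4 : |a + b| ≤ Real.sqrt (1 + a ^ 2) + Real.sqrt (1 + b ^ 2) :=
    (abs_add_le a b).trans (add_le_add (abs_le_sqrt_one_add_sq a) (abs_le_sqrt_one_add_sq b))
  have h5 := congrArg abs h3
  rw [abs_mul, abs_mul, abs_of_pos (by linarith : 0 < Real.sqrt (1 + a ^ 2) +
    Real.sqrt (1 + b ^ 2))] at h5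
  have h6 := mul_le_mul_of_nonneg_left h4 (abs_nonneg (a - b))
  exact le_of_mul_le_mul_right (h5.le.trans h6) (by linarith)

theorem norm_vhat_le_one (v : E3) : ‖vhat v‖ ≤ 1 := by
  have h1 := one_le_sqrt_one_add_sq ‖v‖
  have h2 := abs_le_sqrt_one_add_sq ‖v‖
  rw [vhat, norm_smul, norm_inv, Real.norm_eq_abs, abs_of_pos (by linarith)]
  rw [abs_norm] at h2
  exact inv_mul_le_one_of_le₀ h2 (by linarith)

theorem norm_vhat_sub_le (v w : E3) : ‖vhat v - vhat w‖ ≤ 2 * ‖v - w‖ := by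
  set a := Real.sqrt (1 + ‖v‖ ^ 2)
  set b := Real.sqrt (1 + ‖w‖ ^ 2)
  have ha : 1 ≤ a := one_le_sqrt_one_add_sq ‖v‖
  have hb : 1 ≤ b := one_le_sqrt_one_add_sq ‖w‖
  have hw : ‖w‖ ≤ b := by simpa using abs_le_sqrt_one_add_sq ‖w‖
  have hab : |a - b| ≤ ‖v - w‖ := (abs_sqrt_sub_sqrt_le _ _).trans (abs_norm_sub_norm_le v w)
  have ha0 : 0 < a := by linarith
  have hb0 : 0 < b := by linarith
  -- The first summand varies the numerator and the second the square root; each is at most `‖v -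
  -- w‖`.
  have e : vhat v - vhat w = a⁻¹ • (v - w) + (a⁻¹ * (b - a)) • (b⁻¹ • w) := by
    simp only [vhat, a, b]
    rw [smul_smul, smul_sub, sub_add, ← sub_smul]
    congr 2
    field_simp
    ring
  have h1 : ‖a⁻¹ • (v - w)‖ ≤ ‖v - w‖ := by
    rw [norm_smul, norm_inv, Real.norm_eq_abs, abs_of_pos ha0]
    exact mul_le_of_le_one_left (norm_nonneg _) (inv_le_one_of_one_le₀ ha)
  have h2 : ‖(a⁻¹ * (b - a)) • (b⁻¹ • w)‖ ≤ ‖v - w‖ := by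
    have h3 : ‖b⁻¹ • w‖ ≤ 1 := norm_vhat_le_one w
    rw [norm_smul, norm_mul, norm_inv, Real.norm_eq_abs, Real.norm_eq_abs, abs_of_pos ha0,
      abs_sub_comm]
    calc a⁻¹ * |a - b| * ‖b⁻¹ • w‖ ≤ 1 * |a - b| * 1 := by
          gcongr
          exact inv_le_one_of_one_le₀ ha
      _ ≤ ‖v - w‖ := by linarith
  rw [e]
  exact (norm_add_le _ _).trans (by linarith)

theorem contDiff_vhat {n : WithTop ℕ∞} : ContDiff ℝ n vhat := by
  have h : ∀ v : E3, 0 < 1 + ‖v‖ ^ 2 := fun v => by positivity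
  refine ContDiff.smul (ContDiff.inv ?_ fun v => (Real.sqrt_pos.2 (h v)).ne') contDiff_id
  exact (contDiff_const.add (contDiff_norm_sq ℝ)).sqrt fun v => (h v).ne'

theorem contDiff_vhat_coord (i : Fin 3) {n : WithTop ℕ∞} :
    ContDiff ℝ n (fun v : E3 => vhat v i) :=
  (contDiff_coord i).comp contDiff_vhat

end RelativisticVelocity

/-! ### Integration by parts and differentiation for compact supports. -/

section Divergence

variable {V : Type} [NormedAddCommGroup V] [NormedSpace ℝ V]

theorem hasCompactSupport_dd {h : V → ℝ} (hc : HasCompactSupport h) (w : V) :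
    HasCompactSupport (dd w h) :=
  hc.fderiv_apply ℝ w

variable [FiniteDimensional ℝ V] [MeasurableSpace V] [BorelSpace V]

theorem integral_dd_eq_zero {μ : Measure V} [μ.IsAddHaarMeasure] {h : V → ℝ} (hh : ContDiff ℝ 1 h)
    (hc : HasCompactSupport h) (w : V) : ∫ z, dd w h z ∂μ = 0 := by
  have hI : Integrable (dd w h) μ :=
    (continuous_dd hh w).integrable_of_hasCompactSupport (hasCompactSupport_dd hc w)
  -- Integration by parts against the constant 1.
  have := integral_mul_fderiv_eq_neg_fderiv_mul_of_integrable (μ := μ) (v := w)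
    (f := fun _ : V => (1 : ℝ)) (g := h) (by simp) (by simp only [one_mul]; exact hI)
    (by simpa using hh.continuous.integrable_of_hasCompactSupport hc)
    (fun x _ => differentiableAt_const 1) (fun x _ => hh.differentiable (by simp) x)
  simpa [dd] using this

/-- Integration by parts along a direction in which the coefficient is constant. -/
theorem integral_mul_dd_eq_zero {μ : Measure V} [μ.IsAddHaarMeasure] {c h : V → ℝ}
    (hcd : ContDiff ℝ 1 c) (hh : ContDiff ℝ 1 h) (hc : HasCompactSupport h) {w : V}
    (hw : ∀ z, dd w c z = 0) : ∫ z, c z * dd w h z ∂μ = 0 := by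
  have h1 := integral_dd_eq_zero (μ := μ) (hcd.mul hh) (hc.mul_left (f := c)) w
  have h2 : dd w (fun x => c x * h x) = fun z => c z * dd w h z := by
    have := dd_mul hcd hh w
    simpa only [hw, zero_mul, zero_add] using this
  rwa [h2] at h1

/-- Differentiation under the integral sign for compactly supported functions. -/
theorem hasDerivAt_integral_of_support {μ : Measure V} [IsLocallyFiniteMeasure μ] {I : Set ℝ}
    (hI : IsOpen I) {H : ℝ × V → ℝ} (hH : ContDiffOn ℝ 1 H (I ×ˢ univ)) {K : Set V}
    (hK : IsCompact K) (hsupp : ∀ t ∈ I, ∀ z ∉ K, H (t, z) = 0) {t : ℝ} (ht : t ∈ I) :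
    HasDerivAt (fun t => ∫ z, H (t, z) ∂μ) (∫ z, dd (1, 0) H (t, z) ∂μ) t := by
  have hopen : IsOpen (I ×ˢ (univ : Set V)) := hI.prod isOpen_univ
  obtain ⟨ε, hε, hball⟩ := Metric.nhds_basis_closedBall.mem_iff.1 (hI.mem_nhds ht)
  have hmaps : ∀ s ∈ I, ∀ z : V, (s, z) ∈ I ×ˢ (univ : Set V) := fun s hs z => ⟨hs, mem_univ _⟩
  have hcont : ∀ s ∈ I, Continuous fun z => H (s, z) := fun s hs =>
    hH.continuousOn.comp_continuous (Continuous.prodMk_right s) (hmaps s hs)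
  have hdc : ContinuousOn (dd (1, 0) H) (I ×ˢ univ) :=
    (hH.continuousOn_fderiv_of_isOpen hopen (by simp)).clm_apply continuousOn_const
  have hd : ∀ s ∈ I, ∀ z, HasDerivAt (fun s => H (s, z)) (dd (1, 0) H (s, z)) s := fun s hs z =>
    HasFDerivAt.comp_hasDerivAt (l := H) (f := fun s : ℝ => (s, z)) s
      ((hH.differentiableOn (by simp)).differentiableAt
        (hopen.mem_nhds (hmaps s hs z))).hasFDerivAt
      ((hasDerivAt_id s).prodMk (hasDerivAt_const s z))
  have hdz : ∀ s ∈ I, ∀ z ∉ K, dd (1, 0) H (s, z) = 0 := by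
    intro s hs z hz
    have : (fun s => H (s, z)) =ᶠ[𝓝 s] fun _ => 0 := by
      filter_upwards [hI.mem_nhds hs] with r hr using hsupp r hr z hz
    exact (hd s hs z).unique ((hasDerivAt_const s (0 : ℝ)).congr_of_eventuallyEq this)
  obtain ⟨M, hM⟩ := ((isCompact_closedBall t ε).prod hK).bddAbove_image
    (hdc.mono (Set.prod_mono hball (subset_univ K))).norm
  refine (hasDerivAt_integral_of_dominated_loc_of_deriv_le (μ := μ)
    (F := fun s z => H (s, z)) (F' := fun s z => dd (1, 0) H (s, z))
    (bound := K.indicator fun _ => |M|) (closedBall_mem_nhds t hε) ?_ ?_ ?_ ?_ ?_ ?_).2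
  · filter_upwards [hI.mem_nhds ht] with s hs using (hcont s hs).aestronglyMeasurable
  · exact (hcont t ht).integrable_of_hasCompactSupport
      (HasCompactSupport.intro hK (hsupp t ht))
  · exact (hdc.comp_continuous (Continuous.prodMk_right t) (hmaps t ht)).aestronglyMeasurable
  · refine Eventually.of_forall fun z s hs => ?_
    by_cases hz : z ∈ K
    · rw [indicator_of_mem hz]
      exact (hM (mem_image_of_mem _ (Set.mk_mem_prod hs hz))).trans (le_abs_self M)
    · rw [indicator_of_notMem hz, hdz s (hball hs) z hz, norm_zero]
  · exact (integrable_indicator_iff hK.measurableSet).2 (integrableOn_const hK.measure_ne_top)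
  · exact Eventually.of_forall fun z s hs => hd s (hball hs) z

end Divergence

/-! ### The transport equation and Liouville's theorem. -/

section Transport

/-- The position directions of phase space. -/
abbrev zX (i : Fin 3) : E3 × E3 := (ex i, 0)

/-- The momentum directions of phase space. -/
abbrev zV (i : Fin 3) : E3 × E3 := (0, ex i)

instance : (volume : Measure (E3 × E3)).IsAddHaarMeasure :=
  inferInstanceAs ((volume : Measure E3).prod (volume : Measure E3)).IsAddHaarMeasure

/-- The derivative of `H` along the field `(v̂, F)`. -/
def streaming (F : E3 → E3) (H : E3 × E3 → ℝ) (z : E3 × E3) : ℝ :=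
  ∑ i, vhat z.2 i * dd (zX i) H z + ∑ i, F z.1 i * dd (zV i) H z

theorem fderiv_eq_streaming (F : E3 → E3) (H : E3 × E3 → ℝ) (z : E3 × E3) :
    fderiv ℝ H z (vhat z.2, F z.1) = streaming F H z := by
  have h : ((vhat z.2, F z.1) : E3 × E3) = ∑ i, vhat z.2 i • zX i + ∑ i, F z.1 i • zV i := by
    refine Prod.ext ?_ ?_
    · simp [Prod.fst_sum, sum_smul_ex]
    · simp [Prod.snd_sum, sum_smul_ex]
  rw [h, map_add, map_sum, map_sum]
  simp only [map_smul, streaming, dd, smul_eq_mul]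

theorem integrable_mul_dd {c H : E3 × E3 → ℝ} (hcc : Continuous c) (hH : ContDiff ℝ 1 H)
    (hc : HasCompactSupport H) (w : E3 × E3) : Integrable (fun z => c z * dd w H z) :=
  (hcc.mul (continuous_dd hH w)).integrable_of_hasCompactSupport
    ((hasCompactSupport_dd hc w).mul_left (f := c))

/-- Together with `dd_comp_snd` this is why the phase space field has no divergence: the force
depends on position but differentiates in momentum, and the velocity does the opposite. -/
theorem dd_comp_fst (c : E3 → ℝ) (hc : ContDiff ℝ 1 c) (i : Fin 3) (z : E3 × E3) :
    dd (zV i) (fun z : E3 × E3 => c z.1) z = 0 := by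
  have := (hc.differentiable (by simp) z.1).hasFDerivAt.comp z
    (hasFDerivAt_fst (𝕜 := ℝ) (p := z))
  rw [dd, show (fun z : E3 × E3 => c z.1) = c ∘ Prod.fst from rfl, this.fderiv]
  simp

theorem dd_comp_snd (c : E3 → ℝ) (hc : ContDiff ℝ 1 c) (i : Fin 3) (z : E3 × E3) :
    dd (zX i) (fun z : E3 × E3 => c z.2) z = 0 := by
  have := (hc.differentiable (by simp) z.2).hasFDerivAt.comp z
    (hasFDerivAt_snd (𝕜 := ℝ) (p := z))
  rw [dd, show (fun z : E3 × E3 => c z.2) = c ∘ Prod.snd from rfl, this.fderiv]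
  simp

theorem continuous_streaming {F : E3 → E3} (hF : ∀ i, Continuous fun x => F x i)
    {H : E3 × E3 → ℝ} (hH : ContDiff ℝ 1 H) : Continuous (streaming F H) := by
  refine (continuous_finsetSum _ fun i _ => ?_).add (continuous_finsetSum _ fun i _ => ?_)
  · exact ((contDiff_vhat_coord i (n := 0)).continuous.comp continuous_snd).mul (continuous_dd hH _)
  · exact ((hF i).comp continuous_fst).mul (continuous_dd hH _)

theorem hasCompactSupport_streaming (F : E3 → E3) {H : E3 × E3 → ℝ} (hc : HasCompactSupport H) :
    HasCompactSupport (streaming F H) := by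
  refine (hc.fderiv ℝ).mono fun z hz => ?_
  rw [Function.mem_support, ← fderiv_eq_streaming] at hz
  intro h
  simp only [h] at hz
  exact hz rfl

/-- The phase space field `(v̂, F(x))` is divergence free. -/
theorem integral_streaming_eq_zero {F : E3 → E3} (hF : ∀ i, ContDiff ℝ 1 fun x => F x i)
    {H : E3 × E3 → ℝ} (hH : ContDiff ℝ 1 H) (hc : HasCompactSupport H) :
    ∫ z, streaming F H z = 0 := by
  have c1 : ∀ i, ContDiff ℝ 1 fun z : E3 × E3 => vhat z.2 i := fun i =>
    (contDiff_vhat_coord i).comp contDiff_snd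
  have c2 : ∀ i, ContDiff ℝ 1 fun z : E3 × E3 => F z.1 i := fun i => (hF i).comp contDiff_fst
  unfold streaming
  rw [integral_add, integral_finsetSum, integral_finsetSum]
  · rw [Finset.sum_eq_zero fun i _ => integral_mul_dd_eq_zero (c1 i) hH hc
        (dd_comp_snd _ (contDiff_vhat_coord i) i), Finset.sum_eq_zero fun i _ =>
        integral_mul_dd_eq_zero (c2 i) hH hc (dd_comp_fst _ (hF i) i), add_zero]
  · exact fun i _ => integrable_mul_dd (c2 i).continuous hH hc _
  · exact fun i _ => integrable_mul_dd (c1 i).continuous hH hc _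
  · exact integrable_finsetSum _ fun i _ => integrable_mul_dd (c1 i).continuous hH hc _
  · exact integrable_finsetSum _ fun i _ => integrable_mul_dd (c2 i).continuous hH hc _

/-- The characteristic field of the Vlasov equation with force `F`. -/
def charField (F : ℝ → E3 → E3) (t : ℝ) (z : E3 × E3) : E3 × E3 := (vhat z.2, F t z.1)

/-- Functions transported by the flow solve the transport equation. -/
theorem IsFlow.transport {F : ℝ → E3 → E3} {Φ Ψ : ℝ → E3 × E3 → E3 × E3}
    (hΦ : IsFlow (charField F) Φ Ψ) {h : E3 × E3 → ℝ} (hh : ContDiff ℝ 1 h) (t : ℝ)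
    (z : E3 × E3) :
    dd (1, 0) (fun q : ℝ × E3 × E3 => h (Ψ q.1 q.2)) (t, z) +
      streaming (F t) (fun z => h (Ψ t z)) z = 0 := by
  have hU : ContDiff ℝ 1 (fun q : ℝ × E3 × E3 => h (Ψ q.1 q.2)) := hh.comp hΦ.contDiff_inv
  have hUd := (hU.differentiable (by simp) (t, z)).hasFDerivAt
  set z₀ := Ψ t z
  have hz : Φ t z₀ = z := hΦ.right_inv t z
  have h1 : HasDerivAt (fun s => (s, Φ s z₀)) (1, charField F t z) t := by
    have := (hasDerivAt_id t).prodMk (hΦ.hasDerivAt z₀ t)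
    rwa [hz] at this
  have h2 : HasDerivAt (fun s => h (Ψ s (Φ s z₀)))
      (fderiv ℝ (fun q : ℝ × E3 × E3 => h (Ψ q.1 q.2)) (t, z) (1, charField F t z)) t := by
    refine HasFDerivAt.comp_hasDerivAt (l := fun q : ℝ × E3 × E3 => h (Ψ q.1 q.2))
      (f := fun s => (s, Φ s z₀)) t ?_ h1
    rw [hz]
    exact hUd
  -- Along a trajectory `Ψ s (Φ s z₀) = z₀`, so `h ∘ Ψ` is constant there and its total derivative
  -- vanishes.
  simp only [hΦ.left_inv] at h2
  have h3 := h2.unique (hasDerivAt_const t _)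
  have h4 : ((1, charField F t z) : ℝ × E3 × E3) = (1, 0) + (0, charField F t z) := by simp
  have h5 : HasFDerivAt (fun z => h (Ψ t z)) _ z :=
    HasFDerivAt.comp (g := fun q : ℝ × E3 × E3 => h (Ψ q.1 q.2)) (f := fun z => (t, z)) z hUd
      (hasFDerivAt_prodMk_right t z)
  rw [h4, map_add] at h3
  rw [← fderiv_eq_streaming, h5.fderiv]
  exact h3

theorem IsFlow.continuous_uncurry {Y : Type} [NormedAddCommGroup Y] [NormedSpace ℝ Y]
    {b Φ Ψ : ℝ → Y → Y} (hΦ : IsFlow b Φ Ψ) : Continuous Φ.uncurry :=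
  hΦ.contDiff.continuous

/-- The flow preserves Lebesgue measure (Liouville's theorem). -/
theorem IsFlow.integral_comp_inv {F : ℝ → E3 → E3} (hF : ∀ t i, ContDiff ℝ 1 fun x => F t x i)
    {Φ Ψ : ℝ → E3 × E3 → E3 × E3} (hΦ : IsFlow (charField F) Φ Ψ) {h : E3 × E3 → ℝ}
    (hh : ContDiff ℝ 1 h) (hc : HasCompactSupport h) (t : ℝ) :
    ∫ z, h (Ψ t z) = ∫ z, h z := by
  have hU : ContDiff ℝ 1 (fun q : ℝ × E3 × E3 => h (Ψ q.1 q.2)) := hh.comp hΦ.contDiff_inv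
  have hsupp : ∀ T : ℝ, ∀ s ∈ Ioo (-T) T, ∀ z ∉ (Φ.uncurry '' (Icc (-T) T ×ˢ tsupport h)),
      h (Ψ s z) = 0 := by
    intro T s hs z hz
    by_contra hne
    exact hz ⟨(s, Ψ s z), ⟨Ioo_subset_Icc_self hs, subset_tsupport h hne⟩, hΦ.right_inv s z⟩
  have hK : ∀ T : ℝ, IsCompact (Φ.uncurry '' (Icc (-T) T ×ˢ tsupport h)) := fun T =>
    (isCompact_Icc.prod hc).image hΦ.continuous_uncurry
  -- By the transport equation the derivative is minus the integral of a divergence. For bounded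
  -- times all supports lie in the compact set swept out by `tsupport h` under the flow.
  have hd : ∀ s, HasDerivAt (fun s => ∫ z, h (Ψ s z)) 0 s := by
    intro s
    set T := |s| + 1
    have hs : s ∈ Ioo (-T) T := abs_lt.1 (by simp [T])
    have h1 := hasDerivAt_integral_of_support (μ := (volume : Measure (E3 × E3)))
      (isOpen_Ioo (a := -T) (b := T)) hU.contDiffOn (hK T) (hsupp T) hs
    have h2 : ∀ z, dd (1, 0) (fun q : ℝ × E3 × E3 => h (Ψ q.1 q.2)) (s, z) =
        -streaming (F s) (fun z => h (Ψ s z)) z := fun z =>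
      eq_neg_of_add_eq_zero_left (hΦ.transport hh s z)
    have h3 := integral_streaming_eq_zero (hF s) (H := fun z => h (Ψ s z))
      (hU.comp (contDiff_prodMk_right s))
      (HasCompactSupport.intro (hK T) (hsupp T s hs))
    simp only [h2, integral_neg, h3, neg_zero] at h1
    exact h1
  have h0 := is_const_of_deriv_eq_zero (fun s => (hd s).differentiableAt) (fun s => (hd s).deriv) t 0
  refine h0.trans ?_
  congr 1
  ext z
  have := hΦ.left_inv 0 z
  rw [hΦ.zero] at this
  rw [this]

/-- Change of variables along the flow. -/
theorem IsFlow.integral_comp_inv_mul {F : ℝ → E3 → E3}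
    (hF : ∀ t i, ContDiff ℝ 1 fun x => F t x i)
    {Φ Ψ : ℝ → E3 × E3 → E3 × E3} (hΦ : IsFlow (charField F) Φ Ψ) {f ψ : E3 × E3 → ℝ}
    (hf : ContDiff ℝ 1 f) (hc : HasCompactSupport f) (hψ : ContDiff ℝ 1 ψ) (t : ℝ) :
    ∫ z, f (Ψ t z) * ψ z = ∫ z, f z * ψ (Φ t z) := by
  have hΦt : ContDiff ℝ 1 (Φ t) := hΦ.contDiff.comp (contDiff_prodMk_right t)
  -- Measure preservation is applied to `f * (ψ ∘ Φ t)`, whose composition with `Ψ t` is `(f ∘ Ψ t)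
  -- * ψ`.
  have := hΦ.integral_comp_inv hF (h := fun z => f z * ψ (Φ t z)) (hf.mul (hψ.comp hΦt))
    (hc.mul_right (f' := fun z => ψ (Φ t z))) t
  simpa only [hΦ.right_inv] using this

end Transport

/-! ### The force field of a potential. -/

section Force

/-- The force field `-∂ₓ U`. -/
def force (U : ℝ × E3 → ℝ) (t : ℝ) (x : E3) : E3 := -∑ i, dd (eX i) U (t, x) • ex i

theorem force_apply (U : ℝ × E3 → ℝ) (t : ℝ) (x : E3) (i : Fin 3) :
    force U t x i = -dd (eX i) U (t, x) := by
  have := congrArg (fun y : E3 => y i) (sum_smul_ex (WithLp.toLp 2 fun i => dd (eX i) U (t, x)))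
  simp only at this
  rw [force, PiLp.neg_apply, this]

theorem norm_le_sum_abs (y : E3) : ‖y‖ ≤ ∑ i, |y i| := by
  conv_lhs => rw [← sum_smul_ex y]
  refine (norm_sum_le _ _).trans (Finset.sum_le_sum fun i _ => ?_)
  simp [norm_smul]

theorem contDiff_force {U : ℝ × E3 → ℝ} (hU : ContDiff ℝ 2 U) :
    ContDiff ℝ 1 (force U).uncurry :=
  ContDiff.neg (ContDiff.sum fun i _ => (contDiff_one_dd hU (eX i)).smul contDiff_const)

theorem contDiff_force_apply {U : ℝ × E3 → ℝ} (hU : ContDiff ℝ 2 U) (t : ℝ) (i : Fin 3) :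
    ContDiff ℝ 1 fun x => force U t x i := by
  have h : ContDiff ℝ 1 fun x => -dd (eX i) U (t, x) :=
    ((contDiff_one_dd hU (eX i)).comp (contDiff_prodMk_right t)).neg
  simpa only [force_apply] using h

theorem norm_fderiv_le_of_dd {g : E3 → ℝ} {C : ℝ} (x : E3) (h : ∀ j, |dd (ex j) g x| ≤ C) :
    ‖fderiv ℝ g x‖ ≤ 3 * C := by
  have hC : 0 ≤ C := (abs_nonneg _).trans (h 0)
  refine ContinuousLinearMap.opNorm_le_bound _ (by positivity) fun v => ?_
  rw [fderiv_apply_eq_sum_dd]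
  refine (norm_sum_le _ _).trans ?_
  calc ∑ i, ‖v i * dd (ex i) g x‖ ≤ ∑ _i : Fin 3, ‖v‖ * C := by
        refine Finset.sum_le_sum fun i _ => ?_
        rw [norm_mul]
        exact mul_le_mul (PiLp.norm_apply_le v i) (h i) (norm_nonneg _) (norm_nonneg _)
    _ = 3 * C * ‖v‖ := by simp; ring

/-- Mean value inequality; the 3 counts the coordinates in the bound of the gradient by its
components. This is how Hessian bounds become Lipschitz bounds for the force. -/
theorem HessBounded.abs_dd_sub_le {U : ℝ × E3 → ℝ} (hU : ContDiff ℝ 2 U) (hb : HessBounded U)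
    (T : ℝ) : ∃ L, 0 ≤ L ∧ ∀ i t, |t| ≤ T → ∀ x y,
      |dd (eX i) U (t, x) - dd (eX i) U (t, y)| ≤ L * ‖x - y‖ := by
  obtain ⟨C, hC⟩ := hb T
  refine ⟨3 * |C|, by positivity, fun i t ht x y => ?_⟩
  have hd : Differentiable ℝ (dd (eX i) U) := (contDiff_one_dd hU _).differentiable (by simp)
  have hd' : ∀ z, HasFDerivAt (fun z => dd (eX i) U (t, z))
      (fderiv ℝ (fun z => dd (eX i) U (t, z)) z) z := fun z =>
    (hasFDerivAt_space (hd (t, z))).differentiableAt.hasFDerivAt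
  have := (convex_univ (𝕜 := ℝ) (E := E3)).norm_image_sub_le_of_norm_hasFDerivWithin_le
    (C := 3 * |C|) (fun z _ => (hd' z).hasFDerivWithinAt) (fun z _ => ?_) (mem_univ y) (mem_univ x)
  · exact this
  · refine norm_fderiv_le_of_dd z fun j => ?_
    rw [← dd_space_eq (hd (t, z))]
    exact (hC t ht z i j).trans (le_abs_self C)

end Force

/-! ### Particles moving in the potential that they generate. -/

section Coupled

/-- A retraction onto the closed ball of radius `R`. -/
def retractBall (R : ℝ) (z : E3 × E3) : E3 × E3 := (R / max R ‖z‖) • z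

theorem norm_retractBall_le {R : ℝ} (hR : 0 < R) (z : E3 × E3) : ‖retractBall R z‖ ≤ R := by
  have h : 0 < max R ‖z‖ := hR.trans_le (le_max_left _ _)
  rw [retractBall, norm_smul, Real.norm_eq_abs, abs_of_pos (by positivity), div_mul_eq_mul_div,
    div_le_iff₀ h]
  exact mul_le_mul_of_nonneg_left (le_max_right _ _) hR.le

theorem retractBall_eq {R : ℝ} (hR : 0 < R) {z : E3 × E3} (hz : ‖z‖ ≤ R) :
    retractBall R z = z := by
  rw [retractBall, max_eq_left hz, div_self hR.ne', one_smul]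

theorem continuous_retractBall {R : ℝ} (hR : 0 < R) : Continuous (retractBall R) := by
  unfold retractBall
  refine Continuous.smul (continuous_const.div
    (continuous_const.max continuous_norm) fun z => ?_) continuous_id
  exact (hR.trans_le (le_max_left _ _)).ne'

/-- The potential generated by particles on the trajectories `X`, plus the external potential
`U₀`. -/
def potential (U₀ W : ℝ × E3 → ℝ) (a : E3 × E3 → ℝ) (R : ℝ) (X : ℝ → E3 × E3 → E3)
    (p : ℝ × E3) : ℝ :=
  U₀ p - duhamel volume (closedBall 0 R) a X W p

variable {U₀ W : ℝ × E3 → ℝ} {a : E3 × E3 → ℝ} {R : ℝ}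

theorem contDiff_potential (hU₀ : ContDiff ℝ 2 U₀) (hW : ContDiff ℝ 2 W) (hW0 : ∀ x, W (0, x) = 0)
    (ha : Continuous a) {X : ℝ → E3 × E3 → E3} (hX : Continuous X.uncurry) :
    ContDiff ℝ 2 (potential U₀ W a R X) :=
  hU₀.sub (contDiff_duhamel (isCompact_closedBall _ _) ha hX hW hW0)

theorem dd_potential (hU₀ : ContDiff ℝ 2 U₀) (hW : ContDiff ℝ 2 W) (hW0 : ∀ x, W (0, x) = 0)
    (ha : Continuous a) {X : ℝ → E3 × E3 → E3} (hX : Continuous X.uncurry) (v : ℝ × E3) :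
    dd v (potential U₀ W a R X) =
      fun p => dd v U₀ p - duhamel volume (closedBall 0 R) a X (dd v W) p := by
  unfold potential
  rw [dd_sub (hU₀.of_le (by norm_num)) ((contDiff_duhamel (isCompact_closedBall _ _) ha hX hW
    hW0).of_le (by norm_num)),
    dd_duhamel_of_zero (isCompact_closedBall _ _) ha hX (hW.of_le (by norm_num)) hW0]

/-- The force depends Lipschitz continuously on the position and on the trajectories of the
particles. -/
theorem norm_force_potential_sub_le (hU₀ : ContDiff ℝ 2 U₀) (hbU : HessBounded U₀)
    (hW : ContDiff ℝ 2 W) (hbW : HessBounded W) (hW0 : ∀ x, W (0, x) = 0)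
    (ha : Continuous a) (T : ℝ) : ∃ L, 0 ≤ L ∧ ∀ X₁ X₂ : ℝ → E3 × E3 → E3,
      Continuous X₁.uncurry → Continuous X₂.uncurry → ∀ t, |t| ≤ T → ∀ M x₁ x₂, ‖x₁ - x₂‖ ≤ M →
      (∀ s, |s| ≤ |t| → ∀ z ∈ closedBall (0 : E3 × E3) R, ‖X₁ s z - X₂ s z‖ ≤ M) →
      ‖force (potential U₀ W a R X₁) t x₁ - force (potential U₀ W a R X₂) t x₂‖ ≤ L * M := by
  obtain ⟨L₁, h₁, hL₁⟩ := hbU.abs_dd_sub_le hU₀ T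
  obtain ⟨L₂, h₂, hL₂⟩ := hbW.abs_dd_sub_le hW T
  set A := ∫ z in closedBall (0 : E3 × E3) R, |a z|
  have hA : 0 ≤ A := integral_nonneg fun z => abs_nonneg _
  -- The 3 sums the components of the force. The 2 arises because position and trajectory each
  -- contribute up to `M` to the argument of `W`.
  refine ⟨3 * (L₁ + |T| * (L₂ * A) * 2), by positivity, fun X₁ X₂ hX₁ hX₂ t ht M x₁ x₂ hx hX => ?_⟩
  have hM : 0 ≤ M := (norm_nonneg _).trans hx
  have hT : 0 ≤ T := (abs_nonneg t).trans ht
  refine (norm_le_sum_abs _).trans ?_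
  have hi : ∀ i, |(force (potential U₀ W a R X₁) t x₁ - force (potential U₀ W a R X₂) t x₂) i| ≤
      (L₁ + |T| * (L₂ * A) * 2) * M := by
    intro i
    rw [PiLp.sub_apply, force_apply, force_apply, dd_potential hU₀ hW hW0 ha hX₁,
      dd_potential hU₀ hW hW0 ha hX₂]
    have e1 := hL₁ i t ht x₁ x₂
    have e2 := abs_duhamel_sub_le (μ := volume) (isCompact_closedBall (0 : E3 × E3) R) ha hX₁ hX₂
      (contDiff_one_dd hW (eX i)).continuous (hL₂ i) h₂ ht (M := 2 * M) (x₁ := x₁) (x₂ := x₂)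
      (fun s hs z hz => by
        rw [sub_sub_sub_comm]
        exact (norm_sub_le _ _).trans (by linarith [hX s hs z hz]))
    have e3 : L₁ * ‖x₁ - x₂‖ ≤ L₁ * M := mul_le_mul_of_nonneg_left hx h₁
    rw [abs_of_nonneg hT]
    have e4 := abs_sub (dd (eX i) U₀ (t, x₁) - dd (eX i) U₀ (t, x₂))
      (duhamel volume (closedBall 0 R) a X₁ (dd (eX i) W) (t, x₁) -
        duhamel volume (closedBall 0 R) a X₂ (dd (eX i) W) (t, x₂))
    rw [← abs_neg] at e4
    refine le_trans (le_of_eq (congrArg abs (by ring))) (e4.trans ?_)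
    linarith
  calc _ ≤ ∑ _i : Fin 3, (L₁ + |T| * (L₂ * A) * 2) * M := Finset.sum_le_sum fun i _ => hi i
    _ = _ := by simp; ring

theorem charField_locUnifLipschitz {F : ℝ → E3 → E3}
    (hF : ∀ T : ℝ, ∃ L, 0 ≤ L ∧ ∀ t, |t| ≤ T → ∀ x y, ‖F t x - F t y‖ ≤ L * ‖x - y‖) :
    LocUnifLipschitz (charField F) := by
  intro T
  obtain ⟨L, hL0, hL⟩ := hF T
  refine ⟨2 + L, by linarith, fun t ht z w => ?_⟩
  have h1 := norm_fst_le (z - w)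
  have h2 := norm_snd_le (z - w)
  rw [charField, charField, Prod.mk_sub_mk]
  refine max_le ?_ ?_
  · refine (norm_vhat_sub_le _ _).trans ?_
    change 2 * ‖(z - w).2‖ ≤ _
    nlinarith [norm_nonneg (z - w)]
  · refine (hL t ht _ _).trans ?_
    change L * ‖(z - w).1‖ ≤ _
    nlinarith [norm_nonneg (z - w)]

theorem contDiff_charField {U : ℝ × E3 → ℝ} (hU : ContDiff ℝ 2 U) :
    ContDiff ℝ 1 (charField (force U)).uncurry := by
  have h1 : ContDiff ℝ 1 fun q : ℝ × E3 × E3 => vhat q.2.2 :=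
    (contDiff_vhat (n := 1)).comp (g := vhat) (f := fun q : ℝ × E3 × E3 => q.2.2)
      (contDiff_snd.comp contDiff_snd)
  have h2 : ContDiff ℝ 1 fun q : ℝ × E3 × E3 => (force U).uncurry (q.1, q.2.1) :=
    (contDiff_force hU).comp (g := (force U).uncurry) (f := fun q : ℝ × E3 × E3 => (q.1, q.2.1))
      (contDiff_fst.prodMk (contDiff_fst.comp contDiff_snd))
  exact h1.prodMk h2

/-- The flow of the characteristic field of a potential with bounded second derivatives. -/
theorem exists_flow_charField {U : ℝ × E3 → ℝ} (hU : ContDiff ℝ 2 U)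
    (hL : LocUnifLipschitz (charField (force U))) :
    ∃ Φ Ψ, IsFlow (charField (force U)) Φ Ψ := by
  have hc : ContDiff ℝ 1 (charField (force U)).uncurry := contDiff_charField hU
  refine hL.exists_flow hc.continuous
    (b' := fun t z => (fderiv ℝ (charField (force U)).uncurry (t, z)).comp
      (ContinuousLinearMap.inr ℝ ℝ (E3 × E3))) (fun t z => ?_) ?_
  · exact HasFDerivAt.comp (g := (charField (force U)).uncurry) (f := fun z => (t, z)) z
      (hc.differentiable (by simp) _).hasFDerivAt (hasFDerivAt_prodMk_right t z)
  · exact (hc.continuous_fderiv (by simp)).clm_comp continuous_const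

open Classical in
/-- Existence of trajectories of particles that move in the potential they generate. -/
theorem exists_selfconsistent (hU₀ : ContDiff ℝ 2 U₀) (hbU : HessBounded U₀)
    (hW : ContDiff ℝ 2 W) (hbW : HessBounded W) (hW0 : ∀ x, W (0, x) = 0)
    (ha : Continuous a) (hR : 0 < R) : ∃ X : ℝ → E3 × E3 → E3, Continuous X.uncurry ∧
      ∃ Φ Ψ, IsFlow (charField (force (potential U₀ W a R X))) Φ Ψ ∧
        ∀ t, ∀ z ∈ closedBall (0 : E3 × E3) R, X t z = (Φ t z).1 := by
  have : CompactSpace (closedBall (0 : E3 × E3) R) :=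
    isCompact_iff_compactSpace.1 (isCompact_closedBall _ _)
  -- The unknown lives over the compact ball, where continuous maps form a Banach space. The
  -- retraction extends trajectories to all of phase space, as `potential` expects.
  let r : E3 × E3 → closedBall (0 : E3 × E3) R := fun z =>
    ⟨retractBall R z, by simpa using norm_retractBall_le hR z⟩
  have hr : Continuous r := (continuous_retractBall hR).subtype_mk _
  let X : (ℝ → C(closedBall (0 : E3 × E3) R, E3 × E3)) → ℝ → E3 × E3 → E3 := fun γ t z =>
    (γ t (r z)).1
  have hX : ∀ γ, Continuous γ → Continuous (X γ).uncurry := fun γ hγ =>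
    continuous_fst.comp (continuous_eval.comp
      ((hγ.comp continuous_fst).prodMk (hr.comp continuous_snd)))
  have hP : ∀ γ, Continuous γ → ContDiff ℝ 2 (potential U₀ W a R (X γ)) := fun γ hγ =>
    contDiff_potential hU₀ hW hW0 ha (hX γ hγ)
  have hcont : ∀ γ : ℝ → C(closedBall (0 : E3 × E3) R, E3 × E3), Continuous γ → Continuous
      fun q : ℝ × closedBall (0 : E3 × E3) R =>
        charField (force (potential U₀ W a R (X γ))) q.1 (γ q.1 q.2) := by
    intro γ hγ
    have hev : Continuous fun q : ℝ × closedBall (0 : E3 × E3) R => γ q.1 q.2 :=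
      continuous_eval.comp ((hγ.comp continuous_fst).prodMk continuous_snd)
    exact (contDiff_charField (hP γ hγ)).continuous.comp
      (g := (charField (force (potential U₀ W a R (X γ)))).uncurry)
      (f := fun q : ℝ × closedBall (0 : E3 × E3) R => (q.1, γ q.1 q.2))
      (continuous_fst.prodMk hev)
  -- The value 0 at discontinuous curves is a dummy: only continuous curves are tested below.
  let G : (ℝ → C(closedBall (0 : E3 × E3) R, E3 × E3)) → ℝ →
      C(closedBall (0 : E3 × E3) R, E3 × E3) := fun γ t =>
    if hγ : Continuous γ then ContinuousMap.curry ⟨_, hcont γ hγ⟩ t else 0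
  have hGapp : ∀ γ, Continuous γ → ∀ t z,
      G γ t z = charField (force (potential U₀ W a R (X γ))) t (γ t z) := by
    intro γ hγ t z
    simp only [G, dif_pos hγ]
    rfl
  have hGc : ∀ γ, Continuous γ → Continuous (G γ) := by
    intro γ hγ
    have : G γ = fun t => ContinuousMap.curry ⟨_, hcont γ hγ⟩ t := by
      ext1 t
      simp only [G, dif_pos hγ]
    rw [this]
    exact (ContinuousMap.curry ⟨_, hcont γ hγ⟩).continuous
  have hGL : HistoryLipschitz G := by
    intro T
    obtain ⟨L, hL0, hL⟩ := norm_force_potential_sub_le hU₀ hbU hW hbW hW0 ha (R := R) T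
    refine ⟨2 + L, by linarith, fun γ η hγ hη t ht M hM => ?_⟩
    have hM0 : 0 ≤ M := (norm_nonneg _).trans (hM 0 (by simp))
    rw [ContinuousMap.norm_le _ (by positivity)]
    intro z
    have hpt : ∀ s, |s| ≤ |t| → ∀ z, ‖γ s z - η s z‖ ≤ M := fun s hs z =>
      (ContinuousMap.norm_coe_le_norm (γ s - η s) z).trans (hM s hs)
    have hz := hpt t le_rfl z
    rw [ContinuousMap.sub_apply, hGapp γ hγ, hGapp η hη, charField, charField, Prod.mk_sub_mk]
    refine max_le ?_ ?_
    · refine (norm_vhat_sub_le _ _).trans ?_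
      have := (norm_snd_le (γ t z - η t z)).trans hz
      rw [Prod.snd_sub] at this
      nlinarith
    · refine (hL (X γ) (X η) (hX γ hγ) (hX η hη) t ht M _ _
        ((norm_fst_le (γ t z - η t z)).trans hz) fun s hs w _ =>
          (norm_fst_le (γ s (r w) - η s (r w))).trans (hpt s hs _)).trans ?_
      nlinarith
  -- The initial value is the inclusion of the ball: each particle starts at its own label.
  obtain ⟨γ, hγ0, hγ⟩ := exists_hasDerivAt_of_historyLipschitz hGc hGL
    (⟨fun z => z.1, continuous_subtype_val⟩ : C(closedBall (0 : E3 × E3) R, E3 × E3))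
  have hγc : Continuous γ := continuous_iff_continuousAt.2 fun t => (hγ t).continuousAt
  have hLip : LocUnifLipschitz (charField (force (potential U₀ W a R (X γ)))) := by
    refine charField_locUnifLipschitz fun T => ?_
    obtain ⟨L, hL0, hL⟩ := norm_force_potential_sub_le hU₀ hbU hW hbW hW0 ha (R := R) T
    exact ⟨L, hL0, fun t ht x y => hL (X γ) (X γ) (hX γ hγc) (hX γ hγc) t ht _ x y le_rfl
      fun s _ z _ => by simp⟩
  obtain ⟨Φ, Ψ, hΦ⟩ := exists_flow_charField (hP γ hγc) hLip
  refine ⟨X γ, hX γ hγc, Φ, Ψ, hΦ, fun t z hz => ?_⟩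
  have hz' : ‖z‖ ≤ R := by simpa using hz
  have hrz : r z = ⟨z, hz⟩ := Subtype.ext (retractBall_eq hR hz')
  have hsol : ∀ t, HasDerivAt (fun t => γ t (r z))
      (charField (force (potential U₀ W a R (X γ))) t (γ t (r z))) t := by
    intro t
    have := (ContinuousMap.evalCLM ℝ (r z)).hasFDerivAt.comp_hasDerivAt t (hγ t)
    refine this.congr_deriv ?_
    exact hGapp γ hγc t (r z)
  -- For labels in the ball, the self-consistent trajectory and the flow solve the same equation
  -- with the same initial value.
  have := hLip.unique (a := 0) hsol (hΦ.hasDerivAt z) (by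
    rw [hγ0, hΦ.zero, hrz]
    rfl) t
  exact congrArg Prod.fst this

/-- Solutions of the Vlasov-Klein-Gordon system in Lagrangian form. -/
theorem exists_lagrangian_solution {δ : E3 → ℝ} (hδ : ContDiff ℝ ∞ δ) (hδc : HasCompactSupport δ)
    (ha : Continuous a) (hac : HasCompactSupport a) {u₁ u₂ : E3 → ℝ} (hu₁ : IsCb 3 u₁)
    (hu₂ : IsCb 2 u₂) : ∃ (U : ℝ × E3 → ℝ) (Φ Ψ : ℝ → E3 × E3 → E3 × E3), ContDiff ℝ 2 U ∧
      (∀ x, U (0, x) = u₁ x) ∧ (∀ x, dd eT U (0, x) = u₂ x) ∧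
      IsFlow (charField (force U)) Φ Ψ ∧
      ∀ t x, kg U (t, x) = -∫ z, a z * δ (x - (Φ t z).1) := by
  obtain ⟨U₀, hU₀, hkg₀, h0₁, h0₂, hbU⟩ := exists_kg_homogeneous hu₁ hu₂
  have hδ2 : IsCb 2 δ := isCb_of_hasCompactSupport hδ hδc 2
  have hW : ContDiff ℝ 2 (kgSol δ) := contDiff_kgSol (n := 2) hδ2.contDiff
  -- The ball contains the support of `a`, so restricting the label integrals to it changes nothing.
  obtain ⟨R, hR, hsupp⟩ := hac.isCompact.isBounded.subset_closedBall_lt 0 0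
  obtain ⟨X, hX, Φ, Ψ, hΦ, hXΦ⟩ := exists_selfconsistent hU₀ hbU hW (hessBounded_kgSol hδ2)
    (kgSol_zero δ) ha hR
  refine ⟨potential U₀ (kgSol δ) a R X, Φ, Ψ, contDiff_potential hU₀ hW (kgSol_zero δ) ha hX,
    fun x => ?_, fun x => ?_, hΦ, fun t x => ?_⟩
  · simp [potential, duhamel, h0₁]
  · rw [dd_potential hU₀ hW (kgSol_zero δ) ha hX]
    simp [duhamel, h0₂]
  · have hD : ContDiff ℝ 2 (duhamel volume (closedBall (0 : E3 × E3) R) a X (kgSol δ)) :=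
      contDiff_duhamel (isCompact_closedBall _ _) ha hX hW (kgSol_zero δ)
    have h1 := kg_sub hU₀ hD (t, x)
    rw [hkg₀, kg_duhamel (μ := volume) (isCompact_closedBall (0 : E3 × E3) R) ha hX hW (kgSol_zero δ)
      (kg_kgSol hδ2.contDiff), zero_sub] at h1
    refine h1.trans (congrArg Neg.neg ?_)
    have h2 : ∫ z in closedBall (0 : E3 × E3) R, a z * δ (x - (Φ t z).1) =
        ∫ z, a z * δ (x - (Φ t z).1) :=
      setIntegral_eq_integral_of_forall_compl_eq_zero fun z hz => by
        rw [image_eq_zero_of_notMem_tsupport fun h => hz (hsupp h), zero_mul]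
    rw [← h2]
    refine setIntegral_congr_fun (measurableSet_closedBall (x := (0 : E3 × E3)))
      fun z hz => ?_
    simp only [dd_time_kgSol_zero (hδ2.contDiff.of_le (by norm_num)), hXΦ t z hz]

end Coupled

/-! ### Pointwise derivative rules, for functions regular only near a point. -/

section LocalDerivatives

variable {V : Type} [NormedAddCommGroup V] [NormedSpace ℝ V]

theorem hasDerivAt_slice {H : ℝ × V → ℝ} {t : ℝ} {z : V} (hH : DifferentiableAt ℝ H (t, z)) :
    HasDerivAt (fun s => H (s, z)) (dd (1, 0) H (t, z)) t :=
  HasFDerivAt.comp_hasDerivAt (l := H) (f := fun s : ℝ => (s, z)) t hH.hasFDerivAt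
    ((hasDerivAt_id t).prodMk (hasDerivAt_const t z))

theorem dd_slice {H : ℝ × V → ℝ} {t : ℝ} {z : V} (hH : DifferentiableAt ℝ H (t, z)) (a : V) :
    dd a (fun y => H (t, y)) z = dd (0, a) H (t, z) := by
  have h : HasFDerivAt (fun y => H (t, y))
      ((fderiv ℝ H (t, z)).comp (ContinuousLinearMap.inr ℝ ℝ V)) z :=
    HasFDerivAt.comp (g := H) (f := fun y => (t, y)) z hH.hasFDerivAt
      (hasFDerivAt_prodMk_right t z)
  rw [dd, dd, h.fderiv]
  rfl

theorem dd_dd_eq_of_contDiffAt {U : V → ℝ} {p : V} (hU : ContDiffAt ℝ 2 U p) (a b : V) :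
    dd a (dd b U) p = fderiv ℝ (fderiv ℝ U) p a b := by
  have h1 : DifferentiableAt ℝ (fderiv ℝ U) p :=
    (hU.fderiv_right (m := 1) (by norm_num)).differentiableAt (by simp)
  have h3 := h1.hasFDerivAt.clm_apply (hasFDerivAt_const b p)
  have h4 : fderiv ℝ (dd b U) p = fderiv ℝ (fun y => fderiv ℝ U y b) p := rfl
  rw [dd, h4, h3.fderiv]
  simp

theorem dd_comm_of_contDiffAt {U : V → ℝ} {p : V} (hU : ContDiffAt ℝ 2 U p) (a b : V) :
    dd a (dd b U) p = dd b (dd a U) p := by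
  rw [dd_dd_eq_of_contDiffAt hU, dd_dd_eq_of_contDiffAt hU]
  exact (hU.isSymmSndFDerivAt (by simp)) a b

theorem contDiffAt_one_dd {U : V → ℝ} {p : V} (hU : ContDiffAt ℝ 2 U p) (a : V) :
    ContDiffAt ℝ 1 (dd a U) p :=
  (hU.fderiv_right (m := 1) (by norm_num)).clm_apply contDiffAt_const

end LocalDerivatives

/-! ### A weight adapted to backward light cones. -/

section ConeWeight

/-- A cutoff function that decreases along backward light cones. -/
def coneWeight (A : ℝ) (p : ℝ × E3) : ℝ :=
  Real.smoothTransition (A - p.1 - Real.sqrt (1 + ‖p.2‖ ^ 2))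

theorem contDiff_sqrt_one_add_sq {n : WithTop ℕ∞} :
    ContDiff ℝ n fun x : E3 => Real.sqrt (1 + ‖x‖ ^ 2) :=
  (contDiff_const.add (contDiff_norm_sq ℝ)).sqrt fun x => by positivity

theorem contDiff_coneWeight (A : ℝ) : ContDiff ℝ 1 (coneWeight A) := by
  have h : ContDiff ℝ 1 fun p : ℝ × E3 => A - p.1 - Real.sqrt (1 + ‖p.2‖ ^ 2) :=
    (contDiff_const.sub contDiff_fst).sub (contDiff_sqrt_one_add_sq.comp contDiff_snd)
  exact (Real.smoothTransition.contDiff (n := 1)).comp h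

theorem coneWeight_nonneg (A : ℝ) (p : ℝ × E3) : 0 ≤ coneWeight A p :=
  Real.smoothTransition.nonneg _

theorem coneWeight_le_one (A : ℝ) (p : ℝ × E3) : coneWeight A p ≤ 1 :=
  Real.smoothTransition.le_one _

theorem coneWeight_eq_zero {A t : ℝ} (ht : 0 ≤ t) {x : E3} (hx : x ∉ closedBall 0 A) :
    coneWeight A (t, x) = 0 := by
  refine Real.smoothTransition.zero_of_nonpos ?_
  have h1 : A < ‖x‖ := by simpa using hx
  have h2 := abs_le_sqrt_one_add_sq ‖x‖
  rw [abs_norm] at h2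
  simp only
  linarith

theorem coneWeight_eq_one {A t r : ℝ} {x : E3} (hx : ‖x‖ ≤ r) (hA : t + r + 2 ≤ A) :
    coneWeight A (t, x) = 1 := by
  refine Real.smoothTransition.one_of_one_le ?_
  have h2 : Real.sqrt (1 + ‖x‖ ^ 2) ≤ 1 + ‖x‖ := by
    rw [Real.sqrt_le_left (by positivity)]
    nlinarith [norm_nonneg x]
  simp only
  linarith

theorem sum_sq_eq_norm_sq (x : E3) : ∑ i, x i ^ 2 = ‖x‖ ^ 2 := by
  rw [EuclideanSpace.norm_sq_eq]
  simp

/-- The time derivative of the weight is `-e` with `e ≥ 0`, and its gradient is `-e x / q` with `|x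
/ q| ≤ 1`. Since the energy flux `s m` is dominated by the energy density, the decay of the weight
absorbs whatever flows in. -/
theorem coneWeight_flux_le (A : ℝ) (p : ℝ × E3) (s r : ℝ) (m : Fin 3 → ℝ) :
    dd eT (coneWeight A) p * ((s ^ 2 + ∑ i, m i ^ 2 + r ^ 2) / 2) -
      ∑ i, dd (eX i) (coneWeight A) p * (s * m i) ≤ 0 := by
  obtain ⟨t, x⟩ := p
  set q := Real.sqrt (1 + ‖x‖ ^ 2) with hq
  have hqpos : 0 < q := Real.sqrt_pos.2 (by positivity)
  have hqsq : q ^ 2 = 1 + ‖x‖ ^ 2 := Real.sq_sqrt (by positivity)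
  set e := deriv Real.smoothTransition (A - t - q) with he
  have he0 : 0 ≤ e := Real.smoothTransition.monotone.deriv_nonneg
  have hη : HasDerivAt Real.smoothTransition e (A - t - q) :=
    ((Real.smoothTransition.contDiff (n := 1)).differentiable (by simp) _).hasDerivAt
  have hq' : HasFDerivAt (fun p : ℝ × E3 => Real.sqrt (1 + ‖p.2‖ ^ 2))
      ((1 / (2 * q)) • ((2 • innerSL ℝ x).comp (ContinuousLinearMap.snd ℝ ℝ E3))) (t, x) := by
    have h1 : HasFDerivAt (fun p : ℝ × E3 => ‖p.2‖ ^ 2)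
        ((2 • innerSL ℝ x).comp (ContinuousLinearMap.snd ℝ ℝ E3)) (t, x) :=
      HasFDerivAt.comp (g := fun x : E3 => ‖x‖ ^ 2) (f := Prod.snd) (t, x)
        (hasStrictFDerivAt_norm_sq x).hasFDerivAt hasFDerivAt_snd
    exact (h1.const_add 1).sqrt (by positivity)
  have hφ : HasFDerivAt (coneWeight A) _ (t, x) :=
    HasDerivAt.comp_hasFDerivAt (h₂ := Real.smoothTransition)
      (f := fun p : ℝ × E3 => A - p.1 - Real.sqrt (1 + ‖p.2‖ ^ 2)) (t, x) hη
      ((hasFDerivAt_fst.const_sub A).sub hq')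
  have h1 : dd eT (coneWeight A) (t, x) = -e := by
    rw [dd, hφ.fderiv]
    simp
  have h2 : ∀ i, dd (eX i) (coneWeight A) (t, x) = -e * (x i / q) := by
    intro i
    rw [dd, hφ.fderiv]
    simp [EuclideanSpace.inner_single_right]
    field_simp
    simp
  rw [h1]
  simp only [h2]
  have h3 : ∑ i, (x i / q) ^ 2 ≤ 1 := by
    simp only [div_pow]
    rw [← Finset.sum_div, sum_sq_eq_norm_sq, div_le_one (by positivity), hqsq]
    linarith
  -- Completing the square, this gives `s m · (x / q) ≤ (s² + |m|²) / 2`.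
  have h4 : 0 ≤ ∑ i, (m i - x i / q * s) ^ 2 := Finset.sum_nonneg fun i _ => sq_nonneg _
  have h5 : ∑ i, (m i - x i / q * s) ^ 2 =
      ∑ i, m i ^ 2 - 2 * ∑ i, x i / q * (s * m i) + s ^ 2 * ∑ i, (x i / q) ^ 2 := by
    simp only [Fin.sum_univ_three]
    ring
  have h6 : ∑ i, -e * (x i / q) * (s * m i) = -e * ∑ i, x i / q * (s * m i) := by
    rw [Finset.mul_sum]
    simp only [mul_assoc]
  rw [h6]
  have h7 : 0 ≤ (s ^ 2 + ∑ i, m i ^ 2 + r ^ 2) / 2 - ∑ i, x i / q * (s * m i) := by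
    nlinarith [sq_nonneg s, sq_nonneg r, mul_le_mul_of_nonneg_left h3 (sq_nonneg s)]
  nlinarith [mul_nonneg he0 h7]

end ConeWeight

/-! ### Localized energy estimate for the Klein-Gordon equation. -/

section KleinGordonEnergy

/-- The energy density of the Klein-Gordon equation. -/
def energyDensity (h : ℝ × E3 → ℝ) (p : ℝ × E3) : ℝ :=
  (dd eT h p ^ 2 + ∑ i, dd (eX i) h p ^ 2 + h p ^ 2) / 2

theorem contDiffOn_one_dd {h : ℝ × E3 → ℝ} (hh : ContDiffOn ℝ 2 h (Ioi 0 ×ˢ univ)) (a : ℝ × E3) :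
    ContDiffOn ℝ 1 (dd a h) (Ioi 0 ×ˢ univ) := fun _ hp =>
  (contDiffAt_one_dd (hh.contDiffAt ((isOpen_Ioi.prod isOpen_univ).mem_nhds hp)) a).contDiffWithinAt

theorem contDiffOn_energyDensity {h : ℝ × E3 → ℝ} (hh : ContDiffOn ℝ 2 h (Ioi 0 ×ˢ univ)) :
    ContDiffOn ℝ 1 (energyDensity h) (Ioi 0 ×ˢ univ) :=
  ((((contDiffOn_one_dd hh _).pow 2).add (ContDiffOn.sum fun i _ =>
    (contDiffOn_one_dd hh _).pow 2)).add ((hh.of_le (by norm_num)).pow 2)).div_const 2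

theorem dd_eT_energyDensity {h : ℝ × E3 → ℝ} {p : ℝ × E3} (hh : ContDiffAt ℝ 2 h p) :
    dd eT (energyDensity h) p = dd eT h p * dd eT (dd eT h) p +
      ∑ i, dd (eX i) h p * dd (eX i) (dd eT h) p + h p * dd eT h p := by
  obtain ⟨t, x⟩ := p
  have hd : ∀ a, HasDerivAt (fun s => dd a h (s, x)) (dd eT (dd a h) (t, x)) t := fun a =>
    hasDerivAt_slice ((contDiffAt_one_dd hh a).differentiableAt (by simp))
  have he : DifferentiableAt ℝ (energyDensity h) (t, x) := by
    have hda : ∀ a, ContDiffAt ℝ 1 (dd a h) (t, x) := contDiffAt_one_dd hh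
    have : ContDiffAt ℝ 1 (energyDensity h) (t, x) :=
      ((((hda eT).pow 2).add (ContDiffAt.sum fun i _ => (hda (eX i)).pow 2)).add
        ((hh.of_le (by norm_num)).pow 2)).div_const 2
    exact this.differentiableAt (by simp)
  have h1 := (((((hd eT).pow 2).add (HasDerivAt.fun_sum (u := Finset.univ)
    fun i _ => (hd (eX i)).pow 2)).add
      ((hasDerivAt_slice (hh.differentiableAt (by simp))).pow 2)).div_const 2)
  rw [(hasDerivAt_slice he).unique h1]
  simp only [dd_comm_of_contDiffAt hh eT (eX _), Fin.sum_univ_three]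
  ring

/-- The local energy estimate for the Klein-Gordon equation. -/
theorem exists_hasDerivAt_energy {h : ℝ × E3 → ℝ} (hh : ContDiffOn ℝ 2 h (Ioi 0 ×ˢ univ)) {A t B : ℝ}
    (ht : 0 < t) (hB : ∀ x ∈ closedBall (0 : E3) A, kg h (t, x) ^ 2 ≤ B) : ∃ E',
      HasDerivAt (fun t => ∫ x, coneWeight A (t, x) * energyDensity h (t, x)) E' t ∧
      E' ≤ (∫ x, coneWeight A (t, x) * energyDensity h (t, x)) +
        B * volume.real (closedBall (0 : E3) A) := by
  have hK : IsCompact (closedBall (0 : E3) A) := isCompact_closedBall _ _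
  have hO : IsOpen (Ioi (0 : ℝ) ×ˢ (univ : Set E3)) := isOpen_Ioi.prod isOpen_univ
  have hmem : ∀ x : E3, (t, x) ∈ Ioi (0 : ℝ) ×ˢ (univ : Set E3) := fun x => ⟨ht, mem_univ x⟩
  have hat : ∀ x, ContDiffAt ℝ 2 h (t, x) := fun x =>
    hh.contDiffAt (hO.mem_nhds (hmem x))
  have hw := contDiff_coneWeight A
  have hH : ContDiffOn ℝ 1 (fun p => coneWeight A p * energyDensity h p) (Ioi 0 ×ˢ univ) :=
    hw.contDiffOn.mul (contDiffOn_energyDensity hh)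
  refine ⟨_, hasDerivAt_integral_of_support (μ := (volume : Measure E3)) isOpen_Ioi hH hK
    (fun s hs x hx => by rw [coneWeight_eq_zero (le_of_lt hs) hx, zero_mul]) ht, ?_⟩
  have hslice : ∀ {N : ℝ × E3 → ℝ}, ContDiffOn ℝ 1 N (Ioi 0 ×ˢ univ) →
      ContDiff ℝ 1 fun x => N (t, x) := fun hN =>
    contDiffOn_univ.1 (hN.comp (contDiff_prodMk_right t).contDiffOn fun x _ => ⟨ht, mem_univ x⟩)
  -- The weighted energy flux; its divergence integrates to zero.
  let N : Fin 3 → E3 → ℝ := fun i x => coneWeight A (t, x) * (dd eT h (t, x) * dd (eX i) h (t, x))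
  have hN : ∀ i, ContDiff ℝ 1 (N i) := fun i => hslice (N := fun p =>
    coneWeight A p * (dd eT h p * dd (eX i) h p))
      (hw.contDiffOn.mul ((contDiffOn_one_dd hh _).mul (contDiffOn_one_dd hh _)))
  have hNc : ∀ i, HasCompactSupport (N i) := fun i => HasCompactSupport.intro hK fun x hx => by
    simp only [N, coneWeight_eq_zero ht.le hx, zero_mul]
  have hNd : ∀ i x, dd (ex i) (N i) x = dd (eX i) (coneWeight A) (t, x) *
      (dd eT h (t, x) * dd (eX i) h (t, x)) + coneWeight A (t, x) *
      (dd (eX i) (dd eT h) (t, x) * dd (eX i) h (t, x) +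
        dd eT h (t, x) * dd (eX i) (dd (eX i) h) (t, x)) := by
    intro i x
    have hs : ∀ a, ContDiff ℝ 1 fun x => dd a h (t, x) := fun a => hslice (contDiffOn_one_dd hh a)
    have hws : ContDiff ℝ 1 fun x => coneWeight A (t, x) := hslice hw.contDiffOn
    have hsd : ∀ a b, dd b (fun x => dd a h (t, x)) x = dd (0, b) (dd a h) (t, x) := fun a b =>
      dd_slice ((contDiffAt_one_dd (hat x) a).differentiableAt (by simp)) b
    simp only [N]
    rw [dd_mul hws ((hs _).mul (hs _)), dd_mul (hs _) (hs _)]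
    simp only [hsd, dd_slice (hw.differentiable (by simp) (t, x))]
  -- Pointwise energy balance: divergence of the flux, plus the nonpositive weight term of
  -- `coneWeight_flux_le`, plus the work `∂ₜh * kg h` of the source, split by Young's inequality.
  have hpt : ∀ x, dd (1, 0) (fun p => coneWeight A p * energyDensity h p) (t, x) ≤
      ∑ i, dd (ex i) (N i) x + (coneWeight A (t, x) * energyDensity h (t, x) +
        (closedBall (0 : E3) A).indicator (fun _ => B) x) := by
    intro x
    have hed : DifferentiableAt ℝ (energyDensity h) (t, x) :=
      ((contDiffOn_energyDensity hh).contDiffAt (hO.mem_nhds (hmem x))).differentiableAt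
        (by simp)
    have h1 : dd (1, 0) (fun p => coneWeight A p * energyDensity h p) (t, x) =
        dd eT (coneWeight A) (t, x) * energyDensity h (t, x) +
          coneWeight A (t, x) * dd eT (energyDensity h) (t, x) := by
      rw [dd, fderiv_fun_mul (hw.differentiable (by simp) (t, x)) hed]
      simp [dd]
      ring
    have h2 := coneWeight_flux_le A (t, x) (dd eT h (t, x)) (h (t, x)) fun i => dd (eX i) h (t, x)
    have h3 : coneWeight A (t, x) * (dd eT h (t, x) * kg h (t, x)) ≤
        coneWeight A (t, x) * energyDensity h (t, x) +
          (closedBall (0 : E3) A).indicator (fun _ => B) x := by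
      by_cases hx : x ∈ closedBall (0 : E3) A
      · rw [indicator_of_mem hx]
        have h4 := hB x hx
        have h5 : 0 ≤ ∑ i, dd (eX i) h (t, x) ^ 2 := Finset.sum_nonneg fun i _ => sq_nonneg _
        have h6 : dd eT h (t, x) * kg h (t, x) ≤ energyDensity h (t, x) + B / 2 := by
          rw [energyDensity]
          nlinarith [sq_nonneg (dd eT h (t, x) - kg h (t, x)), sq_nonneg (h (t, x))]
        have h7 := mul_le_mul_of_nonneg_left h6 (coneWeight_nonneg A (t, x))
        nlinarith [coneWeight_le_one A (t, x), (sq_nonneg _).trans h4]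
      · rw [indicator_of_notMem hx, coneWeight_eq_zero ht.le hx]
        simp
    rw [h1, dd_eT_energyDensity (hat x)]
    simp only [hNd]
    rw [kg] at h3
    rw [← energyDensity] at h2
    simp only [Fin.sum_univ_three] at h2 h3 ⊢
    linarith
  have hint : Integrable fun x => coneWeight A (t, x) * energyDensity h (t, x) :=
    (hslice hH).continuous.integrable_of_hasCompactSupport (HasCompactSupport.intro hK fun x hx => by
      rw [coneWeight_eq_zero ht.le hx, zero_mul])
  have hind : Integrable ((closedBall (0 : E3) A).indicator fun _ => B) :=
    (integrable_indicator_iff measurableSet_closedBall).2 (integrableOn_const hK.measure_ne_top)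
  have hNI : ∀ i, Integrable (dd (ex i) (N i)) := fun i =>
    (continuous_dd (hN i) _).integrable_of_hasCompactSupport (hasCompactSupport_dd (hNc i) _)
  have hlhs : Integrable fun x =>
      dd (1, 0) (fun p => coneWeight A p * energyDensity h p) (t, x) := by
    have hc : Continuous fun x => dd (1, 0) (fun p => coneWeight A p * energyDensity h p) (t, x) :=
      ((hH.continuousOn_fderiv_of_isOpen hO (by simp)).clm_apply
        continuousOn_const).comp_continuous (Continuous.prodMk_right t) fun x => ⟨ht, mem_univ x⟩
    refine hc.integrable_of_hasCompactSupport (HasCompactSupport.intro hK fun x hx => ?_)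
    have h1 : HasDerivAt (fun s => coneWeight A (s, x) * energyDensity h (s, x)) _ t :=
      hasDerivAt_slice ((hH.contDiffAt (hO.mem_nhds (hmem x))).differentiableAt (by simp))
    refine h1.unique ((hasDerivAt_const t (0 : ℝ)).congr_of_eventuallyEq ?_)
    filter_upwards [Ioi_mem_nhds ht] with s hs
    rw [coneWeight_eq_zero (le_of_lt hs) hx, zero_mul]
  refine (integral_mono hlhs ((integrable_finsetSum _ fun i _ => hNI i).add (hint.add hind))
    hpt).trans (le_of_eq ?_)
  rw [integral_add' (integrable_finsetSum _ fun i _ => hNI i) (hint.add hind),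
    integral_add' hint hind, integral_finsetSum _ fun i _ => hNI i,
    Finset.sum_eq_zero fun i _ => integral_dd_eq_zero (hN i) (hNc i) _,
    integral_indicator measurableSet_closedBall, setIntegral_const, smul_eq_mul]
  ring

end KleinGordonEnergy

/-! ### The `L²` estimate for the transport equation. -/

section TransportEnergy

theorem fderiv_sq {V : Type} [NormedAddCommGroup V] [NormedSpace ℝ V] {f : V → ℝ} {p : V}
    (hf : DifferentiableAt ℝ f p) (a : V) :
    fderiv ℝ (fun p => f p ^ 2) p a = 2 * f p * fderiv ℝ f p a := by
  have h := (hf.hasFDerivAt.pow 2).fderiv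
  rw [h]
  simp

/-- The `L²` estimate for the transport equation. -/
theorem exists_hasDerivAt_integral_sq {D : ℝ × E3 × E3 → ℝ}
    (hD : ContDiffOn ℝ 1 D (Ioi 0 ×ˢ univ)) {K : Set (E3 × E3)} (hK : IsCompact K) {T : ℝ}
    (hsupp : ∀ t ∈ Ioo 0 T, ∀ z ∉ K, D (t, z) = 0) {F : E3 → E3}
    (hF : ∀ i, ContDiff ℝ 1 fun x => F x i) {S : E3 × E3 → ℝ} (hS : Continuous S)
    (hSK : ∀ z ∉ K, S z = 0) {t : ℝ} (ht : t ∈ Ioo 0 T)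
    (heq : ∀ z, dd (1, 0) D (t, z) + streaming F (fun z => D (t, z)) z = S z) :
    ∃ Y', HasDerivAt (fun t => ∫ z, D (t, z) ^ 2) Y' t ∧
      Y' ≤ (∫ z, D (t, z) ^ 2) + ∫ z, S z ^ 2 := by
  have hO : IsOpen (Ioi (0 : ℝ) ×ˢ (univ : Set (E3 × E3))) := isOpen_Ioi.prod isOpen_univ
  have hmem : ∀ z : E3 × E3, (t, z) ∈ Ioi (0 : ℝ) ×ˢ (univ : Set (E3 × E3)) := fun z =>
    ⟨ht.1, mem_univ z⟩
  have hat : ∀ z, DifferentiableAt ℝ D (t, z) := fun z =>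
    (hD.contDiffAt (hO.mem_nhds (hmem z))).differentiableAt (by simp)
  refine ⟨_, hasDerivAt_integral_of_support (μ := (volume : Measure (E3 × E3))) isOpen_Ioo
    (H := fun p => D p ^ 2) ((hD.mono (prod_mono Ioo_subset_Ioi_self subset_rfl)).pow 2) hK
    (fun s hs z hz => by rw [hsupp s hs z hz]; simp) ht, ?_⟩
  have hDt : ContDiff ℝ 1 fun z => D (t, z) :=
    contDiffOn_univ.1 (hD.comp (contDiff_prodMk_right t).contDiffOn fun z _ => hmem z)
  have hDc : HasCompactSupport fun z => D (t, z) := HasCompactSupport.intro hK (hsupp t ht)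
  have hD2 : ContDiff ℝ 1 fun z => D (t, z) ^ 2 := hDt.pow 2
  have hD2c : HasCompactSupport fun z => D (t, z) ^ 2 :=
    HasCompactSupport.intro hK fun z hz => by rw [hsupp t ht z hz]; simp
  -- The square of `D` is transported with source `2 D S`, and the streaming term integrates to
  -- zero.
  have h1 : ∀ z, dd (1, 0) (fun p => D p ^ 2) (t, z) =
      2 * (D (t, z) * S z) - streaming F (fun z => D (t, z) ^ 2) z := by
    intro z
    rw [dd, fderiv_sq (hat z), ← fderiv_eq_streaming, fderiv_sq (hDt.differentiable (by simp) z),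
      fderiv_eq_streaming, ← heq z, dd]
    ring
  have iDS : Integrable fun z => D (t, z) * S z :=
    (hDt.continuous.mul hS).integrable_of_hasCompactSupport hDc.mul_right
  have iD2 : Integrable fun z => D (t, z) ^ 2 :=
    hD2.continuous.integrable_of_hasCompactSupport hD2c
  have iS2 : Integrable fun z => S z ^ 2 :=
    (hS.pow 2).integrable_of_hasCompactSupport
      (HasCompactSupport.intro hK fun z hz => by simp [hSK z hz])
  have iSt : Integrable (streaming F fun z => D (t, z) ^ 2) :=
    (continuous_streaming (fun i => (hF i).continuous) hD2).integrable_of_hasCompactSupport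
      (hasCompactSupport_streaming F hD2c)
  simp only [h1]
  rw [integral_sub (iDS.const_mul 2) iSt, integral_streaming_eq_zero hF hD2 hD2c, sub_zero,
    ← integral_add iD2 iS2]
  exact integral_mono (iDS.const_mul 2) (iD2.add iS2) fun z => by
    nlinarith [sq_nonneg (D (t, z) - S z)]

end TransportEnergy

/-! ### Grönwall and Cauchy-Schwarz inequalities. -/

section Gronwall

/-- The function `exp(-C t) * Z t` is nonincreasing and starts at 0. Differentiability is demanded
only at interior times, which suits functions that are classical only for `t > 0`. -/
theorem eq_zero_of_deriv_le_mul {Z : ℝ → ℝ} {C T : ℝ} (hc : ContinuousOn Z (Icc 0 T))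
    (h0 : Z 0 = 0) (hnn : ∀ t ∈ Icc 0 T, 0 ≤ Z t)
    (hd : ∀ t ∈ Ioo 0 T, ∃ Z', HasDerivAt Z Z' t ∧ Z' ≤ C * Z t) : ∀ t ∈ Icc 0 T, Z t = 0 := by
  intro t ht
  have hexp : ∀ s, HasDerivAt (fun s => Real.exp (-C * s)) (Real.exp (-C * s) * (-C * 1)) s :=
    fun s => ((hasDerivAt_id s).const_mul (-C)).exp
  have hanti : AntitoneOn (fun s => Real.exp (-C * s) * Z s) (Icc 0 T) := by
    refine antitoneOn_of_deriv_nonpos (convex_Icc 0 T)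
      ((Continuous.continuousOn (by fun_prop)).mul hc) ?_ ?_
    · intro s hs
      rw [interior_Icc] at hs
      obtain ⟨Z', hZ', -⟩ := hd s hs
      exact ((hexp s).mul hZ').differentiableAt.differentiableWithinAt
    · intro s hs
      rw [interior_Icc] at hs
      obtain ⟨Z', hZ', hle⟩ := hd s hs
      have h1 : deriv (fun s => Real.exp (-C * s) * Z s) s = _ := ((hexp s).mul hZ').deriv
      rw [h1]
      have := mul_le_mul_of_nonneg_left hle (Real.exp_pos (-C * s)).le
      linarith
  have h1 := hanti (left_mem_Icc.2 (ht.1.trans ht.2)) ht ht.1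
  simp only [h0, mul_zero] at h1
  have h2 := Real.exp_pos (-C * t)
  exact le_antisymm (by
    by_contra! h3
    linarith [mul_pos h2 h3]) (hnn t ht)

/-- Cauchy-Schwarz against the constant 1, from expanding `∫ (v f - I)² ≥ 0` with `v` the measure of
`K` and `I` the integral of `f`. -/
theorem sq_setIntegral_le {Y : Type} [TopologicalSpace Y] [MeasurableSpace Y]
    [OpensMeasurableSpace Y] [T2Space Y] {μ : Measure Y} [IsFiniteMeasureOnCompacts μ] {K : Set Y}
    (hK : IsCompact K) {f : Y → ℝ} (hf : IntegrableOn f K μ)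
    (hf2 : IntegrableOn (fun y => f y ^ 2) K μ) :
    (∫ y in K, f y ∂μ) ^ 2 ≤ μ.real K * ∫ y in K, f y ^ 2 ∂μ := by
  have hfin := hK.measure_ne_top (μ := μ)
  rcases eq_or_ne (μ K) 0 with h0 | h0
  · rw [setIntegral_measure_zero _ h0, setIntegral_measure_zero _ h0]
    simp
  set v := μ.real K
  have hv : 0 < v := ENNReal.toReal_pos h0 hfin
  set I := ∫ y in K, f y ∂μ
  have h1 : 0 ≤ ∫ y in K, (v * f y - I) ^ 2 ∂μ := integral_nonneg fun y => sq_nonneg _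
  have h2 : ∫ y in K, (v * f y - I) ^ 2 ∂μ = v ^ 2 * (∫ y in K, f y ^ 2 ∂μ) - v * I ^ 2 := by
    have e : (fun y => (v * f y - I) ^ 2) = fun y => v ^ 2 * f y ^ 2 - 2 * v * I * f y + I ^ 2 := by
      ext y
      ring
    have i1 : Integrable (fun y => v ^ 2 * f y ^ 2) (μ.restrict K) := hf2.const_mul _
    have i2 : Integrable (fun y => 2 * v * I * f y) (μ.restrict K) := hf.const_mul _
    have i3 : IntegrableOn (fun _ => I ^ 2) K μ := integrableOn_const hfin
    rw [e, integral_add (f := fun y => v ^ 2 * f y ^ 2 - 2 * v * I * f y) (i1.sub i2) i3,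
      integral_sub i1 i2, integral_const_mul, integral_const_mul,
      setIntegral_const, smul_eq_mul]
    ring
  rw [h2] at h1
  have h3 : 0 ≤ v * (v * (∫ y in K, f y ^ 2 ∂μ) - I ^ 2) := by linarith
  linarith [nonneg_of_mul_nonneg_right h3 hv]

end Gronwall

/-! ### The linear system for a difference of two solutions. -/

section Uniqueness

/-- The norm on `E3 × E3` is the maximum norm, so a ball is a product of balls. -/
theorem setIntegral_closedBall_fst (f : E3 → ℝ) (r : ℝ) :
    ∫ z in closedBall (0 : E3 × E3) r, f z.1 =
      (∫ x in closedBall (0 : E3) r, f x) * volume.real (closedBall (0 : E3) r) := by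
  have h1 : closedBall (0 : E3 × E3) r = closedBall (0 : E3) r ×ˢ closedBall (0 : E3) r := by
    rw [closedBall_prod_same]
    rfl
  have h2 := setIntegral_prod_mul (μ := (volume : Measure E3)) (ν := (volume : Measure E3)) f
    (fun _ => (1 : ℝ)) (closedBall 0 r) (closedBall 0 r)
  simp only [mul_one, setIntegral_const, smul_eq_mul] at h2
  rw [h1]
  exact h2

/-- Bounds the source `∂ₓh · ∂ᵥf` of the transport equation in `L²` of phase space by the gradient
of `h` in `L²` of position space. -/
theorem integral_sq_sum_le {m : Fin 3 → E3 → ℝ} (hm : ∀ i, Continuous (m i))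
    {c : Fin 3 → E3 × E3 → ℝ} (hc : ∀ i, Continuous (c i)) {r C : ℝ}
    (hc0 : ∀ i, ∀ z ∉ closedBall (0 : E3 × E3) r, c i z = 0)
    (hC : ∀ i, ∀ z ∈ closedBall (0 : E3 × E3) r, |c i z| ≤ C) :
    ∫ z : E3 × E3, (∑ i, m i z.1 * c i z) ^ 2 ≤ 3 * C ^ 2 *
      ((∫ x in closedBall (0 : E3) r, ∑ i, m i x ^ 2) * volume.real (closedBall (0 : E3) r)) := by
  have hK : IsCompact (closedBall (0 : E3 × E3) r) := isCompact_closedBall _ _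
  have hS : Continuous fun z : E3 × E3 => (∑ i, m i z.1 * c i z) ^ 2 :=
    (continuous_finsetSum _ fun i _ => ((hm i).comp continuous_fst).mul (hc i)).pow 2
  have hM : Continuous fun z : E3 × E3 => 3 * C ^ 2 * ∑ i, m i z.1 ^ 2 :=
    continuous_const.mul (continuous_finsetSum _ fun i _ => ((hm i).comp continuous_fst).pow 2)
  have h1 : ∫ z : E3 × E3 in closedBall 0 r, (∑ i, m i z.1 * c i z) ^ 2 =
      ∫ z : E3 × E3, (∑ i, m i z.1 * c i z) ^ 2 :=
    setIntegral_eq_integral_of_forall_compl_eq_zero fun z hz => by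
      simp [fun i => hc0 i z hz]
  rw [← h1, ← setIntegral_closedBall_fst (fun x => ∑ i, m i x ^ 2), ← integral_const_mul]
  refine setIntegral_mono_on (hS.continuousOn.integrableOn_compact hK)
    (hM.continuousOn.integrableOn_compact hK) measurableSet_closedBall fun z hz => ?_
  refine (Finset.sum_mul_sq_le_sq_mul_sq _ _ _).trans ?_
  rw [mul_comm]
  refine mul_le_mul_of_nonneg_right ?_ (Finset.sum_nonneg fun i _ => sq_nonneg _)
  calc ∑ i, c i z ^ 2 ≤ ∑ _i : Fin 3, C ^ 2 := Finset.sum_le_sum fun i _ => by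
        rw [← sq_abs (c i z)]
        exact pow_le_pow_left₀ (abs_nonneg _) (hC i z hz) 2
    _ = 3 * C ^ 2 := by simp

/-- A difference of two solutions of the Vlasov-Klein-Gordon system with the same initial data
vanishes. -/
theorem eq_zero_of_linearized {δ : E3 → ℝ} (hδ : Continuous δ) (hδc : HasCompactSupport δ)
    {h : ℝ × E3 → ℝ} (hh : ContDiffOn ℝ 2 h (Ici 0 ×ˢ univ)) (h0 : ∀ x, h (0, x) = 0)
    (h0' : ∀ x, derivWithin (fun s => h (s, x)) (Ici 0) 0 = 0) {D : ℝ × E3 × E3 → ℝ}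
    (hD : ContDiffOn ℝ 1 D (Ici 0 ×ˢ univ)) (hD0 : ∀ z, D (0, z) = 0) {T r : ℝ}
    (hsupp : ∀ t ∈ Icc 0 T, ∀ z ∉ closedBall (0 : E3 × E3) r, D (t, z) = 0) {F : ℝ → E3 → E3}
    (hF : ∀ t ∈ Ioo 0 T, ∀ i, ContDiff ℝ 1 fun x => F t x i) {c : Fin 3 → ℝ × E3 × E3 → ℝ}
    (hc : ∀ i, Continuous (c i))
    (hcsupp : ∀ i, ∀ t ∈ Icc 0 T, ∀ z ∉ closedBall (0 : E3 × E3) r, c i (t, z) = 0)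
    (hV : ∀ t ∈ Ioo 0 T, ∀ z, dd (1, 0) D (t, z) + streaming (F t) (fun z => D (t, z)) z =
      ∑ i, dd (eX i) h (t, z.1) * c i (t, z))
    (hKG : ∀ t ∈ Ioo 0 T, ∀ x, kg h (t, x) = -∫ z, D (t, z) * δ (x - z.1)) :
    ∀ t ∈ Icc 0 T, (∀ z, D (t, z) = 0) ∧ ∀ x ∈ closedBall (0 : E3) r, h (t, x) = 0 := by
  set H : Set (ℝ × E3) := Ici 0 ×ˢ univ with hHdef
  -- The derivative within the half space is continuous up to `t = 0`, where the vanishing initial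
  -- data enter; for `t > 0` it is the full derivative.
  set P := fderivWithin ℝ h H with hP
  have hHu : UniqueDiffOn ℝ H := (uniqueDiffOn_Ici 0).prod uniqueDiffOn_univ
  have hO : IsOpen (Ioi (0 : ℝ) ×ˢ (univ : Set E3)) := isOpen_Ioi.prod isOpen_univ
  have hHnhds : ∀ t x, 0 < t → H ∈ 𝓝 ((t, x) : ℝ × E3) := fun t x ht =>
    mem_of_superset (hO.mem_nhds ⟨ht, mem_univ x⟩) (prod_mono Ioi_subset_Ici_self subset_rfl)
  have hPc : ContinuousOn P H := hh.continuousOn_fderivWithin hHu (by simp)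
  have hPeq : ∀ t x, 0 < t → ∀ a, P (t, x) a = dd a h (t, x) := fun t x ht a => by
    rw [hP, fderivWithin_of_mem_nhds (hHnhds t x ht), dd]
  have hPd : ∀ x, HasFDerivWithinAt h (P (0, x)) H (0, x) := fun x =>
    (hh.differentiableOn (by simp) _ ⟨self_mem_Ici, mem_univ x⟩).hasFDerivWithinAt
  have hP0T : ∀ x, P (0, x) eT = 0 := by
    intro x
    have h1 : HasDerivWithinAt (fun s => h (s, x)) (P (0, x) eT) (Ici 0) 0 :=
      HasFDerivWithinAt.comp_hasDerivWithinAt (l := h) (f := fun s : ℝ => (s, x)) (t := H) 0 (hPd x)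
        ((hasDerivAt_id 0).prodMk (hasDerivAt_const 0 x)).hasDerivWithinAt
        fun s hs => ⟨hs, mem_univ x⟩
    rw [← h1.derivWithin (uniqueDiffOn_Ici 0 0 self_mem_Ici), h0']
  have hP0X : ∀ x i, P (0, x) (eX i) = 0 := by
    intro x i
    have h1 : HasFDerivWithinAt (fun y => h (0, y)) _ univ x :=
      HasFDerivWithinAt.comp (g := h) (f := fun y => (0, y)) (t := H) x (hPd x)
        (hasFDerivAt_prodMk_right (𝕜 := ℝ) (0 : ℝ) x).hasFDerivWithinAt
        fun y _ => ⟨self_mem_Ici, mem_univ y⟩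
    rw [hasFDerivWithinAt_univ] at h1
    simp only [h0] at h1
    have h2 := congrArg (fun L : E3 →L[ℝ] ℝ => L (ex i)) (h1.unique (hasFDerivAt_const 0 x))
    simpa using h2
  -- Large enough for the cone weight to equal 1 on the ball of radius `r` up to time `T`.
  set A := T + r + 2 with hA
  have hKA : IsCompact (closedBall (0 : E3) A) := isCompact_closedBall _ _
  have hKr : IsCompact (closedBall (0 : E3) r) := isCompact_closedBall _ _
  set K := closedBall (0 : E3 × E3) r with hKdef
  have hK : IsCompact K := isCompact_closedBall _ _
  -- the energy density, continuous up to the initial time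
  let e : ℝ × E3 → ℝ := fun p => (P p eT ^ 2 + ∑ i, P p (eX i) ^ 2 + h p ^ 2) / 2
  have he : ∀ t x, 0 < t → e (t, x) = energyDensity h (t, x) := fun t x ht => by
    simp only [e, energyDensity, hPeq t x ht]
  have hec : ContinuousOn e H := by
    have hPa : ∀ a, ContinuousOn (fun p => P p a) H := fun a => hPc.clm_apply continuousOn_const
    exact ((((hPa _).pow 2).add (continuousOn_finsetSum _ fun i _ => (hPa _).pow 2)).add
      (hh.continuousOn.pow 2)).div_const 2
  have he0 : ∀ p, 0 ≤ e p := fun p => by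
    have : 0 ≤ ∑ i, P p (eX i) ^ 2 := Finset.sum_nonneg fun i _ => sq_nonneg _
    positivity
  have hwe : ∀ t, 0 ≤ t → Continuous fun x => coneWeight A (t, x) * e (t, x) := fun t ht =>
    ((contDiff_coneWeight A).continuous.comp (Continuous.prodMk_right t)).mul
      (hec.comp_continuous (Continuous.prodMk_right t) fun x => ⟨ht, mem_univ x⟩)
  have hwe0 : ∀ p, 0 ≤ coneWeight A p * e p := fun p => mul_nonneg (coneWeight_nonneg A p) (he0 p)
  have hweI : ∀ t, 0 ≤ t → Integrable fun x => coneWeight A (t, x) * e (t, x) := fun t ht =>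
    (hwe t ht).integrable_of_hasCompactSupport (HasCompactSupport.intro hKA fun x hx => by
      rw [coneWeight_eq_zero ht hx, zero_mul])
  let E : ℝ → ℝ := fun t => ∫ x, coneWeight A (t, x) * e (t, x)
  let Y : ℝ → ℝ := fun t => ∫ z, D (t, z) ^ 2
  have hE0 : ∀ t, 0 ≤ E t := fun t => integral_nonneg fun x => hwe0 _
  have hY0 : ∀ t, 0 ≤ Y t := fun t => integral_nonneg fun z => sq_nonneg _
  have hDc : ∀ t, 0 ≤ t → Continuous fun z => D (t, z) := fun t ht =>
    hD.continuousOn.comp_continuous (Continuous.prodMk_right t) fun z => ⟨ht, mem_univ z⟩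
  have hEcont : ContinuousOn E (Icc 0 T) := by
    refine continuousOn_integral_of_compact_support hKA
      (f := fun t x => coneWeight A (t, x) * e (t, x)) ?_ fun t x ht hx => by
        rw [coneWeight_eq_zero ht.1 hx, zero_mul]
    exact (contDiff_coneWeight A).continuous.continuousOn.mul
      (hec.mono (prod_mono Icc_subset_Ici_self subset_rfl))
  have hYcont : ContinuousOn Y (Icc 0 T) := by
    refine continuousOn_integral_of_compact_support hK
      (f := fun t z => D (t, z) ^ 2) ?_ fun t z ht hz => by
        rw [hsupp t ht z hz]
        simp
    exact (hD.continuousOn.mono (prod_mono Icc_subset_Ici_self subset_rfl)).pow 2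
  obtain ⟨Cδ, hCδ⟩ : ∃ C, ∀ x, ‖δ x‖ ≤ C := hδ.bounded_above_of_compact_support hδc
  obtain ⟨Cc, hCc⟩ : ∃ C, ∀ i, ∀ p ∈ Icc 0 T ×ˢ K, ‖c i p‖ ≤ C := by
    choose C hC using fun i =>
      ((isCompact_Icc (a := (0 : ℝ)) (b := T)).prod hK).exists_bound_of_continuousOn
        (hc i).continuousOn
    exact ⟨∑ i, |C i|, fun i p hp => (hC i p hp).trans ((le_abs_self _).trans
      (Finset.single_le_sum (f := fun i => |C i|) (fun _ _ => abs_nonneg _) (Finset.mem_univ i)))⟩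
  set v := volume.real (closedBall (0 : E3) r)
  set a := volume.real (closedBall (0 : E3) A)
  set k := volume.real K
  -- the growth of the field energy
  have hEd : ∀ t ∈ Ioo 0 T, ∃ E', HasDerivAt E E' t ∧ E' ≤ E t + k * (Cδ ^ 2 * Y t) * a := by
    intro t ht
    -- Cauchy-Schwarz over the support of `D`: the field source is controlled by the `L²` norm of
    -- `D`.
    have hbound : ∀ x ∈ closedBall (0 : E3) A, kg h (t, x) ^ 2 ≤ k * (Cδ ^ 2 * Y t) := by
      intro x _
      have hcont : Continuous fun z : E3 × E3 => D (t, z) * δ (x - z.1) :=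
        (hDc t ht.1.le).mul (hδ.comp (continuous_const.sub continuous_fst))
      rw [hKG t ht, neg_sq, ← setIntegral_eq_integral_of_forall_compl_eq_zero (s := K) fun z hz => by
        rw [hsupp t (Ioo_subset_Icc_self ht) z hz, zero_mul]]
      refine (sq_setIntegral_le hK (hcont.continuousOn.integrableOn_compact hK)
        ((hcont.pow 2).continuousOn.integrableOn_compact hK)).trans ?_
      refine mul_le_mul_of_nonneg_left ?_ measureReal_nonneg
      have iD : Integrable fun z => D (t, z) ^ 2 :=
        ((hDc t ht.1.le).pow 2).integrable_of_hasCompactSupport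
          (HasCompactSupport.intro hK fun z hz => by simp [hsupp t (Ioo_subset_Icc_self ht) z hz])
      calc ∫ z in K, (D (t, z) * δ (x - z.1)) ^ 2 ≤ ∫ z in K, Cδ ^ 2 * D (t, z) ^ 2 := by
            refine setIntegral_mono ((hcont.pow 2).continuousOn.integrableOn_compact hK)
              (iD.const_mul _).integrableOn fun z => ?_
            have h1 : δ (x - z.1) ^ 2 ≤ Cδ ^ 2 := by
              rw [← sq_abs (δ _)]
              exact pow_le_pow_left₀ (abs_nonneg _) (hCδ _) 2
            simp only [mul_pow]
            nlinarith [mul_le_mul_of_nonneg_left h1 (sq_nonneg (D (t, z)))]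
        _ ≤ ∫ z, Cδ ^ 2 * D (t, z) ^ 2 := setIntegral_le_integral (iD.const_mul _)
            (Eventually.of_forall fun z => by positivity)
        _ = Cδ ^ 2 * Y t := integral_const_mul _ _
    obtain ⟨E', hE', hle⟩ := exists_hasDerivAt_energy (hh.mono (prod_mono Ioi_subset_Ici_self
      subset_rfl)) ht.1 hbound
    have hEt : ∀ s, 0 < s → E s = ∫ x, coneWeight A (s, x) * energyDensity h (s, x) := fun s hs => by
      simp only [E, he s _ hs]
    refine ⟨E', hE'.congr_of_eventuallyEq ?_, by rwa [hEt t ht.1]⟩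
    filter_upwards [Ioi_mem_nhds ht.1] with s hs using hEt s hs
  -- the growth of the particle density
  have hYd : ∀ t ∈ Ioo 0 T, ∃ Y', HasDerivAt Y Y' t ∧
      Y' ≤ Y t + 3 * Cc ^ 2 * (2 * E t * v) := by
    intro t ht
    have ht' : t ∈ Icc 0 T := Ioo_subset_Icc_self ht
    have hdc : ∀ i, Continuous fun x => dd (eX i) h (t, x) := fun i => by
      simp only [← hPeq t _ ht.1]
      exact (hPc.clm_apply continuousOn_const).comp_continuous (Continuous.prodMk_right t)
        fun x => ⟨ht.1.le, mem_univ x⟩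
    have hSc : Continuous fun z : E3 × E3 => ∑ i, dd (eX i) h (t, z.1) * c i (t, z) :=
      continuous_finsetSum _ fun i _ => ((hdc i).comp continuous_fst).mul
        ((hc i).comp (Continuous.prodMk_right t))
    have hS0 : ∀ z ∉ K, ∑ i, dd (eX i) h (t, z.1) * c i (t, z) = 0 := fun z hz =>
      Finset.sum_eq_zero fun i _ => by rw [hcsupp i t ht' z hz, mul_zero]
    obtain ⟨Y', hY', hle⟩ := exists_hasDerivAt_integral_sq
      (hD.mono (prod_mono Ioi_subset_Ici_self subset_rfl)) hK
      (fun s hs => hsupp s (Ioo_subset_Icc_self hs)) (hF t ht) hSc hS0 ht (hV t ht)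
    refine ⟨Y', hY', hle.trans (add_le_add_right ?_ _)⟩
    have hmc : Continuous fun x => ∑ i, dd (eX i) h (t, x) ^ 2 :=
      continuous_finsetSum _ fun i _ => (hdc i).pow 2
    have h1 : ∫ x in closedBall (0 : E3) r, ∑ i, dd (eX i) h (t, x) ^ 2 ≤ 2 * E t := by
      calc ∫ x in closedBall (0 : E3) r, ∑ i, dd (eX i) h (t, x) ^ 2 ≤
          ∫ x in closedBall (0 : E3) r, 2 * (coneWeight A (t, x) * e (t, x)) := by
            refine setIntegral_mono_on (hmc.continuousOn.integrableOn_compact hKr)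
              ((hweI t ht.1.le).const_mul 2).integrableOn measurableSet_closedBall fun x hx => ?_
            rw [coneWeight_eq_one (r := r) (by simpa using hx) (by linarith [ht.2]), he t x ht.1,
              energyDensity]
            nlinarith [sq_nonneg (dd eT h (t, x)), sq_nonneg (h (t, x))]
        _ ≤ ∫ x, 2 * (coneWeight A (t, x) * e (t, x)) :=
            setIntegral_le_integral ((hweI t ht.1.le).const_mul 2)
              (Eventually.of_forall fun x => mul_nonneg (by norm_num) (hwe0 _))
        _ = 2 * E t := integral_const_mul _ _
    have h2 := integral_sq_sum_le (fun i => hdc i) (fun i => (hc i).comp (Continuous.prodMk_right t))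
      (fun i z hz => hcsupp i t ht' z hz) (fun i z hz => hCc i _ ⟨ht', hz⟩)
    refine h2.trans ?_
    have h3 : 0 ≤ v := measureReal_nonneg
    gcongr
  have hv : 0 ≤ v := measureReal_nonneg
  have ha : 0 ≤ a := measureReal_nonneg
  have hk : 0 ≤ k := measureReal_nonneg
  -- Each quantity drives the other, so only the sum closes; the constant adds the two coupling
  -- coefficients to 1.
  have hZ := eq_zero_of_deriv_le_mul (Z := fun t => Y t + E t)
    (C := 1 + k * Cδ ^ 2 * a + 3 * Cc ^ 2 * 2 * v) (hYcont.add hEcont) (by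
      have e0 : ∀ x, e (0, x) = 0 := fun x => by simp [e, hP0T, hP0X, h0]
      simp [Y, E, hD0, e0]) (fun t _ => add_nonneg (hY0 t) (hE0 t)) (fun t ht => by
      obtain ⟨Y', hY', hYle⟩ := hYd t ht
      obtain ⟨E', hE', hEle⟩ := hEd t ht
      refine ⟨_, hY'.add hE', ?_⟩
      have h1 : 0 ≤ k * Cδ ^ 2 * a * E t := mul_nonneg (by positivity) (hE0 t)
      have h2 : 0 ≤ 3 * Cc ^ 2 * 2 * v * Y t := mul_nonneg (by positivity) (hY0 t)
      nlinarith)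
  intro t ht
  have hYt : Y t = 0 := by linarith [hZ t ht, hY0 t, hE0 t]
  have hEt : E t = 0 := by linarith [hZ t ht, hY0 t, hE0 t]
  refine ⟨fun z => ?_, fun x hx => ?_⟩
  · have iD : Integrable fun z => D (t, z) ^ 2 :=
      ((hDc t ht.1).pow 2).integrable_of_hasCompactSupport
        (HasCompactSupport.intro hK fun z hz => by simp [hsupp t ht z hz])
    have h1 := (integral_eq_zero_iff_of_nonneg (fun z => sq_nonneg _) iD).1 hYt
    have h2 := congrFun (((hDc t ht.1).pow 2).ae_eq_iff_eq volume continuous_zero |>.1 h1) z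
    simpa using h2
  · have h1 := (integral_eq_zero_iff_of_nonneg (fun x => hwe0 _) (hweI t ht.1)).1 hEt
    have h2 := congrFun ((hwe t ht.1).ae_eq_iff_eq volume continuous_zero |>.1 h1) x
    simp only [Pi.zero_apply] at h2
    rw [coneWeight_eq_one (r := r) (by simpa using hx) (by linarith [ht.2]), one_mul] at h2
    have h3 : 0 ≤ ∑ i, P (t, x) (eX i) ^ 2 := Finset.sum_nonneg fun i _ => sq_nonneg _
    have h4 : h (t, x) ^ 2 = 0 := by
      simp only [e] at h2
      nlinarith [sq_nonneg (P (t, x) eT), sq_nonneg (h (t, x))]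
    simpa using h4

end Uniqueness

/-! ### Finite propagation speed and compact support of arbitrary solutions. -/

section FiniteSpeed

theorem hasDerivAt_along {F : E3 → E3} {G : ℝ × E3 × E3 → ℝ} {γ : ℝ → E3 × E3} {t : ℝ}
    (hG : DifferentiableAt ℝ G (t, γ t)) (hγ : HasDerivAt γ (vhat (γ t).2, F (γ t).1) t) :
    HasDerivAt (fun s => G (s, γ s))
      (dd (1, 0) G (t, γ t) + streaming F (fun z => G (t, z)) (γ t)) t := by
  have h1 : HasDerivAt (fun s => (s, γ s)) (1, (vhat (γ t).2, F (γ t).1)) t :=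
    (hasDerivAt_id t).prodMk hγ
  have h2 : HasDerivAt (fun s => G (s, γ s)) (fderiv ℝ G (t, γ t) (1, (vhat (γ t).2, F (γ t).1))) t :=
    HasFDerivAt.comp_hasDerivAt (l := G) (f := fun s => (s, γ s)) t hG.hasFDerivAt h1
  refine h2.congr_deriv ?_
  have h3 : ((1, (vhat (γ t).2, F (γ t).1)) : ℝ × E3 × E3) =
      (1, 0) + (0, (vhat (γ t).2, F (γ t).1)) := by simp
  rw [h3, map_add, ← fderiv_eq_streaming]
  exact congrArg (dd (1, 0) G (t, γ t) + ·) (dd_slice hG (vhat (γ t).2, F (γ t).1)).symm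

/-- A localized force field, extended to negative times. -/
def cutoffField (A : ℝ) (N : ℝ × E3 → E3) (t : ℝ) (x : E3) : E3 :=
  coneWeight A (0, x) • N (|t|, x)

theorem continuous_cutoffField {A : ℝ} {N : ℝ × E3 → E3} (hN : ContinuousOn N (Ici 0 ×ˢ univ)) :
    Continuous (cutoffField A N).uncurry := by
  have h1 : Continuous fun q : ℝ × E3 => coneWeight A (0, q.2) :=
    (contDiff_coneWeight A).continuous.comp (continuous_const.prodMk continuous_snd)
  have h2 : Continuous fun q : ℝ × E3 => N (|q.1|, q.2) :=
    hN.comp_continuous (continuous_fst.abs.prodMk continuous_snd)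
      fun q => ⟨abs_nonneg q.1, mem_univ _⟩
  exact h1.smul h2

/-- An arbitrary solution gives a force that is merely `C¹` on `t ≥ 0`, without bounds at spatial
infinity. The cutoff makes its spatial derivative bounded and `|t|` supplies negative times, so the
global solver applies. -/
theorem cutoffField_lipschitz {A : ℝ} {N : ℝ × E3 → E3} (hN : ContDiffOn ℝ 1 N (Ici 0 ×ˢ univ))
    (T : ℝ) : ∃ L, 0 ≤ L ∧ ∀ t, |t| ≤ T → ∀ x y,
      ‖cutoffField A N t x - cutoffField A N t y‖ ≤ L * ‖x - y‖ := by
  set H : Set (ℝ × E3) := Ici 0 ×ˢ univ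
  have hHu : UniqueDiffOn ℝ H := (uniqueDiffOn_Ici 0).prod uniqueDiffOn_univ
  let Q : ℝ × E3 → E3 := fun p => coneWeight A (0, p.2) • N p
  have hQ : ContDiffOn ℝ 1 Q H :=
    ((contDiff_coneWeight A).comp (contDiff_const.prodMk contDiff_snd)).contDiffOn.smul hN
  obtain ⟨L, hL⟩ := ((isCompact_Icc (a := (0 : ℝ)) (b := T)).prod
    (isCompact_closedBall (0 : E3) A)).exists_bound_of_continuousOn
      (((hQ.continuousOn_fderivWithin hHu (by simp)).clm_comp
        (continuousOn_const (c := ContinuousLinearMap.inr ℝ ℝ E3))).mono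
          (prod_mono Icc_subset_Ici_self (subset_univ _)))
  have hd : ∀ t, 0 ≤ t → ∀ x, HasFDerivAt (fun y => Q (t, y))
      ((fderivWithin ℝ Q H (t, x)).comp (ContinuousLinearMap.inr ℝ ℝ E3)) x := by
    intro t ht x
    have h1 := HasFDerivWithinAt.comp (g := Q) (f := fun y => (t, y)) (s := univ) (t := H) x
      ((hQ.differentiableOn (by simp) (t, x) ⟨ht, mem_univ x⟩).hasFDerivWithinAt)
      (hasFDerivAt_prodMk_right (𝕜 := ℝ) t x).hasFDerivWithinAt fun y _ => ⟨ht, mem_univ y⟩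
    exact hasFDerivWithinAt_univ.1 h1
  refine ⟨|L|, abs_nonneg L, fun t ht x y => ?_⟩
  refine (convex_univ (𝕜 := ℝ) (E := E3)).norm_image_sub_le_of_norm_hasFDerivWithin_le
    (f := cutoffField A N t) (fun z _ => (hd |t| (abs_nonneg t) z).hasFDerivWithinAt)
    (fun z _ => ?_) (mem_univ y) (mem_univ x)
  by_cases hz : z ∈ closedBall (0 : E3) A
  · exact (hL (|t|, z) ⟨⟨abs_nonneg t, ht⟩, hz⟩).trans (le_abs_self L)
  · have h1 : (fun y => Q (|t|, y)) =ᶠ[𝓝 z] fun _ => 0 := by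
      filter_upwards [isClosed_closedBall.isOpen_compl.mem_nhds hz] with y hy
      simp only [Q, coneWeight_eq_zero le_rfl hy, zero_smul]
    rw [(hd |t| (abs_nonneg t) z).unique ((hasFDerivAt_const (0 : E3) z).congr_of_eventuallyEq h1)]
    simp

/-- Solutions of the Vlasov equation with compactly supported initial data have compact support,
locally uniformly in time. -/
theorem exists_support_bound {W : ℝ × E3 → ℝ} (hW : ContDiffOn ℝ 2 W (Ici 0 ×ˢ univ))
    {G : ℝ × E3 × E3 → ℝ} (hG : ContDiffOn ℝ 1 G (Ici 0 ×ˢ univ))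
    (hV : ∀ t, 0 < t → ∀ z, dd (1, 0) G (t, z) + streaming (force W t) (fun z => G (t, z)) z = 0)
    {R : ℝ} (hG0 : ∀ z ∉ closedBall (0 : E3 × E3) R, G (0, z) = 0) (T : ℝ) :
    ∃ r, ∀ t ∈ Icc 0 T, ∀ z ∉ closedBall (0 : E3 × E3) r, G (t, z) = 0 := by
  set H : Set (ℝ × E3) := Ici 0 ×ˢ univ
  have hHu : UniqueDiffOn ℝ H := (uniqueDiffOn_Ici 0).prod uniqueDiffOn_univ
  have hO : ∀ {V : Type} [TopologicalSpace V], IsOpen (Ioi (0 : ℝ) ×ˢ (univ : Set V)) :=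
    isOpen_Ioi.prod isOpen_univ
  -- The force with one-sided derivatives, hence continuous down to `t = 0`.
  let N : ℝ × E3 → E3 := fun p => -∑ i, fderivWithin ℝ W H p (eX i) • ex i
  have hN : ContDiffOn ℝ 1 N H := ContDiffOn.neg (ContDiffOn.sum fun i _ =>
    ((hW.fderivWithin hHu (by norm_num)).clm_apply contDiffOn_const).smul contDiffOn_const)
  have hNeq : ∀ t x, 0 < t → N (t, x) = force W t x := fun t x ht => by
    have : H ∈ 𝓝 ((t, x) : ℝ × E3) :=
      mem_of_superset (hO.mem_nhds ⟨ht, mem_univ x⟩) (prod_mono Ioi_subset_Ici_self subset_rfl)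
    simp only [N, force, dd, fderivWithin_of_mem_nhds this]
  -- Speeds are at most 1, so particles starting in the ball of radius `R` stay within radius `R +
  -- T` up to time `T`; their momenta then grow by at most `|M| * T`.
  obtain ⟨M, hM⟩ := ((isCompact_Icc (a := (0 : ℝ)) (b := T)).prod
    (isCompact_closedBall (0 : E3) (R + T))).exists_bound_of_continuousOn
      (hN.continuousOn.mono (prod_mono Icc_subset_Ici_self (subset_univ _)))
  refine ⟨max (R + T) (R + |M| * T), fun t ht z hz => ?_⟩
  by_contra hne
  refine hz ?_
  have hT : 0 ≤ T := ht.1.trans ht.2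
  -- The cutoff equals 1 on all positions that can be reached backwards from `z` within time `t`, so
  -- it does not affect this characteristic.
  set A := ‖z.1‖ + t + 2
  have hLip : LocUnifLipschitz (charField (cutoffField A N)) :=
    charField_locUnifLipschitz (cutoffField_lipschitz hN)
  have hcont : Continuous (charField (cutoffField A N)).uncurry := by
    have h1 : Continuous fun q : ℝ × E3 × E3 => vhat q.2.2 :=
      (contDiff_vhat (n := 0)).continuous.comp (continuous_snd.comp continuous_snd)
    have h2 : Continuous fun q : ℝ × E3 × E3 => (cutoffField A N).uncurry (q.1, q.2.1) :=
      (continuous_cutoffField hN.continuousOn).comp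
        (continuous_fst.prodMk (continuous_fst.comp continuous_snd))
    exact h1.prodMk h2
  obtain ⟨γ, hγt, hγ⟩ := hLip.exists_solution hcont t z
  have hX : ∀ s, HasDerivAt (fun s => (γ s).1) (vhat (γ s).2) s := fun s =>
    (ContinuousLinearMap.fst ℝ E3 E3).hasFDerivAt.comp_hasDerivAt s (hγ s)
  have hP : ∀ s, HasDerivAt (fun s => (γ s).2) (cutoffField A N s (γ s).1) s := fun s =>
    (ContinuousLinearMap.snd ℝ E3 E3).hasFDerivAt.comp_hasDerivAt s (hγ s)
  have hXL : ∀ s s', ‖(γ s').1 - (γ s).1‖ ≤ |s' - s| := by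
    intro s s'
    have := (convex_univ (𝕜 := ℝ) (E := ℝ)).norm_image_sub_le_of_norm_hasDerivWithin_le
      (fun s _ => (hX s).hasDerivWithinAt) (fun s _ => norm_vhat_le_one (γ s).2) (mem_univ s)
      (mem_univ s')
    simpa using this
  have hcut : ∀ s ∈ Icc 0 t, cutoffField A N s (γ s).1 = N (s, (γ s).1) := by
    intro s hs
    have h1 := hXL t s
    rw [hγt, abs_of_nonpos (by linarith [hs.2])] at h1
    have h2 := norm_sub_norm_le (γ s).1 z.1
    rw [cutoffField, coneWeight_eq_one (r := ‖z.1‖ + t) (by linarith [hs.1]) (by simp [A]),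
      one_smul, abs_of_nonneg hs.1]
  -- The derivative along the characteristic vanishes for positive times; the mean value theorem
  -- needs only continuity at the initial time.
  have hconst : G (t, γ t) = G (0, γ 0) := by
    rcases ht.1.eq_or_lt with h0 | h0
    · rw [← h0]
    have hγc : Continuous γ := continuous_iff_continuousAt.2 fun s => (hγ s).continuousAt
    obtain ⟨s, hs, hs'⟩ := exists_hasDerivAt_eq_slope (fun s => G (s, γ s)) (fun _ => 0) h0
      (hG.continuousOn.comp (continuous_id.prodMk hγc).continuousOn
        fun s hs => ⟨hs.1, mem_univ _⟩) (fun s hs => by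
        have hs' := hγ s
        rw [charField, hcut s (Ioo_subset_Icc_self hs), hNeq s _ hs.1] at hs'
        rw [← hV s hs.1 (γ s)]
        refine hasDerivAt_along ?_ hs'
        exact ((hG.mono (prod_mono Ioi_subset_Ici_self subset_rfl)).contDiffAt
          (hO.mem_nhds (show (s, γ s) ∈ Ioi (0 : ℝ) ×ˢ univ from
            ⟨hs.1, mem_univ _⟩))).differentiableAt (by simp))
    rw [eq_comm, div_eq_zero_iff] at hs'
    rcases hs' with h | h <;> linarith
  have hγ0 : ‖γ 0‖ ≤ R := by
    by_contra h
    rw [← hγt, hconst] at hne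
    exact hne (hG0 _ (by simpa using h))
  have hXb : ∀ s ∈ Icc 0 t, ‖(γ s).1‖ ≤ R + T := by
    intro s hs
    have h1 := hXL 0 s
    rw [sub_zero, abs_of_nonneg hs.1] at h1
    linarith [norm_sub_norm_le (γ s).1 (γ 0).1, norm_fst_le (γ 0), hs.2, ht.2]
  have hPb : ‖z.2‖ ≤ R + |M| * T := by
    have h1 := (convex_Icc (0 : ℝ) t).norm_image_sub_le_of_norm_hasDerivWithin_le (C := |M|)
      (fun s _ => (hP s).hasDerivWithinAt) (fun s hs => by
        rw [hcut s hs]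
        exact (hM (s, (γ s).1) ⟨⟨hs.1, hs.2.trans ht.2⟩, by simpa using hXb s hs⟩).trans
          (le_abs_self M)) (left_mem_Icc.2 ht.1) (right_mem_Icc.2 ht.1)
    rw [hγt, sub_zero, Real.norm_eq_abs, abs_of_nonneg ht.1] at h1
    have h2 := mul_le_mul_of_nonneg_left ht.2 (abs_nonneg M)
    linarith [norm_sub_norm_le z.2 (γ 0).2, norm_snd_le (γ 0)]
  have hXz := hXb t (right_mem_Icc.2 ht.1)
  rw [hγt] at hXz
  rw [mem_closedBall_zero_iff]
  exact max_le (hXz.trans (le_max_left _ _)) (hPb.trans (le_max_right _ _))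

end FiniteSpeed

/-! ### Translation between the classical operators and directional derivatives. -/

section ClassicalOperators

theorem inner_gradient_eq (g : E3 → ℝ) (x y : E3) : inner ℝ (gradient g x) y = fderiv ℝ g x y :=
  InnerProductSpace.toDual_symm_apply

theorem gradient_apply (g : E3 → ℝ) (x : E3) (i : Fin 3) : gradient g x i = dd (ex i) g x := by
  have h := inner_gradient_eq g x (ex i)
  rw [EuclideanSpace.inner_single_right] at h
  simpa [dd] using h

theorem gradient_eq_neg_force {U : ℝ × E3 → ℝ} {t : ℝ} {x : E3}
    (hU : DifferentiableAt ℝ U (t, x)) : gradient (fun y => U (t, y)) x = -force U t x := by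
  ext i
  rw [PiLp.neg_apply, force_apply, gradient_apply, dd_slice hU, neg_neg]

theorem vlasov_eq_streaming {G : ℝ × E3 × E3 → ℝ} {U : ℝ × E3 → ℝ} {t : ℝ} (ht : 0 ≤ t) {x v : E3}
    (hG : DifferentiableAt ℝ G (t, x, v)) (hU : DifferentiableAt ℝ U (t, x)) :
    derivWithin (fun s => G (s, x, v)) (Ici 0) t
      + inner ℝ (vhat v) (gradient (fun y => G (t, y, v)) x)
      - inner ℝ (gradient (fun y => U (t, y)) x) (gradient (fun p => G (t, x, p)) v) =
    dd (1, 0) G (t, x, v) + streaming (force U t) (fun z => G (t, z)) (x, v) := by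
  have h1 : HasFDerivAt (fun z : E3 × E3 => G (t, z)) _ (x, v) :=
    HasFDerivAt.comp (g := G) (f := fun z => (t, z)) (x, v) hG.hasFDerivAt
      (hasFDerivAt_prodMk_right t (x, v))
  have h2 : HasFDerivAt (fun y => G (t, y, v)) _ x :=
    HasFDerivAt.comp (g := fun z : E3 × E3 => G (t, z)) (f := fun y => (y, v)) x h1
      (hasFDerivAt_prodMk_left x v)
  have h3 : HasFDerivAt (fun p => G (t, x, p)) _ v :=
    HasFDerivAt.comp (g := fun z : E3 × E3 => G (t, z)) (f := fun p => (x, p)) v h1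
      (hasFDerivAt_prodMk_right x v)
  rw [(hasDerivAt_slice hG).hasDerivWithinAt.derivWithin (uniqueDiffOn_Ici 0 t ht),
    gradient_eq_neg_force hU, inner_neg_left, real_inner_comm, inner_gradient_eq, real_inner_comm,
    inner_gradient_eq, h2.fderiv, h3.fderiv, sub_neg_eq_add, add_assoc, ← fderiv_eq_streaming,
    h1.fderiv]
  congr 1
  have e : ((vhat v, force U t x) : E3 × E3) = (vhat v, 0) + (0, force U t x) := by simp
  rw [e, map_add]
  rfl

theorem eventually_contDiffAt {V : Type} [NormedAddCommGroup V] [NormedSpace ℝ V] {U : V → ℝ}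
    {p : V} (hU : ContDiffAt ℝ 2 U p) : ∀ᶠ q in 𝓝 p, ContDiffAt ℝ 2 U q :=
  hU.eventually (by norm_num)

theorem dd_dd_slice {U : ℝ × E3 → ℝ} {t : ℝ} {x : E3} (hU : ContDiffAt ℝ 2 U (t, x)) (a b : E3) :
    dd a (dd b fun y => U (t, y)) x = dd (0, a) (dd (0, b) U) (t, x) := by
  have h1 : (dd b fun y => U (t, y)) =ᶠ[𝓝 x] fun y => dd (0, b) U (t, y) := by
    filter_upwards [(Continuous.prodMk_right t).continuousAt.eventually
      (eventually_contDiffAt hU)] with y hy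
    exact dd_slice (hy.differentiableAt (by simp)) b
  rw [← dd_slice ((contDiffAt_one_dd hU _).differentiableAt (by simp)), dd, dd, h1.fderiv_eq]

theorem iteratedDerivWithin_two_eq {U : ℝ × E3 → ℝ} {t : ℝ} (ht : 0 ≤ t) {x : E3}
    (hU : ContDiffAt ℝ 2 U (t, x)) :
    iteratedDerivWithin 2 (fun s => U (s, x)) (Ici 0) t = dd eT (dd eT U) (t, x) := by
  have h1 : iteratedDerivWithin 1 (fun s => U (s, x)) (Ici 0) =ᶠ[𝓝[Ici 0] t]
      fun s => dd eT U (s, x) := by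
    have h2 := (Continuous.prodMk_left x).continuousAt.eventually (eventually_contDiffAt hU)
    filter_upwards [nhdsWithin_le_nhds h2, self_mem_nhdsWithin] with s hs hs0
    rw [iteratedDerivWithin_one]
    exact (hasDerivAt_slice (hs.differentiableAt (by simp))).hasDerivWithinAt.derivWithin
      (uniqueDiffOn_Ici 0 s hs0)
  rw [iteratedDerivWithin_succ, h1.derivWithin_eq (h1.self_of_nhdsWithin ht)]
  exact (hasDerivAt_slice ((contDiffAt_one_dd hU eT).differentiableAt
    (by simp))).hasDerivWithinAt.derivWithin (uniqueDiffOn_Ici 0 t ht)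

theorem laplacian_slice_eq {U : ℝ × E3 → ℝ} {t : ℝ} {x : E3} (hU : ContDiffAt ℝ 2 U (t, x)) :
    (Laplacian.laplacian (fun y => U (t, y)) : E3 → ℝ) x =
      ∑ i, dd (eX i) (dd (eX i) U) (t, x) := by
  have hs : ContDiffAt ℝ 2 (fun y => U (t, y)) x :=
    hU.comp x (contDiff_prodMk_right t).contDiffAt
  rw [InnerProductSpace.laplacian_eq_iteratedFDeriv_orthonormalBasis _
    (EuclideanSpace.basisFun (Fin 3) ℝ)]
  refine Finset.sum_congr rfl fun i _ => ?_
  rw [iteratedFDeriv_two_apply, ← dd_dd_slice hU, dd_dd_eq_of_contDiffAt hs]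
  simp

theorem kleinGordon_eq_kg {U : ℝ × E3 → ℝ} {t : ℝ} (ht : 0 ≤ t) {x : E3}
    (hU : ContDiffAt ℝ 2 U (t, x)) :
    iteratedDerivWithin 2 (fun s => U (s, x)) (Ici 0) t
      - (Laplacian.laplacian (fun y => U (t, y)) : E3 → ℝ) x + U (t, x) = kg U (t, x) := by
  rw [iteratedDerivWithin_two_eq ht hU, laplacian_slice_eq hU, kg]

theorem kg_sub_of_contDiffAt {U W : ℝ × E3 → ℝ} {p : ℝ × E3} (hU : ContDiffAt ℝ 2 U p)
    (hW : ContDiffAt ℝ 2 W p) : kg (fun q => U q - W q) p = kg U p - kg W p := by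
  have h : ∀ a, dd a (dd a fun q => U q - W q) p = dd a (dd a U) p - dd a (dd a W) p := by
    intro a
    have h1 : (dd a fun q => U q - W q) =ᶠ[𝓝 p] fun q => dd a U q - dd a W q := by
      filter_upwards [eventually_contDiffAt hU, eventually_contDiffAt hW] with q h1 h2
      rw [dd, fderiv_fun_sub (h1.differentiableAt (by simp)) (h2.differentiableAt (by simp))]
      rfl
    rw [dd, h1.fderiv_eq, fderiv_fun_sub ((contDiffAt_one_dd hU a).differentiableAt (by simp))
      ((contDiffAt_one_dd hW a).differentiableAt (by simp))]
    rfl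
  simp only [kg, h, Finset.sum_sub_distrib]
  ring

end ClassicalOperators

/-! ### The regularized density as a phase space integral. -/

section Density

variable {δ : E3 → ℝ} {f : ℝ → E3 → E3 → ℝ} {t : ℝ}

theorem integrable_rho (hf : Integrable fun z : E3 × E3 => f t z.1 z.2) :
    Integrable (rho f t) :=
  hf.integral_prod_left

theorem convolutionExistsAt_rho (hδ : Continuous δ) (hδc : HasCompactSupport δ)
    (hf : Integrable fun z : E3 × E3 => f t z.1 z.2) (x : E3) :
    ConvolutionExistsAt (rho f t) δ x (ContinuousLinearMap.mul ℝ ℝ) volume :=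
  hδc.convolutionExists_right _ (integrable_rho hf).locallyIntegrable hδ x

/-- Fubini's theorem. In this form the source can be pulled back along the flow and estimated in
`L²` of phase space. -/
theorem rhoConv_eq_integral (hδ : Continuous δ) (hf : Continuous fun z : E3 × E3 => f t z.1 z.2)
    (hc : HasCompactSupport fun z : E3 × E3 => f t z.1 z.2) (x : E3) :
    rhoConv δ f t x = ∫ z : E3 × E3, f t z.1 z.2 * δ (x - z.1) := by
  have hI : Integrable (fun z : E3 × E3 => f t z.1 z.2 * δ (x - z.1))
      ((volume : Measure E3).prod volume) :=
    (hf.mul (hδ.comp (continuous_const.sub continuous_fst))).integrable_of_hasCompactSupport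
      hc.mul_right
  rw [rhoConv, convolution_def, Measure.volume_eq_prod, integral_prod _ hI]
  refine integral_congr_ae (Eventually.of_forall fun y => ?_)
  simp only [ContinuousLinearMap.mul_apply', rho]
  rw [integral_mul_const]

end Density

/-! ### Uniqueness of classical solutions. -/

section SolutionProperties

variable {δ : E3 → ℝ} {g : ℝ → E3 → E3 → ℝ} {w : ℝ → E3 → ℝ}

theorem contDiffAt_of_halfSpace {V : Type} [NormedAddCommGroup V] [NormedSpace ℝ V] {n : ℕ}
    {H : ℝ × V → ℝ} (hH : ContDiffOn ℝ n H (Ici 0 ×ˢ univ)) {t : ℝ} (ht : 0 < t) (z : V) :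
    ContDiffAt ℝ n H (t, z) :=
  hH.contDiffAt (prod_mem_nhds (Ici_mem_nhds ht) univ_mem)

theorem IsSolution.dd_add_streaming (h : IsSolution δ g w) {t : ℝ} (ht : 0 < t) (z : E3 × E3) :
    dd (1, 0) (fun p : ℝ × E3 × E3 => g p.1 p.2.1 p.2.2) (t, z) +
      streaming (force (fun p => w p.1 p.2) t) (fun z => g t z.1 z.2) z = 0 := by
  rw [← h.vlasov t ht.le z.1 z.2]
  exact (vlasov_eq_streaming (G := fun p : ℝ × E3 × E3 => g p.1 p.2.1 p.2.2)
    (U := fun p => w p.1 p.2) ht.le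
    ((contDiffAt_of_halfSpace (n := 1) h.contDiffOn_f ht _).differentiableAt (by simp))
    ((contDiffAt_of_halfSpace (n := 2) h.contDiffOn_u ht _).differentiableAt (by simp))).symm

theorem IsSolution.kg_eq (h : IsSolution δ g w) {t : ℝ} (ht : 0 < t) (x : E3) :
    kg (fun p => w p.1 p.2) (t, x) = -rhoConv δ g t x := by
  rw [← h.kleinGordon t ht.le x]
  exact (kleinGordon_eq_kg (U := fun p => w p.1 p.2) ht.le
    (contDiffAt_of_halfSpace (n := 2) h.contDiffOn_u ht x)).symm

/-- Solutions with the same initial data agree. -/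
theorem IsSolution.eq_of_contDiff (hδ : Continuous δ) (hδc : HasCompactSupport δ)
    {f₀ : E3 → E3 → ℝ} (hf₀c : HasCompactSupport fun z : E3 × E3 => f₀ z.1 z.2) {u₁ u₂ : E3 → ℝ}
    {f : ℝ → E3 → E3 → ℝ} {u : ℝ → E3 → ℝ}
    (hf : ContDiff ℝ 1 fun p : ℝ × E3 × E3 => f p.1 p.2.1 p.2.2)
    (hs : IsSolution δ f u) (hi : HasInitialData f₀ u₁ u₂ f u)
    (hs' : IsSolution δ g w) (hi' : HasInitialData f₀ u₁ u₂ g w) {t : ℝ} (ht : 0 ≤ t) :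
    (∀ x v, g t x v = f t x v) ∧ ∀ x, w t x = u t x := by
  let F : ℝ × E3 × E3 → ℝ := fun p => f p.1 p.2.1 p.2.2
  let G : ℝ × E3 × E3 → ℝ := fun p => g p.1 p.2.1 p.2.2
  let U : ℝ × E3 → ℝ := fun p => u p.1 p.2
  let W : ℝ × E3 → ℝ := fun p => w p.1 p.2
  obtain ⟨R, hR⟩ := hf₀c.isCompact.isBounded.subset_closedBall 0
  have hF0 : ∀ z ∉ closedBall (0 : E3 × E3) R, F (0, z) = 0 := fun z hz =>
    (hi.f_zero z.1 z.2).trans (image_eq_zero_of_notMem_tsupport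
      (f := fun z : E3 × E3 => f₀ z.1 z.2) fun h => hz (hR h))
  have hG0 : ∀ z ∉ closedBall (0 : E3 × E3) R, G (0, z) = 0 := fun z hz =>
    (hi'.f_zero z.1 z.2).trans (image_eq_zero_of_notMem_tsupport
      (f := fun z : E3 × E3 => f₀ z.1 z.2) fun h => hz (hR h))
  obtain ⟨rF, hrF⟩ := exists_support_bound (W := U) (G := F) hs.contDiffOn_u hs.contDiffOn_f
    (fun s hs0 z => hs.dd_add_streaming hs0 z) hF0 (t + 1)
  obtain ⟨rG, hrG⟩ := exists_support_bound (W := W) (G := G) hs'.contDiffOn_u hs'.contDiffOn_f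
    (fun s hs0 z => hs'.dd_add_streaming hs0 z) hG0 (t + 1)
  suffices key : ∀ x, (∀ z, G (t, z) - F (t, z) = 0) ∧ W (t, x) - U (t, x) = 0 from
    ⟨fun x v => sub_eq_zero.1 ((key 0).1 (x, v)), fun x => sub_eq_zero.1 (key x).2⟩
  intro x
  -- One radius covers the supports of both densities and the point `x` at which the potentials are
  -- compared.
  set r := max (max rF rG) ‖x‖
  have hF : ∀ s ∈ Icc 0 (t + 1), ∀ z ∉ closedBall (0 : E3 × E3) r, F (s, z) = 0 := fun s hs z hz =>
    hrF s hs z fun h => hz (closedBall_subset_closedBall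
      ((le_max_left _ _).trans (le_max_left _ _)) h)
  have hG : ∀ s ∈ Icc 0 (t + 1), ∀ z ∉ closedBall (0 : E3 × E3) r, G (s, z) = 0 := fun s hs z hz =>
    hrG s hs z fun h => hz (closedBall_subset_closedBall
      ((le_max_right _ _).trans (le_max_left _ _)) h)
  have hK : IsCompact (closedBall (0 : E3 × E3) r) := isCompact_closedBall _ _
  have hFd : ∀ p, DifferentiableAt ℝ F p := hf.differentiable (by simp)
  have hGd : ∀ s, 0 < s → ∀ z, DifferentiableAt ℝ G (s, z) := fun s hs z =>
    (contDiffAt_of_halfSpace (n := 1) hs'.contDiffOn_f hs z).differentiableAt (by simp)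
  have hUa : ∀ s, 0 < s → ∀ y, ContDiffAt ℝ 2 U (s, y) := fun s h y =>
    contDiffAt_of_halfSpace (n := 2) hs.contDiffOn_u h y
  have hWa : ∀ s, 0 < s → ∀ y, ContDiffAt ℝ 2 W (s, y) := fun s h y =>
    contDiffAt_of_halfSpace (n := 2) hs'.contDiffOn_u h y
  have hdX : ∀ s, 0 < s → ∀ y a, dd a (fun p => W p - U p) (s, y) =
      dd a W (s, y) - dd a U (s, y) := fun s h y a => by
    rw [dd, fderiv_fun_sub ((hWa s h y).differentiableAt (by simp))
      ((hUa s h y).differentiableAt (by simp))]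
    rfl
  have hcont : ∀ {H : ℝ × E3 × E3 → ℝ}, ContDiffOn ℝ 1 H (Ici 0 ×ˢ univ) → ∀ s, 0 ≤ s →
      Continuous fun z => H (s, z) := fun hH s hs =>
    hH.continuousOn.comp_continuous (Continuous.prodMk_right s) fun z => ⟨hs, mem_univ z⟩
  have := eq_zero_of_linearized hδ hδc (h := fun p => W p - U p)
    (hs'.contDiffOn_u.sub hs.contDiffOn_u) (fun y => by
      simp only [W, U, hi.u_zero, hi'.u_zero, sub_self]) (fun y => by
      have hd : ∀ {w : ℝ → E3 → ℝ}, ContDiffOn ℝ 2 (fun p : ℝ × E3 => w p.1 p.2) (Ici 0 ×ˢ univ) →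
          DifferentiableWithinAt ℝ (fun s => w s y) (Ici 0) 0 := fun hw =>
        DifferentiableOn.comp (g := fun p : ℝ × E3 => _) (f := fun s : ℝ => (s, y))
          (hw.differentiableOn (by simp)) (by fun_prop) (fun s hs => ⟨hs, mem_univ _⟩) 0 self_mem_Ici
      have := derivWithin_fun_sub (hd hs'.contDiffOn_u) (hd hs.contDiffOn_u)
      rw [hi.deriv_u_zero, hi'.deriv_u_zero, sub_self] at this
      exact this)
    (D := fun p => G p - F p) (hs'.contDiffOn_f.sub hs.contDiffOn_f) (fun z => by
      simp only [G, F, hi.f_zero, hi'.f_zero, sub_self]) (T := t + 1) (r := r) (fun s hs z hz => by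
      rw [hF s hs z hz, hG s hs z hz, sub_self]) (F := force W) (fun s hs i => by
      simp only [force_apply]
      exact (contDiffOn_univ.1 ((contDiffOn_one_dd (hs'.contDiffOn_u.mono
        (prod_mono Ioi_subset_Ici_self subset_rfl)) (eX i)).comp
          (contDiff_prodMk_right s).contDiffOn fun y _ => ⟨hs.1, mem_univ y⟩)).neg)
    -- Splitting the difference of the nonlinear terms leaves the force of `W` on `G - F` and puts
    -- the momentum gradient of `F` in the source. `F` is `C¹` for all real times, so this
    -- coefficient is continuous everywhere.
    (c := fun i => dd (0, zV i) F) (fun i => continuous_dd hf _) (fun i s hs z hz => by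
      rw [← dd_slice (hFd _), dd]
      have : (fun z => F (s, z)) =ᶠ[𝓝 z] fun _ => 0 := by
        filter_upwards [isClosed_closedBall.isOpen_compl.mem_nhds hz] with y hy using hF s hs y hy
      rw [this.fderiv_eq]
      simp) (fun s h z => by
      have e1 := hs.dd_add_streaming h.1 z
      have e2 := hs'.dd_add_streaming h.1 z
      have e3 : dd (1, 0) (fun p => G p - F p) (s, z) = dd (1, 0) G (s, z) - dd (1, 0) F (s, z) := by
        rw [dd, fderiv_fun_sub (hGd s h.1 z) (hFd _)]
        rfl
      have e4 : ∀ a, dd a (fun z => G (s, z) - F (s, z)) z =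
          dd a (fun z => G (s, z)) z - dd a (fun z => F (s, z)) z := fun a => by
        rw [dd_slice (H := fun p => G p - F p) ((hGd s h.1 z).fun_sub (hFd _)), dd_slice (hGd s h.1 z),
          dd_slice (hFd _), dd, fderiv_fun_sub (hGd s h.1 z) (hFd _)]
        rfl
      rw [e3]
      simp only [hdX s h.1, ← dd_slice (hFd _)]
      unfold streaming at e1 e2 ⊢
      simp only [e4, force_apply, Fin.sum_univ_three] at e1 e2 ⊢
      change dd (1, 0) F (s, z) + _ = 0 at e1
      change dd (1, 0) G (s, z) + _ = 0 at e2
      linear_combination e2 - e1) (fun s h y => by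
      have hGc : HasCompactSupport fun z => G (s, z) :=
        HasCompactSupport.intro hK (hG s (Ioo_subset_Icc_self h))
      have hFc : HasCompactSupport fun z => F (s, z) :=
        HasCompactSupport.intro hK (hF s (Ioo_subset_Icc_self h))
      have hGs := hcont hs'.contDiffOn_f s h.1.le
      have hFs := hcont hs.contDiffOn_f s h.1.le
      have hδy : Continuous fun z : E3 × E3 => δ (y - z.1) :=
        hδ.comp (continuous_const.sub continuous_fst)
      rw [kg_sub_of_contDiffAt (hWa s h.1 y) (hUa s h.1 y), hs.kg_eq h.1, hs'.kg_eq h.1,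
        rhoConv_eq_integral hδ hGs hGc, rhoConv_eq_integral hδ hFs hFc]
      simp only [sub_mul]
      rw [integral_sub (f := fun z : E3 × E3 => G (s, z) * δ (y - z.1))
        (g := fun z : E3 × E3 => F (s, z) * δ (y - z.1)) ((hGs.mul hδy).integrable_of_hasCompactSupport hGc.mul_right)
        ((hFs.mul hδy).integrable_of_hasCompactSupport hFc.mul_right)]
      simp only [G, F]
      ring) t ⟨ht, by linarith⟩
  exact ⟨this.1, this.2 x (by simp [r])⟩

end SolutionProperties

/-! ### From Lagrangian to classical solutions. -/

section Existence

/-- A Lagrangian solution yields a global classical solution. -/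
theorem isSolution_of_flow {δ : E3 → ℝ} (hδ : ContDiff ℝ 1 δ) (hδc : HasCompactSupport δ)
    {a : E3 × E3 → ℝ} (ha : ContDiff ℝ 1 a) (hac : HasCompactSupport a) {U : ℝ × E3 → ℝ}
    (hU : ContDiff ℝ 2 U) {Φ Ψ : ℝ → E3 × E3 → E3 × E3} (hΦ : IsFlow (charField (force U)) Φ Ψ)
    (hkg : ∀ t x, kg U (t, x) = -∫ z, a z * δ (x - (Φ t z).1)) :
    IsSolution δ (fun t x v => a (Ψ t (x, v))) (fun t x => U (t, x)) := by
  have hF : ContDiff ℝ 1 fun p : ℝ × E3 × E3 => a (Ψ p.1 p.2) := ha.comp hΦ.contDiff_inv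
  have hFt : ∀ t, ContDiff ℝ 1 fun z => a (Ψ t z) := fun t => hF.comp (contDiff_prodMk_right t)
  have hFc : ∀ t, HasCompactSupport fun z => a (Ψ t z) := fun t =>
    HasCompactSupport.intro (hac.isCompact.image (f := Φ t)
      (hΦ.contDiff.continuous.comp (Continuous.prodMk_right t))) fun z hz =>
        image_eq_zero_of_notMem_tsupport fun h => hz ⟨_, h, hΦ.right_inv t z⟩
  have hFI : ∀ t, Integrable fun z => a (Ψ t z) := fun t =>
    (hFt t).continuous.integrable_of_hasCompactSupport (hFc t)
  refine ⟨hF.contDiffOn, hU.contDiffOn, fun t _ x => ?_, fun t _ x => ?_, fun t ht x v => ?_,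
    fun t ht x => ?_⟩
  · refine ((hFt t).continuous.comp (Continuous.prodMk_right x)).integrable_of_hasCompactSupport
      (HasCompactSupport.intro ((hFc t).isCompact.image continuous_snd) fun v hv => ?_)
    exact image_eq_zero_of_notMem_tsupport (f := fun z => a (Ψ t z)) fun h => hv ⟨_, h, rfl⟩
  · exact convolutionExistsAt_rho (f := fun t x v => a (Ψ t (x, v))) hδ.continuous hδc (hFI t) x
  · refine Eq.trans ?_ (hΦ.transport ha t (x, v))
    exact vlasov_eq_streaming (G := fun p : ℝ × E3 × E3 => a (Ψ p.1 p.2)) (x := x) (v := v) ht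
      (hF.differentiable (by simp) _) (hU.differentiable (by simp) _)
  -- Liouville's theorem turns the Eulerian source `∫ a(Ψ t z) δ(x - z.1) dz` into the Lagrangian
  -- one of `hkg`.
  · rw [rhoConv_eq_integral (f := fun t x v => a (Ψ t (x, v))) hδ.continuous (hFt t).continuous
      (hFc t), hΦ.integral_comp_inv_mul (fun t => contDiff_force_apply hU t) ha hac
        (ψ := fun z => δ (x - z.1)) (hδ.comp (contDiff_const.sub contDiff_fst)) t, ← hkg]
    exact kleinGordon_eq_kg ht hU.contDiffAt

theorem IsFlow.inv_zero {b Φ Ψ : ℝ → E3 × E3 → E3 × E3} (hΦ : IsFlow b Φ Ψ) (z : E3 × E3) :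
    Ψ 0 z = z := by
  have := hΦ.left_inv 0 z
  rwa [hΦ.zero] at this

end Existence

end VlasovKleinGordon

end

theorem theorem3p1
    (δ : VlasovKleinGordon.E3 → ℝ)
    (hδ : ContDiff ℝ ∞ δ) (hδc : HasCompactSupport δ)
    (f₀ : VlasovKleinGordon.E3 → VlasovKleinGordon.E3 → ℝ)
    (hf₀ : ContDiff ℝ 1 (fun z : VlasovKleinGordon.E3 × VlasovKleinGordon.E3 => f₀ z.1 z.2))
    (hf₀c : HasCompactSupport
      (fun z : VlasovKleinGordon.E3 × VlasovKleinGordon.E3 => f₀ z.1 z.2))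
    (hf₀pos : ∀ x v, 0 ≤ f₀ x v)
    (u₁ u₂ : VlasovKleinGordon.E3 → ℝ)
    (hu₁ : VlasovKleinGordon.IsCb 3 u₁) (hu₂ : VlasovKleinGordon.IsCb 2 u₂) :
    ∃ (f : ℝ → VlasovKleinGordon.E3 → VlasovKleinGordon.E3 → ℝ)
      (u : ℝ → VlasovKleinGordon.E3 → ℝ),
      VlasovKleinGordon.IsSolution δ f u ∧
      VlasovKleinGordon.HasInitialData f₀ u₁ u₂ f u ∧
      (∀ t, 0 ≤ t → ∀ x v, 0 ≤ f t x v) ∧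
      ∀ (g : ℝ → VlasovKleinGordon.E3 → VlasovKleinGordon.E3 → ℝ)
        (w : ℝ → VlasovKleinGordon.E3 → ℝ),
        VlasovKleinGordon.IsSolution δ g w →
        VlasovKleinGordon.HasInitialData f₀ u₁ u₂ g w →
        (∀ t, 0 ≤ t → ∀ x v, g t x v = f t x v) ∧
        (∀ t, 0 ≤ t → ∀ x, w t x = u t x) := by
  obtain ⟨U, Φ, Ψ, hU, hU₁, hU₂, hΦ, hkg⟩ :=
    VlasovKleinGordon.exists_lagrangian_solution hδ hδc hf₀.continuous hf₀c hu₁ hu₂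
  have hs := VlasovKleinGordon.isSolution_of_flow (hδ.of_le (by exact_mod_cast le_top)) hδc hf₀
    hf₀c hU hΦ hkg
  have hi : VlasovKleinGordon.HasInitialData f₀ u₁ u₂
      (fun t x v => f₀ (Ψ t (x, v)).1 (Ψ t (x, v)).2) (fun t x => U (t, x)) := by
    refine ⟨fun x v => ?_, hU₁, fun x => ?_⟩
    · rw [hΦ.inv_zero]
    · rw [← hU₂ x]
      exact (VlasovKleinGordon.hasDerivAt_time
        (hU.differentiable (by simp) _)).hasDerivWithinAt.derivWithin
          (uniqueDiffOn_Ici 0 0 self_mem_Ici)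
  -- The density is `f₀` evaluated at transported points, so it inherits the sign of `f₀`.
  refine ⟨_, _, hs, hi, fun t _ x v => hf₀pos _ _, fun g w hs' hi' => ?_⟩
  have key := fun t (ht : 0 ≤ t) => VlasovKleinGordon.IsSolution.eq_of_contDiff hδ.continuous hδc
    hf₀c (hf₀.comp hΦ.contDiff_inv) hs hi hs' hi' ht
  exact ⟨fun t ht => (key t ht).1, fun t ht => (key t ht).2⟩
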